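/- **Theorem.** Let $\emptyset'$ be the halting problem. A *total cost functional* is a Turing functional $\mathbf c^Z(x,t)$ that is total and takes values in the nonnegative rationals for every oracle $Z\subseteq\mathbb N$. It is *nondecreasing in the stage* if, for every $Z$, $\mathbf c^Z(x,s)=0$ for $x>s$ and $\mathbf c^Z(x,s)\le \mathbf c^Z(x,s+1)$ for all $x,s$; it *satisfies the limit condition for every oracle* if $\lim_x\liminf_s \mathbf c^Z(x,s)=0$ for every $Z$. For a set $A$, write $A\models^Z \mathbf c^Z$ if there is a $Z$-computable sequence of finite sets $(A_s)_{s\in\mathbb N}$ with $\lim_s A_s(x)=A(x)$ for every $x$, such that the total cost $$\sum_{x,s}\ \mathbf c^Z(x,s)\,\bigl[\,x<s \text{ and } x \text{ is least such that } A_{s-1}(x)\ne A_s(x)\,\bigr]$$ is finite. (1) Let $\mathbf c$ be a total cost functional that is nondecreasing in the stage and satisfies the limit condition for every oracle. Then there is a c.e. set $D$ with $\emptyset'\not\le_T D$ such that $\emptyset'\models^D\mathbf c^D$. (2) Let $\mathbf c_K^Z(x,s)=\sum_{x<w\le s}2^{-K_s^Z(w)}$, where $K^Z_s(w)$ is the length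 of a shortest program for $w$ of a universal prefix-free oracle machine with oracle $Z$ at stage $s$ ($K^Z_s(w)=\infty$ if there is none or if $w\ge s$, and $2^{-\infty}=0$). Then $\mathbf c_K$ is a total cost functional that is nondecreasing in the stage and satisfies the limit condition for every oracle, and there is a c.e. set $D$ with $\emptyset'\not\le_T D$ and $\emptyset'\models^D\mathbf c_K^D$ which is LR-complete, that is, every sequence that is Martin-Löf random relative to $D$ is Martin-Löf random relative to $\emptyset'$. -/

import Mathlib

open Filter Topology MeasureTheory

noncomputable section

namespace CostFn

/-! ### Oracles, Turing functionals, the halting problem -/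

open Classical in
/-- The first `l` bits of (the characteristic function of) the set `Z`. -/
def restr (Z : Set ℕ) (l : ℕ) : List Bool :=
  (List.range l).map fun i => decide (i ∈ Z)

open Classical in
/-- The characteristic function of a set, in the form in which Mathlib uses it as an oracle. -/
def charFn (Z : Set ℕ) : ℕ →. ℕ :=
  fun n => Part.some (if n ∈ Z then 1 else 0)

/-- `A ≤_T B`. -/
def TuringLE (A B : Set ℕ) : Prop := TuringReducible (charFn A) (charFn B)

/-- `S` is c.e. relative to `Z`: it is the domain of a function partial computable in `Z`. -/
def CEIn {α : Type*} [Primcodable α] (Z : Set ℕ) (S : Set α) : Prop :=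
  RecursiveIn {charFn Z} fun a : α => Part.assert (a ∈ S) fun _ => Part.some ()

/-- `S` is computably enumerable. -/
def CE (S : Set ℕ) : Prop := REPred fun n => n ∈ S

/-- The halting problem `∅' = {e : φ_e(e) ↓}`. -/
def halting : Set ℕ :=
  {e | (Nat.Partrec.Code.eval (Denumerable.ofNat Nat.Partrec.Code e) e).Dom}

/-- Attempt number `m = ⟨k, l⟩` at computing `Φ_e^Z(x)`: run the program `e` for `k` steps on the
input `x` together with the finite oracle information `Z ↾ l`. -/
def attempt (e : Nat.Partrec.Code) (Z : Set ℕ) (x m : ℕ) : Option ℕ :=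
  Nat.Partrec.Code.evaln m.unpair.1 e (Encodable.encode (restr Z m.unpair.2, x))

/-- The Turing functional `Φ_e`: the value `Φ_e^Z(x)` is the result of the first attempt that
halts. Every Turing functional arises in this way (take for `e` a program which, on input `(σ, x)`,
simulates the functional on `x`, answers oracle queries from `σ`, and diverges when a query is
not below the length of `σ`), and every `Φ_e` is a Turing functional. -/
def functional (e : Nat.Partrec.Code) (Z : Set ℕ) (x : ℕ) : Part ℕ :=
  Nat.rfindOpt (attempt e Z x)

/-- `Φ_{e,s}^Z(x)`: only the attempts `m < s` are made (so only numbers below `s` are queried). -/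
def functionalStage (e : Nat.Partrec.Code) (Z : Set ℕ) (x s : ℕ) : Option ℕ :=
  (List.range s).findSome? (attempt e Z x)

/-! ### Cost functionals and obedience relative to an oracle -/

/-- A total cost functional: a single Turing functional computes, for every oracle `Z`, the
nonnegative rational `c^Z(x,t)` (as a pair numerator, denominator) from `x` and `t`. -/
def IsTotalCostFunctional (c : Set ℕ → ℕ → ℕ → ℚ≥0) : Prop :=
  ∃ e : Nat.Partrec.Code, ∀ (Z : Set ℕ) (x t : ℕ),
    functional e Z (Nat.pair x t) = Part.some (Nat.pair (c Z x t).num (c Z x t).den)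

/-- `c` is nondecreasing in the stage: `c(x,s) = 0` for `x > s`, and `c(x,s) ≤ c(x,s+1)`. -/
def NondecreasingInStage (c : ℕ → ℕ → ℚ≥0) : Prop :=
  (∀ x s, s < x → c x s = 0) ∧ ∀ x s, c x s ≤ c x (s + 1)

/-- A nonnegative rational as an extended nonnegative real. -/
def toENNReal (q : ℚ≥0) : ENNReal := ((q : NNReal) : ENNReal)

/-- The limit condition `lim_x liminf_s c(x,s) = 0`. -/
def LimitCondition (c : ℕ → ℕ → ℚ≥0) : Prop :=
  Tendsto (fun x => liminf (fun s => toENNReal (c x s)) atTop) atTop (𝓝 0)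

/-- `⟨A_s⟩` is a `Z`-computable approximation of `A`: a sequence of finite sets, given by their
canonical indices `∑_{x ∈ A_s} 2^x` as a function of `s` computable in `Z`, with
`lim_s A_s(x) = A(x)` for every `x`. -/
def IsApproximation (Z : Set ℕ) (As : ℕ → Finset ℕ) (A : Set ℕ) : Prop :=
  ComputableIn {charFn Z} (fun s => ∑ x ∈ As s, 2 ^ x) ∧
    ∀ x, ∀ᶠ s in atTop, x ∈ As s ↔ x ∈ A

open Classical in
/-- The total cost of the changes of `⟨A_s⟩`: the sum of `c(x,s)` over all `x, s` such that `x < s`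
and `x` is least with `A_{s-1}(x) ≠ A_s(x)`. (For `s = 0` no `x` qualifies.) -/
def totalCost (c : ℕ → ℕ → ℚ≥0) (As : ℕ → Finset ℕ) : ENNReal :=
  ∑' s, ∑' x, if x < s ∧ IsLeast {y | ¬ (y ∈ As (s - 1) ↔ y ∈ As s)} x
    then toENNReal (c x s) else 0

/-- `A ⊨^Z c`: some `Z`-computable approximation of `A` has finite total cost. -/
def Obeys (Z : Set ℕ) (c : ℕ → ℕ → ℚ≥0) (A : Set ℕ) : Prop :=
  ∃ As : ℕ → Finset ℕ, IsApproximation Z As A ∧ totalCost c As < ⊤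

/-! ### Prefix-free complexity relative to an oracle, and the cost functional for K-triviality -/

/-- The `e`-th prefix-free oracle machine at stage `s`, as a finite list of pairs
(program, output). At stage `s + 1` one string `σ` is considered (each string is considered at
infinitely many stages); if `Φ_{e,s}^Z(σ) = y` and `σ` is incomparable with all programs already in
the domain, then `(σ, y)` is added. If `Φ_e^Z` has prefix-free domain then nothing gets lost. -/
def pfMachineStage (Z : Set ℕ) (e : Nat.Partrec.Code) : ℕ → List (List Bool × ℕ)
  | 0 => []
  | s + 1 =>
    match (Encodable.decode s.unpair.1 : Option (List Bool)) with
    | none => pfMachineStage Z e s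
    | some σ =>
      match functionalStage e Z (Encodable.encode σ) s with
      | none => pfMachineStage Z e s
      | some y =>
        if ∀ p ∈ pfMachineStage Z e s, ¬ σ <+: p.1 ∧ ¬ p.1 <+: σ then
          (σ, y) :: pfMachineStage Z e s
        else pfMachineStage Z e s

/-- The universal prefix-free oracle machine at stage `s`: `𝕌^Z(0^e 1 σ) = M_e^Z(σ)`, where
only the machines with index `e < s` are used, each up to stage `s`. -/
def universalStage (Z : Set ℕ) (s : ℕ) : List (List Bool × ℕ) :=
  (List.range s).flatMap fun e =>
    (pfMachineStage Z (Denumerable.ofNat Nat.Partrec.Code e) s).map fun p =>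
      (List.replicate e false ++ true :: p.1, p.2)

/-- `K_s^Z(w) = min {|σ| : 𝕌_s^Z(σ) = w}`, with `K_s^Z(w) = ∞` if there is no such `σ` or
if `w ≥ s`. -/
def KStage (Z : Set ℕ) (s w : ℕ) : WithTop ℕ :=
  if s ≤ w then ⊤
  else (((universalStage Z s).filter fun p => p.2 = w).map fun p => p.1.length).minimum

/-- `2^{-k}`, where `2^{-∞} = 0`. -/
def twoPowNeg : WithTop ℕ → ℚ≥0
  | ⊤ => 0
  | (k : ℕ) => (1 / 2) ^ k

/-- The cost functional for `K`-triviality, `c_K^Z(x,s) = ∑_{x < w ≤ s} 2^{-K_s^Z(w)}`. -/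
def costK (Z : Set ℕ) (x s : ℕ) : ℚ≥0 :=
  ∑ w ∈ Finset.Ioc x s, twoPowNeg (KStage Z s w)

/-! ### Martin-Löf randomness relative to an oracle, and LR-reducibility -/

/-- The uniform (fair coin) measure on Cantor space. -/
def coinMeasure : Measure (ℕ → Bool) :=
  Measure.infinitePi fun _ : ℕ => (PMF.uniformOfFintype Bool).toMeasure

/-- The basic open set of all infinite sequences that extend the string `σ`. -/
def cylinder (σ : List Bool) : Set (ℕ → Bool) :=
  {X | ∀ i (h : i < σ.length), X i = σ[i]}

/-- The open set `⋃_{(n,σ) ∈ S} [σ]`, the `n`-th component of the sequence of open sets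
described by `S`. -/
def testComponent (S : Set (ℕ × List Bool)) (n : ℕ) : Set (ℕ → Bool) :=
  {X | ∃ σ, (n, σ) ∈ S ∧ X ∈ cylinder σ}

/-- `X` is Martin-Löf random relative to `Z`: it passes every Martin-Löf test relative to `Z`, that
is, every sequence of open sets `U_n`, uniformly c.e. in `Z`, such that the measure of `U_n` is at
most `2^{-n}`. -/
def MLRandom (Z : Set ℕ) (X : ℕ → Bool) : Prop :=
  ∀ S : Set (ℕ × List Bool), CEIn Z S →
    (∀ n, coinMeasure (testComponent S n) ≤ (2 : ENNReal)⁻¹ ^ n) →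
    ∃ n, X ∉ testComponent S n

/-- `A ≤_LR B`: every sequence that is Martin-Löf random relative to `B` is
Martin-Löf random relative to `A`. -/
def LRLE (A B : Set ℕ) : Prop := ∀ X, MLRandom B X → MLRandom A X

/-- `D` is LR-complete: `∅' ≤_LR D`. -/
def LRComplete (D : Set ℕ) : Prop := LRLE halting D

end CostFn

end

/-! The set `D` consists of the pairs ⟨y,k⟩ such that y enters ∅' and chooses the marker k ≥ y at
that moment. From `D` one can tell when every event with marker below r has happened
(`settled_of_check`), hence compute the list of events up to the last such one, `limTrunc P r`. The
numbers entering in these lists form an increasing `D`-computable approximation of ∅'. A requirement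
e may impose an instance (e,n,r), which forces numbers y ≥ n to choose markers at least r. An event
with a marker below r cancels the instance, so only numbers below n can injure it.

Incompleteness. Let E be the set of ⟨e,n⟩ such that some instance (e,n,r) is permanent. Then E ≤_T
∅': once the part of ∅' below n has been enumerated, no instance (e,n,r) can be cancelled any more
(`turingLE_permanentSet`). If ∅' ≤_T `D`, then E is computed from `D` by some functional Φ_e.
Requirement e acts only when it sees Φ_e(⟨e,n⟩) = 0 with use at most r, and its restraint preserves
this computation. A permanent instance thus makes Φ_e wrong about E. Without one, Φ_e must give 0 at
every ⟨e,n⟩, and for suitable n the requirement is eligible in the limit; by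
`eligible_false_of_not_permanent` it would then have a permanent instance.

Cost. A change of the approximation at x < s is caused by a permanent instance (e,n,s) with n ≤ x
(`exists_permanent_of_change`). Each e has at most one permanent instance, so it pays at most once.
Eligibility also demands that the costs c(x,t) with x ≥ n that are seen to converge are at most
2^{-e}, which the limit condition for `D` makes possible for large n. Speeding up the approximation
so that the relevant costs have converged before each change bounds the total by ∑ 2^{-e}
(`totalCost_lt_top`).

LR-completeness. Given a test relative to ∅', collect everything it accepts along the approximations
of ∅', cut off at the permitted measure. The measure of the union exceeds that bound by at most the
sum of the losses, that is, of what becomes obsolete when an approximation changes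
(`measure_iUnion_le_of_losses`). Eligibility requires the loss chargeable to e to be at most
2^{-(e+i)} for components i ≤ e of tests j ≤ e, so the total loss is finite (`sum_loss_le`). The
same finiteness shows that this demand holds in the limit for all large n (`exists_forall_lrGood`).
There is no circularity, because only permanent instances cause losses, and these already satisfy
the demand.

For the cost functional of K-triviality, Kraft's inequality bounds costs by tails of a convergent
series. The functional is total since its value at stage t depends only on the first t oracle bits.
-/

namespace CostFn

/-! ### Primitive recursive functions and `fun_prop` -/

attribute [fun_prop] Primrec
attribute [fun_prop] Primrec.id Primrec.const Primrec.fst Primrec.snd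

section PrimrecFunProp

variable {α β γ δ σ : Type*} [Primcodable α] [Primcodable β] [Primcodable γ] [Primcodable δ]
  [Primcodable σ]

@[fun_prop]
theorem primrec_comp {f : β → σ} {g : α → β} (hf : Primrec f) (hg : Primrec g) :
    Primrec fun a => f (g a) := hf.comp hg

@[fun_prop]
theorem primrec_pair {f : α → β} {g : α → γ} (hf : Primrec f) (hg : Primrec g) :
    Primrec fun a => (f a, g a) := hf.pair hg

@[fun_prop]
theorem primrec_fst {f : α → β × γ} (hf : Primrec f) : Primrec fun a => (f a).1 :=
  Primrec.fst.comp hf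

@[fun_prop]
theorem primrec_snd {f : α → β × γ} (hf : Primrec f) : Primrec fun a => (f a).2 :=
  Primrec.snd.comp hf

@[fun_prop]
theorem primrec_add {f g : α → ℕ} (hf : Primrec f) (hg : Primrec g) :
    Primrec fun a => f a + g a := Primrec.nat_add.comp hf hg

@[fun_prop]
theorem primrec_sub {f g : α → ℕ} (hf : Primrec f) (hg : Primrec g) :
    Primrec fun a => f a - g a := Primrec.nat_sub.comp hf hg

@[fun_prop]
theorem primrec_mul {f g : α → ℕ} (hf : Primrec f) (hg : Primrec g) :
    Primrec fun a => f a * g a := Primrec.nat_mul.comp hf hg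

@[fun_prop]
theorem primrec_div {f g : α → ℕ} (hf : Primrec f) (hg : Primrec g) :
    Primrec fun a => f a / g a := Primrec.nat_div.comp hf hg

@[fun_prop]
theorem primrec_mod {f g : α → ℕ} (hf : Primrec f) (hg : Primrec g) :
    Primrec fun a => f a % g a := Primrec.nat_mod.comp hf hg

@[fun_prop]
theorem primrec_max {f g : α → ℕ} (hf : Primrec f) (hg : Primrec g) :
    Primrec fun a => max (f a) (g a) := Primrec.nat_max.comp hf hg

@[fun_prop]
theorem primrec_pow {f g : α → ℕ} (hf : Primrec f) (hg : Primrec g) :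
    Primrec fun a => f a ^ g a :=
  (Primrec₂.unpaired'.1 Nat.Primrec.pow).comp hf hg

@[fun_prop]
theorem primrec_natPair {f g : α → ℕ} (hf : Primrec f) (hg : Primrec g) :
    Primrec fun a => Nat.pair (f a) (g a) := Primrec₂.natPair.comp hf hg

@[fun_prop]
theorem primrec_unpair {f : α → ℕ} (hf : Primrec f) : Primrec fun a => Nat.unpair (f a) :=
  Primrec.unpair.comp hf

@[fun_prop]
theorem primrec_encode {g : α → β} (hg : Primrec g) : Primrec fun a => Encodable.encode (g a) :=
  Primrec.encode.comp hg

@[fun_prop]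
theorem primrec_decode {g : α → ℕ} (hg : Primrec g) :
    Primrec fun a => (Encodable.decode (g a) : Option β) :=
  Primrec.decode.comp hg

@[fun_prop]
theorem primrec_code {g : α → ℕ} (hg : Primrec g) :
    Primrec fun a => Denumerable.ofNat Nat.Partrec.Code (g a) :=
  (Primrec.ofNat Nat.Partrec.Code).comp hg

@[fun_prop]
theorem primrec_evaln {f : α → ℕ} {c : α → Nat.Partrec.Code} {g : α → ℕ} (hf : Primrec f)
    (hc : Primrec c) (hg : Primrec g) :
    Primrec fun a => Nat.Partrec.Code.evaln (f a) (c a) (g a) :=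
  Nat.Partrec.Code.primrec_evaln.comp ((hf.pair hc).pair hg)

@[fun_prop]
theorem primrec_band {f g : α → Bool} (hf : Primrec f) (hg : Primrec g) :
    Primrec fun a => (f a && g a) := Primrec.and.comp hf hg

@[fun_prop]
theorem primrec_bor {f g : α → Bool} (hf : Primrec f) (hg : Primrec g) :
    Primrec fun a => (f a || g a) := Primrec.or.comp hf hg

@[fun_prop]
theorem primrec_bnot {f : α → Bool} (hf : Primrec f) : Primrec fun a => !(f a) :=
  Primrec.not.comp hf

@[fun_prop]
theorem primrec_cond {c : α → Bool} {f g : α → σ} (hc : Primrec c) (hf : Primrec f)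
    (hg : Primrec g) : Primrec fun a => bif c a then f a else g a := Primrec.cond hc hf hg

@[fun_prop]
theorem primrec_blt {f g : α → ℕ} (hf : Primrec f) (hg : Primrec g) :
    Primrec fun a => Nat.blt (f a) (g a) :=
  ((Primrec.nat_lt.comp hf hg).decide).of_eq fun a => by
    rw [Bool.eq_iff_iff]; simp

@[fun_prop]
theorem primrec_ble {f g : α → ℕ} (hf : Primrec f) (hg : Primrec g) :
    Primrec fun a => Nat.ble (f a) (g a) :=
  ((Primrec.nat_le.comp hf hg).decide).of_eq fun a => by
    rw [Bool.eq_iff_iff]; simp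

@[fun_prop]
theorem primrec_beq [DecidableEq β] [BEq β] [LawfulBEq β] {f g : α → β} (hf : Primrec f)
    (hg : Primrec g) : Primrec fun a => (f a == g a) :=
  ((Primrec.eq.comp hf hg).decide).of_eq fun a => by
    rw [Bool.eq_iff_iff]; simp

@[fun_prop]
theorem primrec_some {f : α → β} (hf : Primrec f) : Primrec fun a => some (f a) :=
  Primrec.option_some.comp hf

@[fun_prop]
theorem primrec_isSome {f : α → Option β} (hf : Primrec f) : Primrec fun a => (f a).isSome :=
  Primrec.option_isSome.comp hf

@[fun_prop]
theorem primrec_getD {f : α → Option β} {g : α → β} (hf : Primrec f) (hg : Primrec g) :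
    Primrec fun a => (f a).getD (g a) := Primrec.option_getD.comp hf hg

@[fun_prop]
theorem primrec_option_bind {f : α → Option β} {g : α → β → Option σ} (hf : Primrec f)
    (hg : Primrec fun p : α × β => g p.1 p.2) : Primrec fun a => (f a).bind (g a) :=
  Primrec.option_bind hf hg

@[fun_prop]
theorem primrec_option_map {f : α → Option β} {g : α → β → σ} (hf : Primrec f)
    (hg : Primrec fun p : α × β => g p.1 p.2) : Primrec fun a => (f a).map (g a) :=
  Primrec.option_map hf hg

@[fun_prop]
theorem primrec_option_elim {f : α → Option β} {d : α → σ} {g : α → β → σ} (hf : Primrec f)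
    (hd : Primrec d) (hg : Primrec fun p : α × β => g p.1 p.2) :
    Primrec fun a => (f a).elim (d a) (g a) :=
  (Primrec.option_casesOn hf hd hg).of_eq fun a => by cases f a <;> rfl

@[fun_prop]
theorem primrec_list_cons {f : α → β} {g : α → List β} (hf : Primrec f) (hg : Primrec g) :
    Primrec fun a => f a :: g a := Primrec.list_cons.comp hf hg

@[fun_prop]
theorem primrec_list_append {f g : α → List β} (hf : Primrec f) (hg : Primrec g) :
    Primrec fun a => f a ++ g a := Primrec.list_append.comp hf hg

@[fun_prop]
theorem primrec_list_length {f : α → List β} (hf : Primrec f) : Primrec fun a => (f a).length :=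
  Primrec.list_length.comp hf

@[fun_prop]
theorem primrec_list_head? {f : α → List β} (hf : Primrec f) : Primrec fun a => (f a).head? :=
  Primrec.list_head?.comp hf

@[fun_prop]
theorem primrec_list_map {f : α → List β} {g : α → β → σ} (hf : Primrec f)
    (hg : Primrec fun p : α × β => g p.1 p.2) : Primrec fun a => (f a).map (g a) :=
  Primrec.list_map hf hg

@[fun_prop]
theorem primrec_list_flatMap {f : α → List β} {g : α → β → List σ} (hf : Primrec f)
    (hg : Primrec fun p : α × β => g p.1 p.2) : Primrec fun a => (f a).flatMap (g a) :=
  Primrec.list_flatMap hf hg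

@[fun_prop]
theorem primrec_list_filterMap {f : α → List β} {g : α → β → Option σ} (hf : Primrec f)
    (hg : Primrec fun p : α × β => g p.1 p.2) : Primrec fun a => (f a).filterMap (g a) :=
  Primrec.listFilterMap hf hg

@[fun_prop]
theorem primrec_list_filter {f : α → List β} {g : α → β → Bool} (hf : Primrec f)
    (hg : Primrec fun p : α × β => g p.1 p.2) : Primrec fun a => (f a).filter (g a) :=
  (Primrec.listFilterMap (g := fun a b => bif g a b then some b else none) hf
    (Primrec.cond hg (by fun_prop) (by fun_prop))).of_eq fun a => by
      induction f a with
      | nil => rfl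
      | cons b l ih => cases h : g a b <;> simp [h, ih]

@[fun_prop]
theorem primrec_list_take {f : α → List β} {g : α → ℕ} (hf : Primrec f) (hg : Primrec g) :
    Primrec fun a => (f a).take (g a) := Primrec.list_take.comp hg hf

@[fun_prop]
theorem primrec_list_drop {f : α → List β} {g : α → ℕ} (hf : Primrec f) (hg : Primrec g) :
    Primrec fun a => (f a).drop (g a) := Primrec.list_drop.comp hg hf

@[fun_prop]
theorem primrec_list_get {f : α → List β} {g : α → ℕ} (hf : Primrec f) (hg : Primrec g) :
    Primrec fun a => (f a)[g a]? := Primrec.list_getElem?.comp hf hg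

@[fun_prop]
theorem primrec_list_range {g : α → ℕ} (hg : Primrec g) : Primrec fun a => List.range (g a) :=
  Primrec.list_range.comp hg

@[fun_prop]
theorem primrec_list_foldr {f : α → List β} {g : α → σ} {h : α → β → σ → σ} (hf : Primrec f)
    (hg : Primrec g) (hh : Primrec fun p : α × β × σ => h p.1 p.2.1 p.2.2) :
    Primrec fun a => (f a).foldr (h a) (g a) :=
  Primrec.list_foldr (h := fun a p => h a p.1 p.2) hf hg hh

@[fun_prop]
theorem primrec_list_any {f : α → List β} {g : α → β → Bool} (hf : Primrec f)
    (hg : Primrec fun p : α × β => g p.1 p.2) : Primrec fun a => (f a).any (g a) :=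
  (Primrec.list_foldr (h := fun a (p : β × Bool) => g a p.1 || p.2) hf (Primrec.const false)
    (by
      have := Primrec.comp hg
        (show Primrec fun p : α × β × Bool => (p.1, p.2.1) by fun_prop)
      exact Primrec.or.comp this (by fun_prop))).of_eq fun a => by
      induction f a with
      | nil => rfl
      | cons b l ih => simp [ih]

@[fun_prop]
theorem primrec_list_all {f : α → List β} {g : α → β → Bool} (hf : Primrec f)
    (hg : Primrec fun p : α × β => g p.1 p.2) : Primrec fun a => (f a).all (g a) :=
  (Primrec.not.comp (primrec_list_any (g := fun a b => !(g a b)) hf (by fun_prop))).of_eq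
    fun a => by simp [List.all_eq_not_any_not]

@[fun_prop]
theorem primrec_list_findSome? {f : α → List β} {g : α → β → Option σ} (hf : Primrec f)
    (hg : Primrec fun p : α × β => g p.1 p.2) : Primrec fun a => (f a).findSome? (g a) :=
  (primrec_list_head? (primrec_list_filterMap hf hg)).of_eq fun _ => List.head?_filterMap

@[fun_prop]
theorem primrec_list_find? {f : α → List β} {g : α → β → Bool} (hf : Primrec f)
    (hg : Primrec fun p : α × β => g p.1 p.2) : Primrec fun a => (f a).find? (g a) :=
  (primrec_list_head? (primrec_list_filter hf hg)).of_eq fun _ => List.head?_filter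

@[fun_prop]
theorem primrec_list_dropWhile {f : α → List β} {g : α → β → Bool} (hf : Primrec f)
    (hg : Primrec fun p : α × β => g p.1 p.2) : Primrec fun a => (f a).dropWhile (g a) :=
  (primrec_list_drop hf (Primrec.list_findIdx hf (p := fun a b => !(g a b))
    (show Primrec fun p : α × β => !(g p.1 p.2) by fun_prop))).of_eq fun _ =>
      List.dropWhile_eq_drop_findIdx_not.symm

end PrimrecFunProp

/-! ### Initial segments of oracles -/

@[simp]
theorem length_restr (Z : Set ℕ) (l : ℕ) : (restr Z l).length = l := by simp [restr]

open Classical in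
theorem restr_succ (Z : Set ℕ) (l : ℕ) : restr Z (l + 1) = restr Z l ++ [decide (l ∈ Z)] := by
  simp [restr, List.range_succ]

theorem take_restr (Z : Set ℕ) (m l : ℕ) : (restr Z l).take m = restr Z (min m l) := by
  simp only [restr, ← List.map_take, List.take_range]

theorem take_restr_of_le (Z : Set ℕ) {m l : ℕ} (h : m ≤ l) : (restr Z l).take m = restr Z m := by
  rw [take_restr, min_eq_left h]

theorem restr_prefix (Z : Set ℕ) {m l : ℕ} (h : m ≤ l) : restr Z m <+: restr Z l := by
  rw [← take_restr_of_le Z h]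
  exact List.take_prefix _ _

open Classical in
theorem getElem?_restr (Z : Set ℕ) {i l : ℕ} (h : i < l) :
    (restr Z l)[i]? = some (decide (i ∈ Z)) := by
  simp [restr, h]

theorem getElem?_restr_eq_some_true (Z : Set ℕ) {i l : ℕ} :
    (restr Z l)[i]? = some true ↔ i < l ∧ i ∈ Z := by
  by_cases h : i < l
  · rw [getElem?_restr Z h]; simp [h]
  · simp [h]

theorem getElem?_restr_eq_some_false (Z : Set ℕ) {i l : ℕ} :
    (restr Z l)[i]? = some false ↔ i < l ∧ i ∉ Z := by
  by_cases h : i < l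
  · rw [getElem?_restr Z h]; simp [h]
  · simp [h]

theorem restr_congr {Y Z : Set ℕ} {l : ℕ} (h : ∀ i < l, i ∈ Y ↔ i ∈ Z) :
    restr Y l = restr Z l := by
  simp only [restr]
  refine List.map_congr_left fun i hi => ?_
  simp [h i (List.mem_range.1 hi)]

/-! ### Searching through the initial segments of an oracle -/

theorem nat_recursiveIn_restr (Z : Set ℕ) :
    Nat.RecursiveIn {charFn Z} fun n => Part.some (Encodable.encode (restr Z n)) := by
  let c : ℕ → ℕ := fun q => Encodable.encode
    (((Encodable.decode q.unpair.1 : Option (List Bool)).getD []) ++ [q.unpair.2 == 1])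
  have hc : Nat.RecursiveIn {charFn Z} fun q => Part.some (c q) :=
    Nat.Primrec.recursiveIn (Primrec.nat_iff.1 (by unfold c; fun_prop))
  have hf : Nat.RecursiveIn {charFn Z} fun _ => Part.some (Encodable.encode ([] : List Bool)) :=
    Nat.Primrec.recursiveIn (Nat.Primrec.const _)
  have hyi : Nat.RecursiveIn {charFn Z} fun p => Part.some p.unpair.2.unpair.2 :=
    Nat.Primrec.recursiveIn (Primrec.nat_iff.1 (by fun_prop))
  have hy : Nat.RecursiveIn {charFn Z} fun p => Part.some p.unpair.2.unpair.1 :=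
    Nat.Primrec.recursiveIn (Primrec.nat_iff.1 (by fun_prop))
  have hg := Nat.RecursiveIn.comp hc (Nat.RecursiveIn.pair hyi
    (Nat.RecursiveIn.comp (Nat.RecursiveIn.oracle (charFn Z) rfl) hy))
  have hpair : Nat.RecursiveIn {charFn Z} fun n => Part.some (Nat.pair 0 n) :=
    Nat.Primrec.recursiveIn (Primrec.nat_iff.1 (by fun_prop))
  refine (Nat.RecursiveIn.comp (Nat.RecursiveIn.prec hf hg) hpair).of_eq fun n => ?_
  simp only [Part.bind_eq_bind, Part.bind_some, Nat.unpair_pair]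
  induction n with
  | zero => simp [restr]
  | succ n ih =>
    simp only [ih, Part.bind_some]
    have : (Part.some n >>= charFn Z) = charFn Z n := Part.bind_some _ _
    rw [this]
    by_cases h : n ∈ Z <;> simp [Seq.seq, charFn, c, restr_succ, h]

variable {α β : Type*} [Primcodable α] [Primcodable β]

/-- Reduces oracle computability to primitive recursiveness: every algorithm with an oracle below is
given as a search through initial segments. -/
theorem recursiveIn_rfindOpt_restr (Z : Set ℕ) {Q : α → List Bool → Option β}
    (hQ : Primrec fun p : α × List Bool => Q p.1 p.2) :
    RecursiveIn {charFn Z} fun a => Nat.rfindOpt fun l => Q a (restr Z l) := by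
  -- `test q` encodes the value of `Q` at the argument coded by `q = ⟨a, σ⟩`
  let g : ℕ → Option β := fun q =>
    (Encodable.decode q.unpair.1 : Option α).bind fun a =>
      (Encodable.decode q.unpair.2 : Option (List Bool)).bind fun σ => Q a σ
  have hg : Primrec g := by
    unfold g
    refine primrec_option_bind (by fun_prop) (primrec_option_bind (by fun_prop) ?_)
    exact hQ.comp (f := fun p : α × List Bool => Q p.1 p.2)
      (g := fun p : (ℕ × α) × List Bool => (p.1.2, p.2)) (by fun_prop)
  let t : ℕ → ℕ := fun q => bif (g q).isSome then 0 else 1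
  let u : ℕ → ℕ := fun q => ((g q).map Encodable.encode).getD 0
  have ht : Nat.RecursiveIn {charFn Z} fun q => Part.some (t q) :=
    Nat.Primrec.recursiveIn (Primrec.nat_iff.1 (by unfold t; fun_prop))
  have hu : Nat.RecursiveIn {charFn Z} fun q => Part.some (u q) :=
    Nat.Primrec.recursiveIn (Primrec.nat_iff.1 (by unfold u; fun_prop))
  have hq := Nat.RecursiveIn.pair (O := {charFn Z}) Nat.RecursiveIn.left
    (Nat.RecursiveIn.comp (nat_recursiveIn_restr Z) Nat.RecursiveIn.right)
  have hid : Nat.RecursiveIn {charFn Z} fun n => Part.some n :=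
    Nat.Primrec.recursiveIn Nat.Primrec.id
  have hr := Nat.RecursiveIn.comp (Nat.RecursiveIn.comp hu hq)
    (Nat.RecursiveIn.pair hid (Nat.RecursiveIn.rfind (Nat.RecursiveIn.comp ht hq)))
  refine hr.of_eq fun n => ?_
  simp only [Part.bind_eq_bind, Part.bind_some, Part.map_eq_map, Part.map_some, Seq.seq, Part.bind_map,
    Nat.unpair_pair]
  rcases hd : (Encodable.decode n : Option α) with _ | a
  -- On a number that codes no argument the search never succeeds, as the encoding of a partial
  -- function on `α` demands.
  · have : ∀ σ : List Bool, g (Nat.pair n (Encodable.encode σ)) = none := fun σ => by simp [g, hd]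
    simp only [Part.coe_none, Part.bind_none]
    refine Part.eq_none_iff.2 fun y hy => ?_
    obtain ⟨m, hm, -⟩ := Part.mem_bind_iff.1 hy
    simpa [t, this] using Nat.rfind_spec hm
  · have hQ' : ∀ σ : List Bool, g (Nat.pair n (Encodable.encode σ)) = Q a σ := fun σ => by
      simp [g, hd]
    have htest : ∀ o : Option β, decide ((bif o.isSome then 0 else 1) = 0) = o.isSome := by
      rintro (_ | _) <;> rfl
    simp only [t, u, hQ', Nat.rfindOpt, Part.coe_some, Part.bind_some, Part.map_some, htest]
    refine Part.ext fun y => ?_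
    simp only [Part.mem_bind_iff, Part.mem_map_iff, Part.mem_some_iff, Part.mem_coe]
    constructor
    · rintro ⟨m, hm, rfl⟩
      obtain ⟨b, hb⟩ := Option.isSome_iff_exists.1 (Part.mem_some_iff.1 (Nat.rfind_spec hm)).symm
      exact ⟨b, ⟨m, hm, by simp [hb]⟩, by simp [hb]⟩
    · rintro ⟨b, ⟨m, hm, hb⟩, rfl⟩
      refine ⟨m, hm, ?_⟩
      simp only [Option.mem_def] at hb
      simp [hb]

theorem computableIn_of_search (Z : Set ℕ) {Q : α → List Bool → Option β} {f : α → β}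
    (hQ : Primrec fun p : α × List Bool => Q p.1 p.2)
    (hex : ∀ a, ∃ l, (Q a (restr Z l)).isSome)
    (hval : ∀ a l b, Q a (restr Z l) = some b → b = f a) : ComputableIn {charFn Z} f := by
  refine (recursiveIn_rfindOpt_restr Z hQ).of_eq_tot fun a => ?_
  obtain ⟨l, hl⟩ := hex a
  obtain ⟨b, hb⟩ := Option.isSome_iff_exists.1 hl
  have hdom : (Nat.rfindOpt fun l => Q a (restr Z l)).Dom := Nat.rfindOpt_dom.2 ⟨l, b, hb⟩
  obtain ⟨c, hc⟩ := Part.dom_iff_mem.1 hdom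
  obtain ⟨m, hm⟩ := Nat.rfindOpt_spec hc
  rwa [hval a m c hm] at hc

theorem ceIn_of_search (Z : Set ℕ) {Q : α → List Bool → Bool}
    (hQ : Primrec fun p : α × List Bool => Q p.1 p.2) {S : Set α}
    (hS : ∀ a, a ∈ S ↔ ∃ l, Q a (restr Z l) = true) : CEIn Z S := by
  have hQ' : Primrec fun p : α × List Bool => bif Q p.1 p.2 then some () else none :=
    Primrec.cond hQ (by fun_prop) (by fun_prop)
  refine (recursiveIn_rfindOpt_restr Z (Q := fun a σ => bif Q a σ then some () else none)
    hQ').of_eq fun a => ?_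
  refine Part.ext' ?_ fun _ _ => rfl
  rw [Nat.rfindOpt_dom]
  simp only [Part.assert, hS a, exists_prop, Part.some_dom, and_true]
  refine exists_congr fun l => ?_
  cases Q a (restr Z l) <;> simp

/-! ### A normal form for functions recursive in a set -/

/-- `F` is a partial recursive family of functions, monotone in a string parameter, whose limit
along the initial segments of `Z` is `f`. -/
structure Approximates (Z : Set ℕ) (F : List Bool → ℕ → Part ℕ) (f : ℕ → Part ℕ) : Prop where
  partrec : Partrec₂ (fun σ x => F σ x : List Bool → ℕ →. ℕ)
  mono : ∀ {σ τ x y}, σ <+: τ → y ∈ F σ x → y ∈ F τ x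
  mem_iff : ∀ {x y}, y ∈ f x ↔ ∃ l, y ∈ F (restr Z l) x

namespace Approximates

variable {Z : Set ℕ}

theorem of_primrec {f : ℕ → ℕ} (hf : Primrec f) :
    Approximates Z (fun _ x => Part.some (f x)) fun x => Part.some (f x) where
  partrec := (hf.comp Primrec.snd).to_comp.partrec
  mono _ h := h
  mem_iff := by simp

theorem mem_restr_mono {F f} (h : Approximates Z F f) {l m x y} (hlm : l ≤ m)
    (hy : y ∈ F (restr Z l) x) : y ∈ F (restr Z m) x :=
  h.mono (restr_prefix Z hlm) hy

/-- A query beyond the end of the string diverges instead of receiving a default answer; this is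
what makes the family monotone in the string. -/
theorem oracle : Approximates Z
    (fun σ x => ((σ[x]?.map fun b => bif b then 1 else 0 : Option ℕ) : Part ℕ)) (charFn Z) where
  partrec := by
    refine Computable.ofOption (Primrec.to_comp ?_)
    fun_prop
  mono {σ τ x y} h := by
    obtain ⟨ρ, rfl⟩ := h
    simp only [Part.mem_coe, Option.mem_def, Option.map_eq_some_iff]
    rintro ⟨b, hb, rfl⟩
    refine ⟨b, ?_, rfl⟩
    rw [List.getElem?_append_left (List.getElem?_eq_some_iff.1 hb).1, hb]
  mem_iff {x y} := by
    simp only [Part.mem_coe, Option.mem_def, Option.map_eq_some_iff, charFn, Part.mem_some_iff]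
    constructor
    · rintro rfl
      refine ⟨x + 1, _, getElem?_restr Z (Nat.lt_succ_self x), ?_⟩
      by_cases h : x ∈ Z <;> simp [h]
    · rintro ⟨l, b, hb, rfl⟩
      rcases b
      · simp [(getElem?_restr_eq_some_false Z).1 hb]
      · simp [(getElem?_restr_eq_some_true Z).1 hb]

theorem bind {F G f g} (hf : Approximates Z F f) (hg : Approximates Z G g) :
    Approximates Z (fun σ x => (G σ x).bind (F σ)) fun x => (g x).bind f where
  partrec := by
    refine Partrec.bind (hg.partrec) ?_
    exact hf.partrec.comp (Computable.fst.comp Computable.fst) Computable.snd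
  mono {σ τ x y} h := by
    simp only [Part.mem_bind_iff]
    rintro ⟨z, hz, hy⟩
    exact ⟨z, hg.mono h hz, hf.mono h hy⟩
  mem_iff {x y} := by
    simp only [Part.mem_bind_iff, hf.mem_iff, hg.mem_iff]
    constructor
    · rintro ⟨z, ⟨l, hl⟩, m, hm⟩
      exact ⟨max l m, z, hg.mem_restr_mono (le_max_left _ _) hl,
        hf.mem_restr_mono (le_max_right _ _) hm⟩
    · rintro ⟨l, z, hz, hy⟩
      exact ⟨z, ⟨l, hz⟩, l, hy⟩

theorem pair {F G f g} (hf : Approximates Z F f) (hg : Approximates Z G g) :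
    Approximates Z (fun σ x => (F σ x).bind fun a => (G σ x).map (Nat.pair a))
      fun x => (f x).bind fun a => (g x).map (Nat.pair a) where
  partrec := by
    refine Partrec.bind (hf.partrec) (Partrec.map (Partrec₂.comp hg.partrec
      (Computable.fst.comp Computable.fst) (Computable.snd.comp Computable.fst)) ?_)
    exact Primrec.to_comp (by fun_prop)
  mono {σ τ x y} h := by
    simp only [Part.mem_bind_iff, Part.mem_map_iff]
    rintro ⟨z, hz, w, hw, rfl⟩
    exact ⟨z, hf.mono h hz, w, hg.mono h hw, rfl⟩
  mem_iff {x y} := by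
    simp only [Part.mem_bind_iff, Part.mem_map_iff, hf.mem_iff, hg.mem_iff]
    constructor
    · rintro ⟨z, ⟨l, hl⟩, w, ⟨m, hm⟩, rfl⟩
      exact ⟨max l m, z, hf.mem_restr_mono (le_max_left _ _) hl, w,
        hg.mem_restr_mono (le_max_right _ _) hm, rfl⟩
    · rintro ⟨l, z, hz, w, hw, rfl⟩
      exact ⟨z, ⟨l, hz⟩, w, ⟨l, hw⟩, rfl⟩

theorem prec {F G f g} (hf : Approximates Z F f) (hg : Approximates Z G g) :
    Approximates Z
      (fun σ p => Nat.rec (F σ p.unpair.1)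
        (fun y IH => IH.bind fun i => G σ (Nat.pair p.unpair.1 (Nat.pair y i))) p.unpair.2)
      fun p => Nat.rec (f p.unpair.1)
        (fun y IH => IH.bind fun i => g (Nat.pair p.unpair.1 (Nat.pair y i))) p.unpair.2 where
  partrec := by
    refine Partrec.nat_rec (f := fun p : List Bool × ℕ => p.2.unpair.2)
      (g := fun p : List Bool × ℕ => F p.1 p.2.unpair.1)
      (h := fun (p : List Bool × ℕ) (q : ℕ × ℕ) =>
        G p.1 (Nat.pair p.2.unpair.1 (Nat.pair q.1 q.2)))
      (Primrec.to_comp (by fun_prop)) ?_ ?_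
    · exact Partrec₂.comp hf.partrec Computable.fst (Primrec.to_comp (by fun_prop))
    · exact Partrec₂.comp hg.partrec (Computable.fst.comp Computable.fst)
        (Primrec.to_comp (by fun_prop))
  mono {σ τ x y} h := by
    generalize x.unpair.2 = n
    induction n generalizing y with
    | zero => exact hf.mono h
    | succ n ih =>
      simp only [Part.mem_bind_iff]
      rintro ⟨i, hi, hy⟩
      exact ⟨i, ih hi, hg.mono h hy⟩
  mem_iff {x y} := by
    have mono : ∀ {l m n y}, l ≤ m →
        y ∈ (Nat.rec (F (restr Z l) x.unpair.1) (fun y IH => IH.bind fun i =>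
          G (restr Z l) (Nat.pair x.unpair.1 (Nat.pair y i))) n : Part ℕ) →
        y ∈ (Nat.rec (F (restr Z m) x.unpair.1) (fun y IH => IH.bind fun i =>
          G (restr Z m) (Nat.pair x.unpair.1 (Nat.pair y i))) n : Part ℕ) := by
      intro l m n y hlm
      induction n generalizing y with
      | zero => exact hf.mem_restr_mono hlm
      | succ n ih =>
        simp only [Part.mem_bind_iff]
        rintro ⟨i, hi, hy⟩
        exact ⟨i, ih hi, hg.mem_restr_mono hlm hy⟩
    generalize x.unpair.2 = n
    induction n generalizing y with
    | zero => exact hf.mem_iff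
    | succ n ih =>
      simp only [Part.mem_bind_iff, ih, hg.mem_iff]
      constructor
      · rintro ⟨i, ⟨l, hl⟩, m, hm⟩
        exact ⟨max l m, i, mono (le_max_left _ _) hl,
          hg.mem_restr_mono (le_max_right _ _) hm⟩
      · rintro ⟨l, i, hi, hy⟩
        exact ⟨i, ⟨l, hi⟩, l, hy⟩

theorem mem_rfind_eq_zero {p : ℕ → Part ℕ} {n : ℕ} :
    n ∈ Nat.rfind (fun n => (p n).map fun m => decide (m = 0)) ↔
      0 ∈ p n ∧ ∀ k < n, ∃ a ∈ p k, a ≠ 0 := by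
  refine Nat.mem_rfind.trans (and_congr ?_ (forall_congr' fun k => imp_congr_right fun _ => ?_))
  · exact (Part.mem_map_iff _).trans (by simp)
  · exact (Part.mem_map_iff _).trans (by simp)

theorem rfind {F f} (hf : Approximates Z F f) :
    Approximates Z
      (fun σ a => Nat.rfind fun n => (F σ (Nat.pair a n)).map fun m => decide (m = 0))
      fun a => Nat.rfind fun n => (f (Nat.pair a n)).map fun m => decide (m = 0) where
  partrec := by
    refine Partrec.rfind (p := fun (p : List Bool × ℕ) n =>
      (F p.1 (Nat.pair p.2 n)).map fun m => decide (m = 0)) (Partrec.map (Partrec₂.comp hf.partrec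
      (Computable.fst.comp Computable.fst) (Primrec.to_comp (by fun_prop))) ?_)
    exact Primrec.to_comp (Primrec.eq.comp (by fun_prop) (by fun_prop)).decide
  mono {σ τ x y} h := by
    rw [mem_rfind_eq_zero, mem_rfind_eq_zero]
    rintro ⟨h0, hlt⟩
    refine ⟨hf.mono h h0, fun k hk => ?_⟩
    obtain ⟨a, ha, hne⟩ := hlt k hk
    exact ⟨a, hf.mono h ha, hne⟩
  mem_iff {x y} := by
    simp_rw [mem_rfind_eq_zero, hf.mem_iff]
    constructor
    · rintro ⟨⟨l, hl⟩, hlt⟩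
      -- Each of the finitely many values below the minimum has its own use; their supremum serves
      -- for all.
      have : ∀ k, ∃ l', k < y → ∃ a, a ∈ F (restr Z l') (Nat.pair x k) ∧ a ≠ 0 := by
        intro k
        by_cases hk : k < y
        · obtain ⟨a, ⟨l', hl'⟩, ha⟩ := hlt k hk
          exact ⟨l', fun _ => ⟨a, hl', ha⟩⟩
        · exact ⟨0, fun h => absurd h hk⟩
      choose b hb using this
      have hle : ∀ k < y, b k ≤ (Finset.range y).sup b := fun k hk =>
        Finset.le_sup (Finset.mem_range.2 hk)
      refine ⟨max l ((Finset.range y).sup b),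
        hf.mem_restr_mono (le_max_left _ _) hl, fun k hk => ?_⟩
      obtain ⟨a, ha, h0⟩ := hb k hk
      exact ⟨a, hf.mem_restr_mono ((hle k hk).trans (le_max_right _ _)) ha, h0⟩
    · rintro ⟨l, h0, hlt⟩
      refine ⟨⟨l, h0⟩, fun k hk => ?_⟩
      obtain ⟨a, ha, h0⟩ := hlt k hk
      exact ⟨a, ⟨l, ha⟩, h0⟩

end Approximates

theorem exists_approximates {Z : Set ℕ} {f : ℕ →. ℕ} (hf : Nat.RecursiveIn {charFn Z} f) :
    ∃ F, Approximates Z F f := by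
  induction hf with
  | zero => exact ⟨_, Approximates.of_primrec (f := fun _ => 0) (by fun_prop)⟩
  | succ => exact ⟨_, Approximates.of_primrec (f := fun n => n + 1) (by fun_prop)⟩
  | left => exact ⟨_, Approximates.of_primrec (f := fun n => n.unpair.1) (by fun_prop)⟩
  | right => exact ⟨_, Approximates.of_primrec (f := fun n => n.unpair.2) (by fun_prop)⟩
  | oracle g hg =>
    obtain rfl := Set.mem_singleton_iff.1 hg
    exact ⟨_, Approximates.oracle⟩
  | pair _ _ ihf ihg =>
    obtain ⟨F, hF⟩ := ihf
    obtain ⟨G, hG⟩ := ihg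
    have := hF.pair hG
    refine ⟨fun σ x => (F σ x).bind fun a => (G σ x).map (Nat.pair a), ?_⟩
    convert! this using 2
  | comp _ _ ihf ihg =>
    obtain ⟨F, hF⟩ := ihf
    obtain ⟨G, hG⟩ := ihg
    exact ⟨_, hF.bind hG⟩
  | prec _ _ ihf ihg =>
    obtain ⟨F, hF⟩ := ihf
    obtain ⟨G, hG⟩ := ihg
    exact ⟨_, hF.prec hG⟩
  | rfind _ ihf =>
    obtain ⟨F, hF⟩ := ihf
    exact ⟨_, hF.rfind⟩

/-- The program `e` computes, from initial segments of `Z`, the partial function `f`. -/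
def ComputesFrom (e : Nat.Partrec.Code) (Z : Set ℕ) (f : ℕ →. ℕ) : Prop :=
  ∀ x y, y ∈ f x ↔ ∃ l k, Nat.Partrec.Code.evaln k e (Encodable.encode (restr Z l, x)) = some y

/-- The use principle: an abstract reduction becomes a program run on finite oracle strings, a form
that a stagewise construction can inspect. -/
theorem exists_computesFrom {Z : Set ℕ} {f : ℕ →. ℕ} (hf : Nat.RecursiveIn {charFn Z} f) :
    ∃ e, ComputesFrom e Z f := by
  obtain ⟨F, hF⟩ := exists_approximates hf
  obtain ⟨e, he⟩ := Nat.Partrec.Code.exists_code.1 hF.partrec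
  refine ⟨e, fun x y => ?_⟩
  rw [hF.mem_iff]
  refine exists_congr fun l => ?_
  have : Nat.Partrec.Code.eval e (Encodable.encode (restr Z l, x)) = F (restr Z l) x := by
    simp [he, Encodable.encodek, Part.map_id']
  rw [← this, Nat.Partrec.Code.evaln_complete]
  rfl

/-! ### The construction

A state consists of a list `L` of events (the latest first) and a list `I` of active instances.
An event `(y, k)` says that `y` has entered `∅'` and that `⟨y, k⟩` has been enumerated into `D`;
an instance `(e, n, r)` says that the `e`-th requirement restrains every number `y ≥ n` from
choosing `k < r`. -/

/-- The states of the construction. -/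
abbrev State := List (ℕ × ℕ) × List (ℕ × ℕ × ℕ)

/-- The least `k ≥ y` that respects all restraints imposed on `y`. -/
def restraint (y : ℕ) (I : List (ℕ × ℕ × ℕ)) : ℕ :=
  I.foldr (fun i m => bif Nat.ble i.2.1 y then max i.2.2 m else m) y

/-- The events up to the latest one with second component below `r`. -/
def trunc (r : ℕ) (L : List (ℕ × ℕ)) : List (ℕ × ℕ) :=
  L.dropWhile fun p => Nat.ble r p.2

/-- At stage `⟨y, k⟩` the number `y` is seen to be a new element of `∅'`. -/
def enters (v : ℕ) (L : List (ℕ × ℕ)) : Bool :=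
  (Nat.Partrec.Code.evaln v.unpair.2 (Denumerable.ofNat Nat.Partrec.Code v.unpair.1)
    v.unpair.1).isSome && !(L.any fun p => p.1 == v.unpair.1)

/-- The event `(y, k)` takes place, where `k` is chosen by the restraints; the instances with
`k < r` are removed. -/
def addEvent (y : ℕ) (S : State) : State :=
  ((y, restraint y S.2) :: S.1, S.2.filter fun i => Nat.ble i.2.2 (restraint y S.2))

/-- The first half of a stage. -/
def eventStep (v : ℕ) (S : State) : State :=
  bif enters v S.1 then addEvent v.unpair.1 S else S

/-- The second half of a stage: if the `e`-th requirement has no active instance, then an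
eligible one is sought. -/
def actStep (P : ℕ → ℕ → ℕ → List (ℕ × ℕ) → Bool) (v : ℕ) (S : State) : State :=
  bif S.2.any fun i => i.1 == v.unpair.1 then S
  else ((List.range v).find? fun m =>
      P v.unpair.1 m.unpair.1 m.unpair.2 (trunc m.unpair.2 S.1)).elim S fun m =>
    (S.1, (v.unpair.1, m.unpair.1, m.unpair.2) :: S.2)

/-- The state before stage `v`. -/
def state (P : ℕ → ℕ → ℕ → List (ℕ × ℕ) → Bool) : ℕ → State
  | 0 => ([], [])
  | v + 1 => actStep P v (eventStep v (state P v))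

/-! ### Computability of the construction -/

@[fun_prop]
theorem primrec_trunc {α : Type*} [Primcodable α] {r : α → ℕ} {L : α → List (ℕ × ℕ)}
    (hr : Primrec r) (hL : Primrec L) : Primrec fun a => trunc (r a) (L a) := by
  unfold trunc; fun_prop

theorem primrec_eventStep : Primrec fun q : ℕ × State => eventStep q.1 q.2 := by
  unfold eventStep addEvent enters restraint; fun_prop

section

variable {P : ℕ → ℕ → ℕ → List (ℕ × ℕ) → Bool}

theorem primrec_actStep
    (hP : Primrec fun q : ℕ × ℕ × ℕ × List (ℕ × ℕ) => P q.1 q.2.1 q.2.2.1 q.2.2.2) :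
    Primrec fun q : ℕ × State => actStep P q.1 q.2 := by
  unfold actStep
  refine primrec_cond (by fun_prop) (by fun_prop)
    (primrec_option_elim (primrec_list_find? (by fun_prop) ?_) (by fun_prop) (by fun_prop))
  exact hP.comp (g := fun p : (ℕ × State) × ℕ => (p.1.1.unpair.1, p.2.unpair.1, p.2.unpair.2,
    trunc p.2.unpair.2 p.1.2.1)) (by fun_prop)

theorem primrec_state
    (hP : Primrec fun q : ℕ × ℕ × ℕ × List (ℕ × ℕ) => P q.1 q.2.1 q.2.2.1 q.2.2.2) :
    Primrec (state P) := by
  have := Primrec.nat_rec₁ (f := fun v S => actStep P v (eventStep v S)) (([], []) : State)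
    ((primrec_actStep hP).comp (g := fun q : ℕ × State => (q.1, eventStep q.1 q.2))
      (Primrec.fst.pair primrec_eventStep))
  refine this.of_eq fun v => ?_
  induction v with
  | zero => rfl
  | succ v ih => simp only [state, ← ih]

/-! ### Restraints and truncated lists of events -/

theorem le_restraint (y : ℕ) (I : List (ℕ × ℕ × ℕ)) : y ≤ restraint y I := by
  induction I with
  | nil => exact le_rfl
  | cons i I ih =>
    simp only [restraint, List.foldr_cons] at ih ⊢
    cases Nat.ble i.2.1 y
    · exact ih
    · exact ih.trans (le_max_right _ _)

theorem le_restraint_of_mem {y : ℕ} {I : List (ℕ × ℕ × ℕ)} {i : ℕ × ℕ × ℕ} (hi : i ∈ I)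
    (hy : i.2.1 ≤ y) : i.2.2 ≤ restraint y I := by
  induction I with
  | nil => simp at hi
  | cons j I ih =>
    simp only [restraint, List.foldr_cons] at ih ⊢
    rcases List.mem_cons.1 hi with rfl | hi
    · rw [Nat.ble_eq_true_of_le hy]
      exact le_max_left _ _
    · cases Nat.ble j.2.1 y
      · exact ih hi
      · exact (ih hi).trans (le_max_right _ _)

theorem restraint_eq_or (y : ℕ) (I : List (ℕ × ℕ × ℕ)) :
    restraint y I = y ∨ ∃ i ∈ I, i.2.1 ≤ y ∧ i.2.2 = restraint y I := by
  induction I with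
  | nil => exact Or.inl rfl
  | cons i I ih =>
    have ih' : restraint y I = y ∨ ∃ j ∈ i :: I, j.2.1 ≤ y ∧ j.2.2 = restraint y I :=
      ih.imp_right fun ⟨j, hj, h⟩ => ⟨j, List.mem_cons_of_mem _ hj, h⟩
    cases h : Nat.ble i.2.1 y
    · have : restraint y (i :: I) = restraint y I := by
        simp [restraint, h]
      rwa [this]
    · have : restraint y (i :: I) = max i.2.2 (restraint y I) := by
        simp [restraint, h]
      rw [this]
      rcases le_total i.2.2 (restraint y I) with hle | hle
      · rwa [max_eq_right hle]
      · rw [max_eq_left hle]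
        exact Or.inr ⟨i, List.mem_cons_self, Nat.le_of_ble_eq_true h, rfl⟩

theorem trunc_cons_of_le {r : ℕ} {p : ℕ × ℕ} (L : List (ℕ × ℕ)) (h : r ≤ p.2) :
    trunc r (p :: L) = trunc r L := by
  simp [trunc, h]

theorem trunc_cons_of_lt {r : ℕ} {p : ℕ × ℕ} (L : List (ℕ × ℕ)) (h : p.2 < r) :
    trunc r (p :: L) = p :: L := by
  have : Nat.ble r p.2 = false := by simpa [← Bool.not_eq_true] using h
  simp [trunc, this]

theorem mem_of_mem_trunc {r : ℕ} {L : List (ℕ × ℕ)} {p : ℕ × ℕ} (h : p ∈ trunc r L) : p ∈ L :=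
  (List.dropWhile_suffix _).subset h

theorem mem_trunc_of_lt {r : ℕ} {L : List (ℕ × ℕ)} {p : ℕ × ℕ} (h : p ∈ L) (hr : p.2 < r) :
    p ∈ trunc r L := by
  induction L with
  | nil => simp at h
  | cons q L ih =>
    rcases lt_or_ge q.2 r with hq | hq
    · rwa [trunc_cons_of_lt _ hq]
    · rw [trunc_cons_of_le _ hq]
      refine ih ((List.mem_cons.1 h).resolve_left ?_)
      rintro rfl
      omega

theorem trunc_suffix_trunc {r s : ℕ} (h : r ≤ s) (L : List (ℕ × ℕ)) : trunc r L <:+ trunc s L := by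
  induction L with
  | nil => exact List.suffix_refl _
  | cons q L ih =>
    rcases lt_or_ge q.2 s with hq | hq
    · rw [trunc_cons_of_lt _ hq]
      exact List.dropWhile_suffix _
    · rwa [trunc_cons_of_le _ hq, trunc_cons_of_le _ (h.trans hq)]

/-! ### Invariants of the construction -/

theorem actStep_cases (v : ℕ) (S : State) :
    (actStep P v S = S ∧ ((∃ i ∈ S.2, i.1 = v.unpair.1) ∨
      ∀ m : ℕ, m < v → P v.unpair.1 m.unpair.1 m.unpair.2 (trunc m.unpair.2 S.1) = false)) ∨
    ∃ m : ℕ, (∀ i ∈ S.2, i.1 ≠ v.unpair.1) ∧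
      P v.unpair.1 m.unpair.1 m.unpair.2 (trunc m.unpair.2 S.1) = true ∧
      (∀ m' : ℕ, m' < m → P v.unpair.1 m'.unpair.1 m'.unpair.2 (trunc m'.unpair.2 S.1) = false) ∧
      actStep P v S = (S.1, (v.unpair.1, m.unpair.1, m.unpair.2) :: S.2) := by
  rcases h : S.2.any fun i => i.1 == v.unpair.1
  · rcases h' : (List.range v).find? fun m =>
      P v.unpair.1 m.unpair.1 m.unpair.2 (trunc m.unpair.2 S.1) with _ | m
    · refine Or.inl ⟨by simp only [actStep, h, h', cond_false, Option.elim_none],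
        Or.inr fun m hm => by simpa using List.find?_eq_none.1 h' m (by simpa)⟩
    · refine Or.inr ⟨m, by simpa using h, by have := List.find?_some h'; exact this, fun m' hm' => ?_,
        by simp only [actStep, h, h', cond_false, Option.elim_some]⟩
      simpa using (List.find?_range_eq_some.1 h').2.2 m' hm'
  · refine Or.inl ⟨by simp only [actStep, h, cond_true], Or.inl ?_⟩
    simpa only [List.any_eq_true, beq_iff_eq] using h

theorem fst_actStep (v : ℕ) (S : State) : (actStep P v S).1 = S.1 := by
  rcases actStep_cases (P := P) v S with ⟨h, -⟩ | ⟨m, -, -, -, h⟩ <;> rw [h]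

/-- Invariants need only be checked for the two elementary moves. The equation in the event case
records that the new event really occurs in the next state. -/
theorem step_induction (v : ℕ) {p : State → Prop}
    (hev : ∀ y, y ∈ halting → (∀ q ∈ (state P v).1, q.1 ≠ y) →
      (addEvent y (state P v)).1 = (state P (v + 1)).1 → p (addEvent y (state P v)))
    (hact : ∀ S e n r, (∀ i ∈ S.2, i.1 ≠ e) → P e n r (trunc r S.1) = true → p S →
      p (S.1, (e, n, r) :: S.2)) (hv : p (state P v)) : p (state P (v + 1)) := by
  have h1 : p (eventStep v (state P v)) := by
    have hfst' : (state P (v + 1)).1 = _ := fst_actStep v (eventStep v (state P v))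
    unfold eventStep at hfst' ⊢
    cases h : enters v (state P v).1
    · exact hv
    · simp only [h, cond_true] at hfst' ⊢
      simp only [enters, Bool.and_eq_true, Bool.not_eq_true', List.any_eq_false, beq_iff_eq] at h
      refine hev _ ?_ h.2 hfst'.symm
      obtain ⟨z, hz⟩ := Option.isSome_iff_exists.1 h.1
      exact Part.dom_iff_mem.2 ⟨z, Nat.Partrec.Code.evaln_sound hz⟩
  change p (actStep P v (eventStep v (state P v)))
  generalize eventStep v (state P v) = S at h1
  rcases actStep_cases (P := P) v S with ⟨h, -⟩ | ⟨m, hne, hm, -, h⟩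
  · rwa [h]
  · rw [h]
    exact hact _ _ _ _ hne hm h1

theorem state_induction {p : State → Prop} (h0 : p ([], []))
    (hev : ∀ S y, y ∈ halting → (∀ q ∈ S.1, q.1 ≠ y) → p S → p (addEvent y S))
    (hact : ∀ S e n r, (∀ i ∈ S.2, i.1 ≠ e) → P e n r (trunc r S.1) = true → p S →
      p (S.1, (e, n, r) :: S.2)) (v : ℕ) : p (state P v) := by
  induction v with
  | zero => exact h0
  | succ v ih => exact step_induction v (fun y hy hq _ => hev _ y hy hq ih) hact ih

theorem mem_addEvent {y : ℕ} {S : State} {i : ℕ × ℕ × ℕ} (hi : i ∈ S.2)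
    (hr : i.2.2 ≤ restraint y S.2) : i ∈ (addEvent y S).2 :=
  List.mem_filter.2 ⟨hi, Nat.ble_eq_true_of_le hr⟩

theorem of_mem_addEvent {y : ℕ} {S : State} {i : ℕ × ℕ × ℕ} (hi : i ∈ (addEvent y S).2) :
    i ∈ S.2 ∧ i.2.2 ≤ restraint y S.2 :=
  (List.mem_filter.1 hi).imp_right Nat.le_of_ble_eq_true

theorem fst_mem_halting {v : ℕ} {q : ℕ × ℕ} (hq : q ∈ (state P v).1) : q.1 ∈ halting := by
  revert q
  refine state_induction (p := fun S => ∀ {q}, q ∈ S.1 → q.1 ∈ halting) (by simp) ?_ ?_ v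
  · intro S y hy _ ih q hq
    rcases List.mem_cons.1 hq with rfl | hq
    exacts [hy, ih hq]
  · intro S e n r _ _ ih
    exact ih

theorem fst_le_snd {v : ℕ} {q : ℕ × ℕ} (hq : q ∈ (state P v).1) : q.1 ≤ q.2 := by
  revert q
  refine state_induction (p := fun S => ∀ {q}, q ∈ S.1 → q.1 ≤ q.2) (by simp) ?_ ?_ v
  · intro S y hy _ ih q hq
    rcases List.mem_cons.1 hq with rfl | hq
    exacts [le_restraint _ _, ih hq]
  · intro S e n r _ _ ih
    exact ih

theorem nodup_events (v : ℕ) : ((state P v).1.map Prod.fst).Nodup := by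
  refine state_induction (p := fun S => (S.1.map Prod.fst).Nodup) (by simp) ?_ ?_ v
  · intro S y hy hq ih
    refine List.nodup_cons.2 ⟨?_, ih⟩
    simpa using fun k hk => hq (y, k) hk
  · intro S e n r _ _ ih
    exact ih

theorem state_suffix_succ (v : ℕ) : (state P v).1 <:+ (state P (v + 1)).1 :=
  step_induction (p := fun S => (state P v).1 <:+ S.1) v
    (fun _ _ _ _ => List.suffix_cons _ _) (fun _ _ _ _ _ _ h => h) (List.suffix_refl _)

theorem state_suffix {v w : ℕ} (h : v ≤ w) : (state P v).1 <:+ (state P w).1 := by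
  induction h with
  | refl => exact List.suffix_refl _
  | step _ ih => exact ih.trans (state_suffix_succ _)

theorem exists_mem_state {y : ℕ} (hy : y ∈ halting) : ∃ v k, (y, k) ∈ (state P v).1 := by
  obtain ⟨z, hz⟩ := Part.dom_iff_mem.1 hy
  obtain ⟨t, ht⟩ := Nat.Partrec.Code.evaln_complete.1 hz
  by_contra! hno
  -- At this stage the computation is run for the t steps in which it halts, so y enters now unless
  -- it entered before.
  set v := Nat.pair y t with hv
  have hent : enters v (state P v).1 = true := by
    simp only [enters, hv, Nat.unpair_pair, Bool.and_eq_true, Bool.not_eq_true',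
      List.any_eq_false, beq_iff_eq]
    refine ⟨Option.isSome_iff_exists.2 ⟨z, ht⟩, fun q hq he => ?_⟩
    exact hno _ q.2 (by rw [← he]; exact hq)
  have hfst : (state P (v + 1)).1 = _ := fst_actStep v (eventStep v (state P v))
  refine hno (v + 1) (restraint y (state P v).2) ?_
  rw [hfst, eventStep, hent, hv, Nat.unpair_pair]
  exact List.mem_cons_self

/-! ### The enumeration in the limit -/

/-- The set of all events. -/
def events (P : ℕ → ℕ → ℕ → List (ℕ × ℕ) → Bool) : Set (ℕ × ℕ) := {q | ∃ v, q ∈ (state P v).1}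

theorem eq_of_fst_eq {q q' : ℕ × ℕ} (hq : q ∈ events P) (hq' : q' ∈ events P)
    (h : q.1 = q'.1) : q = q' := by
  obtain ⟨v, hv⟩ := hq
  obtain ⟨w, hw⟩ := hq'
  have hv' := (state_suffix (le_max_left v w)).subset hv
  have hw' := (state_suffix (le_max_right v w)).subset hw
  exact List.inj_on_of_nodup_map (nodup_events _) hv' hw' h

/-- All events with second component below `r` have taken place before stage `v`. -/
def Settled (P : ℕ → ℕ → ℕ → List (ℕ × ℕ) → Bool) (r v : ℕ) : Prop :=
  ∀ q ∈ events P, q.2 < r → q ∈ (state P v).1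

theorem Settled.mono {r v w : ℕ} (h : Settled P r v) (hvw : v ≤ w) : Settled P r w :=
  fun q hq hr => (state_suffix hvw).subset (h q hq hr)

/-- Finitely many events all take place before some stage. -/
theorem exists_stage_of_finite {s : Set (ℕ × ℕ)} (hs : s.Finite) :
    ∃ v, ∀ q ∈ events P, q ∈ s → q ∈ (state P v).1 := by
  have : ∀ q, ∃ v, q ∈ events P → q ∈ (state P v).1 := by
    intro q
    by_cases h : q ∈ events P
    · obtain ⟨v, hv⟩ := h
      exact ⟨v, fun _ => hv⟩
    · exact ⟨0, fun h' => absurd h' h⟩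
  choose f hf using this
  obtain ⟨v, hv⟩ := (hs.image f).bddAbove
  exact ⟨v, fun q hq hqs => (state_suffix (hv (Set.mem_image_of_mem f hqs))).subset (hf q hq)⟩

theorem exists_stage_fst_lt (n : ℕ) : ∃ v, ∀ q ∈ events P, q.1 < n → q ∈ (state P v).1 := by
  have : ({q | q ∈ events P ∧ q.1 < n}).Finite := by
    refine Set.Finite.of_finite_image (f := Prod.fst) ((Set.finite_Iio n).subset ?_) ?_
    · rintro _ ⟨q, hq, rfl⟩
      exact hq.2
    · intro q hq q' hq' h
      exact eq_of_fst_eq hq.1 hq'.1 h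
  obtain ⟨v, hv⟩ := exists_stage_of_finite (P := P) this
  exact ⟨v, fun q hq h => hv q hq ⟨hq, h⟩⟩

theorem exists_settled (r : ℕ) : ∃ v, Settled P r v := by
  obtain ⟨v, hv⟩ := exists_stage_of_finite (P := P)
    ((Set.finite_Iio r).prod (Set.finite_Iio r))
  refine ⟨v, fun q hq hr => hv q hq ⟨?_, hr⟩⟩
  obtain ⟨w, hw⟩ := hq
  exact (fst_le_snd hw).trans_lt hr

/-- Events after a settled stage have markers at least r and are dropped again; one with a smaller
marker would occur twice in the list. -/
theorem trunc_state_eq {r v w : ℕ} (h : Settled P r v) (hvw : v ≤ w) :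
    trunc r (state P w).1 = trunc r (state P v).1 := by
  obtain ⟨M, hM⟩ := state_suffix (P := P) hvw
  rw [← hM]
  refine List.dropWhile_append_of_pos fun q hq => Nat.ble_eq_true_of_le (not_lt.1 fun hr => ?_)
  have hw : q ∈ (state P w).1 := by rw [← hM]; exact List.mem_append_left _ hq
  have hd : (state P w).1.Nodup := (nodup_events w).of_map
  rw [← hM, List.nodup_append] at hd
  exact hd.2.2 q hq q (h q ⟨w, hw⟩ hr) rfl

open Classical in
/-- The eventual value of `trunc r L`. -/
noncomputable def limTrunc (P : ℕ → ℕ → ℕ → List (ℕ × ℕ) → Bool) (r : ℕ) : List (ℕ × ℕ) :=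
  trunc r (state P (exists_settled (P := P) r).choose).1

theorem Settled.trunc_eq {r v : ℕ} (h : Settled P r v) : trunc r (state P v).1 = limTrunc P r := by
  have h' := (exists_settled (P := P) r).choose_spec
  rw [limTrunc, ← trunc_state_eq h (le_max_left v (exists_settled (P := P) r).choose),
    ← trunc_state_eq h' (le_max_right v _)]

theorem mem_limTrunc_of_lt {r : ℕ} {q : ℕ × ℕ} (hq : q ∈ events P) (hr : q.2 < r) :
    q ∈ limTrunc P r := by
  obtain ⟨v, hv⟩ := exists_settled (P := P) r
  rw [← hv.trunc_eq]
  exact mem_trunc_of_lt (hv q hq hr) hr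

theorem limTrunc_subset_events {r : ℕ} {q : ℕ × ℕ} (hq : q ∈ limTrunc P r) : q ∈ events P :=
  ⟨_, mem_of_mem_trunc hq⟩

theorem limTrunc_suffix {r s : ℕ} (h : r ≤ s) : limTrunc P r <:+ limTrunc P s := by
  obtain ⟨v, hv⟩ := exists_settled (P := P) r
  obtain ⟨w, hw⟩ := exists_settled (P := P) s
  rw [← (hv.mono (le_max_left v w)).trunc_eq, ← (hw.mono (le_max_right v w)).trunc_eq]
  exact trunc_suffix_trunc h _

/-! ### Instances -/

/-- A requirement acts only when it has no instance. This is why each requirement pays at most once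
in the cost and loss estimates. -/
theorem instance_eq {v : ℕ} {i j : ℕ × ℕ × ℕ} (hi : i ∈ (state P v).2) (hj : j ∈ (state P v).2)
    (h : i.1 = j.1) : i = j := by
  revert i j
  refine state_induction (p := fun S => ∀ {i j}, i ∈ S.2 → j ∈ S.2 → i.1 = j.1 → i = j)
    (by simp) ?_ ?_ v
  · intro S y _ _ ih i j hi hj
    exact ih (of_mem_addEvent hi).1 (of_mem_addEvent hj).1
  · intro S e n r hne _ ih i j hi hj h
    rcases List.mem_cons.1 hi with rfl | hi <;> rcases List.mem_cons.1 hj with rfl | hj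
    · rfl
    · exact absurd h.symm (hne _ hj)
    · exact absurd h (hne _ hi)
    · exact ih hi hj h

/-- An event that leaves the instance alive has marker at least r, so it does not change the
truncated list on which eligibility was decided. -/
theorem instance_spec {v e n r : ℕ} (hi : (e, n, r) ∈ (state P v).2) :
    P e n r (trunc r (state P v).1) = true := by
  revert e n r
  refine state_induction
    (p := fun S => ∀ {e n r}, (e, n, r) ∈ S.2 → P e n r (trunc r S.1) = true) (by simp) ?_ ?_ v
  · intro S y _ _ ih e n r hi
    have := of_mem_addEvent hi
    rw [addEvent, trunc_cons_of_le _ this.2]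
    exact ih this.1
  · intro S e n r _ hP ih e' n' r' hi
    rcases List.mem_cons.1 hi with h | hi
    · simp only [Prod.mk.injEq] at h
      obtain ⟨rfl, rfl, rfl⟩ := h
      exact hP
    · exact ih hi

/-- The instance `(e, n, r)` is active from some stage on. -/
def Permanent (P : ℕ → ℕ → ℕ → List (ℕ × ℕ) → Bool) (e n r : ℕ) : Prop :=
  ∃ v, ∀ w, v ≤ w → (e, n, r) ∈ (state P w).2

theorem Permanent.eq {e n r n' r' : ℕ} (h : Permanent P e n r) (h' : Permanent P e n' r') :
    n = n' ∧ r = r' := by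
  obtain ⟨v, hv⟩ := h
  obtain ⟨w, hw⟩ := h'
  simpa using instance_eq (hv _ (le_max_left v w)) (hw _ (le_max_right v w)) rfl

theorem Permanent.spec {e n r : ℕ} (h : Permanent P e n r) : P e n r (limTrunc P r) = true := by
  obtain ⟨v, hv⟩ := h
  obtain ⟨w, hw⟩ := exists_settled (P := P) r
  rw [← (hw.mono (le_max_right v w)).trunc_eq]
  exact instance_spec (hv _ (le_max_left v w))

/-- An instance can only be removed by an event that it does not restrain. -/
theorem instance_mem_of_le {v w : ℕ} {i : ℕ × ℕ × ℕ} (hi : i ∈ (state P v).2) (hvw : v ≤ w)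
    (h : ∀ q ∈ events P, q ∉ (state P v).1 → i.2.1 ≤ q.1 ∨ i.2.2 ≤ q.2) :
    i ∈ (state P w).2 := by
  induction hvw with
  | refl => exact hi
  | @step w hvw ih =>
    refine step_induction (p := fun S => i ∈ S.2) w ?_
      (fun _ _ _ _ _ _ hi => List.mem_cons_of_mem _ hi) ih
    intro y _ hy heq
    refine mem_addEvent ih ?_
    rcases h (y, restraint y (state P w).2) ⟨w + 1, by rw [← heq]; exact List.mem_cons_self⟩
      (fun hmem => hy _ ((state_suffix hvw).subset hmem) rfl) with h | h
    · exact le_restraint_of_mem ih h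
    · exact h

/-- A certificate of permanence in terms of `D`: no further marker below r appears. The next lemma
gives one in terms of ∅': all later events come from numbers that obey the instance. -/
theorem permanent_of_settled {v e n r : ℕ} (hv : Settled P r v) (hi : (e, n, r) ∈ (state P v).2) :
    Permanent P e n r :=
  ⟨v, fun _ hw => instance_mem_of_le hi hw fun q hq hqv =>
    Or.inr (not_lt.1 fun hr => hqv (hv q hq hr))⟩

theorem permanent_of_forall_lt {v e n r : ℕ}
    (hv : ∀ q ∈ events P, q.1 < n → q ∈ (state P v).1) (hi : (e, n, r) ∈ (state P v).2) :
    Permanent P e n r :=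
  ⟨v, fun _ hw => instance_mem_of_le hi hw fun q hq hqv =>
    Or.inl (not_lt.1 fun hr => hqv (hv q hq hr))⟩

/-! ### Changes of the truncated lists are caused by instances -/

/-- If `x` entered `∅'` since the latest event with second component below `s`, where `x < s`,
then some active instance restrains `x` from choosing numbers below `s`. -/
theorem exists_instance_of_entered {s x k v : ℕ} (hxs : x < s) (hx : (x, k) ∈ (state P v).1)
    (hx' : (x, k) ∉ trunc s (state P v).1) : ∃ i ∈ (state P v).2, i.2.1 ≤ x ∧ s ≤ i.2.2 := by
  revert hx hx'
  refine state_induction (p := fun S => (x, k) ∈ S.1 → (x, k) ∉ trunc s S.1 →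
    ∃ i ∈ S.2, i.2.1 ≤ x ∧ s ≤ i.2.2) (by simp) ?_ ?_ v
  · intro S y _ _ ih hx hx'
    rcases lt_or_ge (restraint y S.2) s with hk | hk
    · exact absurd hx (by rwa [addEvent, trunc_cons_of_lt _ hk] at hx')
    rw [addEvent, trunc_cons_of_le _ hk] at hx'
    -- If x < y, the instance restraining x restrains y too and survives. If y ≤ x, then y < s is at
    -- most the chosen marker minus one, so the marker comes from an instance, and this instance
    -- also restrains x.
    rcases lt_or_ge x y with hxy | hxy
    · have hx : (x, k) ∈ S.1 := (List.mem_cons.1 hx).resolve_left fun h => by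
        simp only [Prod.mk.injEq] at h; omega
      obtain ⟨i, hi, hix, his⟩ := ih hx hx'
      exact ⟨i, mem_addEvent hi (le_restraint_of_mem hi (hix.trans hxy.le)), hix, his⟩
    · obtain ⟨i, hi, hiy, hir⟩ := (restraint_eq_or y S.2).resolve_left (by omega)
      exact ⟨i, mem_addEvent hi hir.le, by omega, by omega⟩
  · intro S e n r _ _ ih hx hx'
    obtain ⟨i, hi, h⟩ := ih hx hx'
    exact ⟨i, List.mem_cons_of_mem _ hi, h⟩

/-- A marker below s makes the smaller truncation complete, and one above s affects neither
truncation and removes no instance with r = s. Only the marker s matters: an instance behind the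
change then has r ≥ s but must respect r ≤ s in order to be compatible with this marker. -/
theorem exists_instance_of_mem_trunc_succ {s x k v : ℕ} (hxs : x < s)
    (hx : (x, k) ∈ trunc (s + 1) (state P v).1) (hx' : (x, k) ∉ trunc s (state P v).1) :
    ∃ i ∈ (state P v).2, i.2.1 ≤ x ∧ i.2.2 = s := by
  induction v with
  | zero => simp [state, trunc] at hx
  | succ v ih =>
    revert hx hx'
    refine step_induction (p := fun S => (x, k) ∈ trunc (s + 1) S.1 → (x, k) ∉ trunc s S.1 →
      ∃ i ∈ S.2, i.2.1 ≤ x ∧ i.2.2 = s) v ?_ ?_ ih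
    · intro y _ _ _ hx hx'
      rcases lt_trichotomy (restraint y (state P v).2) s with hk | hk | hk
      · rw [addEvent, trunc_cons_of_lt _ hk] at hx'
        exact absurd (mem_of_mem_trunc hx) hx'
      · rw [addEvent, trunc_cons_of_lt _ (by omega)] at hx
        rw [addEvent, trunc_cons_of_le _ hk.ge] at hx'
        rcases lt_or_ge x y with hxy | hxy
        · have hx : (x, k) ∈ (state P v).1 := (List.mem_cons.1 hx).resolve_left fun h => by
            simp only [Prod.mk.injEq] at h; omega
          obtain ⟨i, hi, hix, his⟩ := exists_instance_of_entered hxs hx hx'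
          have := le_restraint_of_mem hi (hix.trans hxy.le)
          exact ⟨i, mem_addEvent hi this, hix, by omega⟩
        · obtain ⟨i, hi, hiy, hir⟩ := (restraint_eq_or y (state P v).2).resolve_left (by omega)
          exact ⟨i, mem_addEvent hi hir.le, by omega, by omega⟩
      · rw [addEvent, trunc_cons_of_le _ (by exact hk)] at hx
        rw [addEvent, trunc_cons_of_le _ hk.le] at hx'
        obtain ⟨i, hi, hix, his⟩ := ih hx hx'
        exact ⟨i, mem_addEvent hi (by omega), hix, his⟩
    · intro S e n r _ _ ih hx hx'
      obtain ⟨i, hi, h⟩ := ih hx hx'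
      exact ⟨i, List.mem_cons_of_mem _ hi, h⟩

/-- The charging principle behind both the cost bound and the loss bound. At a settled stage the
instance responsible for the change can no longer be cancelled. -/
theorem exists_permanent_of_change {s x k : ℕ} (hxs : x < s) (hx : (x, k) ∈ limTrunc P (s + 1))
    (hx' : (x, k) ∉ limTrunc P s) : ∃ e n, n ≤ x ∧ Permanent P e n s := by
  obtain ⟨v, hv⟩ := exists_settled (P := P) (s + 1)
  have hv' : Settled P s v := fun q hq h => hv q hq (by omega)
  rw [← hv.trunc_eq] at hx
  rw [← hv'.trunc_eq] at hx'
  obtain ⟨⟨e, n, r⟩, hi, hn, rfl⟩ := exists_instance_of_mem_trunc_succ hxs hx hx'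
  exact ⟨e, n, hn, permanent_of_settled hv' hi⟩

/-! ### Activity of a requirement in the limit -/

/-- Choosing the least eligible code keeps n below any fixed eligible code m. So once all numbers up
to m that ever enter ∅' have entered, a new instance cannot be injured. -/
theorem instance_new {v : ℕ} {i : ℕ × ℕ × ℕ} (hi : i ∈ (state P (v + 1)).2)
    (hi' : i ∉ (state P v).2) : i.1 = v.unpair.1 ∧ ∀ m < v,
      P i.1 m.unpair.1 m.unpair.2 (trunc m.unpair.2 (state P (v + 1)).1) = true → i.2.1 ≤ m := by
  have hfst : (state P (v + 1)).1 = _ := fst_actStep v (eventStep v (state P v))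
  have hsub : i ∉ (eventStep v (state P v)).2 := by
    unfold eventStep
    cases enters v (state P v).1
    · exact hi'
    · exact fun h => hi' (of_mem_addEvent h).1
  change i ∈ (actStep P v (eventStep v (state P v))).2 at hi
  rw [hfst]
  rcases actStep_cases (P := P) v (eventStep v (state P v)) with ⟨h, -⟩ | ⟨m, -, -, hmin, h⟩
  · exact absurd (h ▸ hi) hsub
  · rw [h] at hi
    obtain rfl := (List.mem_cons.1 hi).resolve_right hsub
    refine ⟨rfl, fun m' _ hP => ?_⟩
    refine (Nat.unpair_left_le m).trans (not_lt.1 fun hlt => ?_)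
    simp [hmin m' hlt] at hP

theorem exists_instance_of_eligible {v m : ℕ} (hm : m < v)
    (hP : P v.unpair.1 m.unpair.1 m.unpair.2
      (trunc m.unpair.2 (state P (v + 1)).1) = true) :
    ∃ i ∈ (state P (v + 1)).2, i.1 = v.unpair.1 := by
  have hfst : (state P (v + 1)).1 = _ := fst_actStep v (eventStep v (state P v))
  rw [hfst] at hP
  change ∃ i ∈ (actStep P v (eventStep v (state P v))).2, _
  rcases actStep_cases (P := P) v (eventStep v (state P v)) with ⟨h, h'⟩ | ⟨m, -, -, -, h⟩
  · rw [h]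
    refine h'.resolve_right fun h' => ?_
    simp [h' m hm] at hP
  · rw [h]
    exact ⟨_, List.mem_cons_self, rfl⟩

/-- A requirement without a permanent instance is never eligible in the limit. -/
theorem eligible_false_of_not_permanent {e : ℕ} (he : ∀ n r, ¬ Permanent P e n r) (n r : ℕ) :
    P e n r (limTrunc P r) = false := by
  by_contra hP
  rw [Bool.not_eq_false] at hP
  set m := Nat.pair n r with hm
  obtain ⟨v₁, hv₁⟩ := exists_settled (P := P) (r + 1)
  have hs : ∀ v, v₁ ≤ v → trunc r (state P v).1 = limTrunc P r := fun v hv =>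
    Settled.trunc_eq fun q hq h => (hv₁.mono hv) q hq (by omega)
  -- from stage `v₂` on all events have a first component greater than `m`
  obtain ⟨v₂, hv₂⟩ := exists_stage_fst_lt (P := P) (m + 1)
  have hno : ∀ v, v₂ ≤ v → ∀ n' r', n' ≤ m → (e, n', r') ∉ (state P v).2 :=
    fun v hv n' r' hn' hi => he n' r' (permanent_of_forall_lt
      (fun q hq h => (state_suffix hv).subset (hv₂ q hq (by omega))) hi)
  -- no instance of `e` is added
  have hback : ∀ w, max (m + 1) (max v₁ v₂) ≤ w → ∀ i ∈ (state P (w + 1)).2, i.1 = e →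
      i ∈ (state P w).2 := by
    rintro w hw ⟨e', n', r'⟩ hi rfl
    by_contra hnew
    obtain ⟨rfl, hle⟩ := instance_new hi hnew
    refine hno (w + 1) (by omega) n' r' (hle m (by omega) ?_) hi
    rw [hm, Nat.unpair_pair, hs _ (by omega)]
    exact hP
  have hnone : ∀ u w, max (m + 1) (max v₁ v₂) ≤ u → u ≤ w → (∀ i ∈ (state P u).2, i.1 ≠ e) →
      ∀ i ∈ (state P w).2, i.1 ≠ e := by
    intro u w hu huw h
    induction huw with
    | refl => exact h
    | @step w huw ih => exact fun i hi hie => ih i (hback w (hu.trans huw) i hi hie) hie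
  -- An instance still present is not permanent, hence disappears at some later stage, and no other
  -- instance of e can have replaced it.
  obtain ⟨u, hu, hue⟩ : ∃ u, max (m + 1) (max v₁ v₂) ≤ u ∧ ∀ i ∈ (state P u).2, i.1 ≠ e := by
    set u := max (m + 1) (max v₁ v₂)
    by_cases h : ∀ i ∈ (state P u).2, i.1 ≠ e
    · exact ⟨u, le_rfl, h⟩
    push Not at h
    obtain ⟨⟨e', n', r'⟩, hi, rfl⟩ := h
    have := he n' r'
    simp only [Permanent, not_exists, not_forall] at this
    obtain ⟨w, hw, hnot⟩ := this u
    refine ⟨w, hw, ?_⟩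
    have key : ∀ w, u ≤ w → ∀ i ∈ (state P w).2, i.1 = e' → i ∈ (state P u).2 := by
      intro w hw
      induction hw with
      | refl => exact fun i hi _ => hi
      | @step w huw ih => exact fun i hi hie => ih i (hback w huw i hi hie) hie
    intro i hi' hie
    exact hnot (instance_eq (key w hw i hi' hie) hi hie ▸ hi')
  -- contradiction at a later stage of the form `⟨e, j⟩`
  have hj : u ≤ Nat.pair e u := Nat.right_le_pair _ _
  obtain ⟨i, hi, hie⟩ := exists_instance_of_eligible (P := P) (v := Nat.pair e u) (m := m)
    (by omega) (by rw [Nat.unpair_pair, hm, Nat.unpair_pair, hs _ (by omega)]; exact hP)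
  exact hnone u _ hu (by omega) hue i hi (by simpa using hie)

end

/-! ### Computably enumerable sets and the halting problem -/

theorem rePred_of_search {α : Type*} [Primcodable α] {Q : α → ℕ → Bool}
    (hQ : Primrec fun p : α × ℕ => Q p.1 p.2) {R : α → Prop}
    (hR : ∀ a, R a ↔ ∃ w, Q a w = true) : REPred R := by
  have h := ceIn_of_search (α := α) ∅ (Q := fun a σ => Q a σ.length) (S := {a | R a})
    (hQ.comp (g := fun p : α × List Bool => (p.1, p.2.length)) (by fun_prop))
    (by simpa using hR)
  refine RecursiveIn.partrec_of_const (s := Part.some 0) ?_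
  have : charFn ∅ = fun _ => Part.some 0 := by
    funext n; simp [charFn]
  rw [← this]
  exact h

/-- Every c.e. set is many-one reducible to the halting problem. -/
theorem exists_reduction_halting {R : ℕ → Prop} (hR : REPred R) :
    ∃ h : ℕ → ℕ, Primrec h ∧ ∀ k, h k ∈ halting ↔ R k := by
  -- The second argument is ignored, so after currying with k the program halts on its own code
  -- exactly if `R k` holds.
  have h1 : Partrec fun p : ℕ => (Part.assert (R p.unpair.1) fun _ => Part.some ()).map
      fun _ => (0 : ℕ) :=
    Partrec.map (Partrec.comp hR (Primrec.to_comp (by fun_prop)))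
      (Primrec.to_comp (by fun_prop))
  obtain ⟨c, hc⟩ := Nat.Partrec.Code.exists_code.1 (Partrec.nat_iff.1 h1)
  refine ⟨fun k => Encodable.encode (Nat.Partrec.Code.curry c k),
    primrec_encode (Nat.Partrec.Code.primrec₂_curry.comp (Primrec.const c) Primrec.id),
    fun k => ?_⟩
  simp [halting, Nat.Partrec.Code.eval_curry, hc, Part.assert]

section

variable {P : ℕ → ℕ → ℕ → List (ℕ × ℕ) → Bool}

/-! ### The set `D` and the approximation of `∅'` -/

/-- The set `D` enumerated by the construction. -/
def outSet (P : ℕ → ℕ → ℕ → List (ℕ × ℕ) → Bool) : Set ℕ := {d | d.unpair ∈ events P}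

/-- The first `r` bits of the part of `D` given by the events in `L`. -/
def outBits (r : ℕ) (L : List (ℕ × ℕ)) : List Bool :=
  (List.range r).map fun i => L.any fun q => q == i.unpair

/-- The first `r` bits of the set of numbers that occur in the events in `L`. -/
def fstBits (r : ℕ) (L : List (ℕ × ℕ)) : List Bool :=
  (List.range r).map fun i => L.any fun q => q.1 == i

/-- The approximation of `∅'` that is computable from `D`. -/
noncomputable def approx (P : ℕ → ℕ → ℕ → List (ℕ × ℕ) → Bool) (s : ℕ) : Finset ℕ :=
  ((limTrunc P (s + 1)).map Prod.fst).toFinset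

variable (P) in
/-- The string `σ` shows that all events with second component below `r` have taken place before
stage `|σ|`. -/
def settledCheck (r : ℕ) (σ : List Bool) : Bool :=
  (List.range r).all fun y => (List.range r).all fun k =>
    (σ[Nat.pair y k]? == some false) || (state P σ.length).1.any fun q => q == (y, k)

@[fun_prop]
theorem primrec_outBits {α : Type*} [Primcodable α] {r : α → ℕ} {L : α → List (ℕ × ℕ)}
    (hr : Primrec r) (hL : Primrec L) : Primrec fun a => outBits (r a) (L a) := by
  unfold outBits; fun_prop

@[fun_prop]
theorem primrec_fstBits {α : Type*} [Primcodable α] {r : α → ℕ} {L : α → List (ℕ × ℕ)}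
    (hr : Primrec r) (hL : Primrec L) : Primrec fun a => fstBits (r a) (L a) := by
  unfold fstBits; fun_prop

theorem primrec_settledCheck {α : Type*} [Primcodable α] (hP : Primrec (state P))
    {r : α → ℕ} {σ : α → List Bool} (hr : Primrec r) (hσ : Primrec σ) :
    Primrec fun a => settledCheck P (r a) (σ a) := by
  unfold settledCheck; fun_prop

theorem ce_outSet (hP : Primrec (state P)) : CE (outSet P) := by
  refine rePred_of_search (Q := fun d v => (state P v).1.any fun q => q == d.unpair)
    (by fun_prop) fun d => ?_
  simp [outSet, events]

/-- A pair with code below r has its marker below r, so its event survives truncation. Hence a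
permanent instance has seen the true initial segment of `D`. -/
theorem outBits_limTrunc (r : ℕ) : outBits r (limTrunc P r) = restr (outSet P) r := by
  simp only [outBits, restr]
  refine List.map_congr_left fun i hi => ?_
  rw [Bool.eq_iff_iff]
  simp only [List.any_eq_true, beq_iff_eq, exists_eq_right, decide_eq_true_eq]
  change _ ↔ i.unpair ∈ events P
  exact ⟨limTrunc_subset_events, fun h => mem_limTrunc_of_lt h
    ((Nat.unpair_right_le i).trans_lt (List.mem_range.1 hi))⟩

theorem mem_approx {s x : ℕ} : x ∈ approx P s ↔ ∃ k, (x, k) ∈ limTrunc P (s + 1) := by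
  simp [approx]

theorem fstBits_limTrunc (s l : ℕ) : fstBits l (limTrunc P (s + 1)) = restr (approx P s) l := by
  simp only [fstBits, restr]
  refine List.map_congr_left fun i hi => ?_
  rw [Bool.eq_iff_iff]
  simp [mem_approx]

theorem approx_mono {s t : ℕ} (h : s ≤ t) : approx P s ⊆ approx P t := by
  intro x
  simp only [mem_approx]
  exact fun ⟨k, hk⟩ => ⟨k, (limTrunc_suffix (by omega)).subset hk⟩

theorem eventually_mem_approx_iff (x : ℕ) : ∀ᶠ s in atTop, x ∈ approx P s ↔ x ∈ halting := by
  by_cases hx : x ∈ halting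
  · obtain ⟨v, k, hk⟩ := exists_mem_state (P := P) hx
    filter_upwards [eventually_ge_atTop k] with s hs
    simp only [hx, iff_true, mem_approx]
    exact ⟨k, mem_limTrunc_of_lt ⟨v, hk⟩ (by simp only; omega)⟩
  · refine Eventually.of_forall fun s => ?_
    simp only [hx, iff_false, mem_approx, not_exists]
    intro k hk
    obtain ⟨v, hv⟩ := limTrunc_subset_events hk
    exact hx (fst_mem_halting hv)

theorem exists_permanent_of_approx {s x : ℕ} (hxs : x < s) (hx : x ∈ approx P s)
    (hx' : x ∉ approx P (s - 1)) : ∃ e n, n ≤ x ∧ Permanent P e n s := by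
  obtain ⟨k, hk⟩ := mem_approx.1 hx
  refine exists_permanent_of_change hxs hk fun h => hx' (mem_approx.2 ⟨k, ?_⟩)
  rwa [Nat.sub_add_cancel (by omega)]

theorem settled_of_check {r l : ℕ} (h : settledCheck P r (restr (outSet P) l) = true) :
    Settled P r l := by
  rintro ⟨y, k⟩ hq hk
  obtain ⟨w, hw⟩ := id hq
  -- Markers dominate their numbers, so the r × r square examined by the check contains all relevant
  -- pairs.
  have hyk : y ≤ k := fst_le_snd hw
  simp only [settledCheck, List.all_eq_true, List.mem_range, Bool.or_eq_true, beq_iff_eq,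
    length_restr, List.any_eq_true, exists_eq_right] at h
  refine (h y (hyk.trans_lt hk) k hk).resolve_left fun h => ?_
  rw [getElem?_restr_eq_some_false] at h
  exact h.2 (by simpa [outSet] using hq)

theorem exists_check (r : ℕ) : ∃ l₀, ∀ l, l₀ ≤ l → settledCheck P r (restr (outSet P) l) = true := by
  obtain ⟨v, hv⟩ := exists_settled (P := P) r
  refine ⟨max v (Nat.pair r r), fun l hl => ?_⟩
  simp only [settledCheck, List.all_eq_true, List.mem_range, Bool.or_eq_true, beq_iff_eq,
    length_restr, List.any_eq_true, exists_eq_right]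
  intro y hy k hk
  rw [getElem?_restr_eq_some_false]
  have : Nat.pair y k < Nat.pair r r :=
    (Nat.pair_lt_pair_left k hy).trans (Nat.pair_lt_pair_right r hk)
  by_cases h : Nat.pair y k ∈ outSet P
  · refine Or.inr (hv.mono (le_trans (le_max_left _ _) hl) _ ?_ hk)
    simpa [outSet] using h
  · exact Or.inl ⟨by omega, h⟩

/-! ### Incompleteness of `D` -/

variable (P) in
/-- The codes `⟨e, n⟩` of the permanent instances. -/
def permanentSet : Set ℕ := {x | ∃ r, Permanent P x.unpair.1 x.unpair.2 r}

theorem turingLE_permanentSet (hP : Primrec (state P)) :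
    TuringLE (permanentSet P) halting := by
  classical
  -- Here k codes ⟨⟨e,n⟩,v⟩, and the question is whether some instance of e with this n is active at
  -- a stage after v. It is Σ₁, hence one query to ∅'.
  have hR : REPred fun k : ℕ => ∃ w, (Nat.ble k.unpair.2 w && (state P w).2.any fun i =>
      i.1 == k.unpair.1.unpair.1 && i.2.1 == k.unpair.1.unpair.2) = true :=
    rePred_of_search (by fun_prop) fun _ => Iff.rfl
  obtain ⟨h, hprim, hh⟩ := exists_reduction_halting hR
  let Q : ℕ → List Bool → Option ℕ := fun x σ => (List.range σ.length).findSome? fun v =>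
    bif (List.range x.unpair.2).all fun y => (σ[y]? == some false) ||
      (state P v).1.any fun q => q.1 == y then
      (σ[h (Nat.pair x v)]?).map fun b => bif b then 1 else 0
    else none
  have hQ : Primrec fun p : ℕ × List Bool => Q p.1 p.2 := by
    unfold Q; fun_prop
  have key : ∀ x v, (∀ y < x.unpair.2, y ∈ halting → ∃ q ∈ (state P v).1, q.1 = y) →
      (h (Nat.pair x v) ∈ halting ↔ x ∈ permanentSet P) := by
    intro x v hv
    rw [hh]
    simp only [Nat.unpair_pair, Bool.and_eq_true, Nat.ble_eq, List.any_eq_true, beq_iff_eq,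
      permanentSet, Set.mem_ofPred_eq]
    constructor
    · rintro ⟨w, hvw, ⟨e, n, r⟩, hi, rfl, rfl⟩
      refine ⟨r, permanent_of_forall_lt (v := w) (fun q hq hqn => ?_) hi⟩
      obtain ⟨u, hu⟩ := id hq
      obtain ⟨q', hq', he⟩ := hv q.1 hqn (fst_mem_halting hu)
      rw [← eq_of_fst_eq ⟨v, hq'⟩ hq he]
      exact (state_suffix hvw).subset hq'
    · rintro ⟨r, w, hw⟩
      exact ⟨max v w, le_max_left _ _, _, hw _ (le_max_right _ _), rfl, rfl⟩
  refine computableIn_of_search halting (Q := Q)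
    (f := fun x => if x ∈ permanentSet P then 1 else 0) hQ ?_ ?_
  · intro x
    obtain ⟨v, hv⟩ := exists_stage_fst_lt (P := P) x.unpair.2
    refine ⟨max (v + 1) (max (h (Nat.pair x v) + 1) (x.unpair.2)), ?_⟩
    simp only [Q, List.findSome?_isSome_iff, length_restr, List.mem_range]
    refine ⟨v, by omega, ?_⟩
    have h1 : ((List.range x.unpair.2).all fun y =>
        ((restr halting (max (v + 1) (max (h (Nat.pair x v) + 1) (x.unpair.2))))[y]? ==
          some false) || (state P v).1.any fun q => q.1 == y) = true := by
      simp only [List.all_eq_true, List.mem_range, Bool.or_eq_true, beq_iff_eq,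
        List.any_eq_true, getElem?_restr_eq_some_false]
      intro y hy
      by_cases hyh : y ∈ halting
      · obtain ⟨w, k, hk⟩ := exists_mem_state (P := P) hyh
        exact Or.inr ⟨(y, k), hv _ ⟨w, hk⟩ hy, rfl⟩
      · exact Or.inl ⟨by omega, hyh⟩
    rw [h1, getElem?_restr _ (by omega)]
    rfl
  · intro x l b hb
    obtain ⟨v, -, hv⟩ := List.exists_of_findSome?_eq_some hb
    rcases hc : (List.range x.unpair.2).all fun y => ((restr halting l)[y]? == some false) ||
      (state P v).1.any fun q => q.1 == y
    · simp [hc] at hv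
    rw [hc] at hv
    simp only [cond_true, Option.map_eq_some_iff] at hv
    obtain ⟨b', hb', rfl⟩ := hv
    have := key x v fun y hy hyh => by
      simp only [List.all_eq_true, List.mem_range, Bool.or_eq_true, beq_iff_eq,
        List.any_eq_true, getElem?_restr_eq_some_false] at hc
      exact (hc y hy).resolve_left fun h => h.2 hyh
    cases b'
    · simp [← this, ((getElem?_restr_eq_some_false _).1 hb').2]
    · simp [← this, ((getElem?_restr_eq_some_true _).1 hb').2]

end

/-! ### Eligibility and diagonalisation -/

/-- The `e`-th requirement may act with the instance `(e, n, r)`: with an oracle given by the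
events in `L`, the `e`-th functional is seen with use at most `r` to have the value `0` at
`⟨e, n⟩`, and `good e n r L` holds. -/
def eligible (good : ℕ → ℕ → ℕ → List (ℕ × ℕ) → Bool) (e n r : ℕ) (L : List (ℕ × ℕ)) : Bool :=
  ((List.range (r + 1)).any fun l =>
    Nat.Partrec.Code.evaln r (Denumerable.ofNat Nat.Partrec.Code e)
      (Encodable.encode ((outBits r L).take l, Nat.pair e n)) == some 0) && good e n r L

variable {good : ℕ → ℕ → ℕ → List (ℕ × ℕ) → Bool}

theorem primrec_eligible
    (hg : Primrec fun q : ℕ × ℕ × ℕ × List (ℕ × ℕ) => good q.1 q.2.1 q.2.2.1 q.2.2.2) :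
    Primrec fun q : ℕ × ℕ × ℕ × List (ℕ × ℕ) => eligible good q.1 q.2.1 q.2.2.1 q.2.2.2 := by
  unfold eligible
  exact primrec_band (by fun_prop) hg

theorem not_turingLE_outSet
    (hg : Primrec fun q : ℕ × ℕ × ℕ × List (ℕ × ℕ) => good q.1 q.2.1 q.2.2.1 q.2.2.2)
    (hlim : ∀ e, ∃ n, ∀ r, good e n r (limTrunc (eligible good) r) = true) :
    ¬ TuringLE halting (outSet (eligible good)) := by
  intro hle
  set P := eligible good with hPdef
  have hE : TuringLE (permanentSet P) (outSet P) :=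
    TuringReducible.trans (turingLE_permanentSet (primrec_state (primrec_eligible hg))) hle
  obtain ⟨c, hc⟩ := exists_computesFrom (RecursiveIn.iff_nat.1 hE)
  set e := Encodable.encode c with he
  have hec : Denumerable.ofNat Nat.Partrec.Code e = c := Denumerable.ofNat_encode c
  have hzero : ∀ x, 0 ∈ charFn (permanentSet P) x ↔ x ∉ permanentSet P := by
    intro x
    by_cases hx : x ∈ permanentSet P <;> simp [charFn, hx]
  by_cases hperm : ∃ n r, Permanent P e n r
  -- The permanent instance puts ⟨e,n⟩ into the set, while its eligibility preserves a computation
  -- from `D` giving 0 there.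
  · obtain ⟨n, r, hp⟩ := hperm
    have hspec := hp.spec
    simp only [hPdef, eligible, Bool.and_eq_true, List.any_eq_true, List.mem_range, beq_iff_eq,
      hec] at hspec
    obtain ⟨⟨l, hl, hev⟩, -⟩ := hspec
    rw [← hPdef, outBits_limTrunc, take_restr_of_le _ (by omega)] at hev
    refine (hzero (Nat.pair e n)).1 ((hc _ _).2 ⟨l, r, hev⟩) ⟨r, ?_⟩
    simpa using hp
  · push Not at hperm
    obtain ⟨n, hn⟩ := hlim e
    have h0 : 0 ∈ charFn (permanentSet P) (Nat.pair e n) :=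
      (hzero _).2 fun ⟨r, hr⟩ => hperm n r (by simpa using hr)
    obtain ⟨l, k, hlk⟩ := (hc _ _).1 h0
    -- The maximum bounds both the use l and the number k of steps, as eligibility uses one
    -- parameter for the two.
    refine absurd (eligible_false_of_not_permanent hperm n (max l k)) ?_
    rw [Bool.not_eq_false]
    conv_lhs => rw [hPdef]
    simp only [eligible, Bool.and_eq_true, List.any_eq_true, List.mem_range, beq_iff_eq, hec]
    refine ⟨⟨l, by omega, ?_⟩, hn _⟩
    rw [← hPdef, outBits_limTrunc, take_restr_of_le _ (le_max_left _ _)]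
    exact Nat.Partrec.Code.evaln_mono (le_max_right _ _) hlk

/-! ### Clopen sets in Cantor space -/

/-- The first `m` bits of `X`. -/
def pre (X : ℕ → Bool) (m : ℕ) : List Bool := (List.range m).map X

@[simp]
theorem length_pre (X : ℕ → Bool) (m : ℕ) : (pre X m).length = m := by simp [pre]

theorem take_pre (X : ℕ → Bool) {m l : ℕ} (h : m ≤ l) : (pre X l).take m = pre X m := by
  simp only [pre, ← List.map_take, List.take_range, min_eq_left h]

theorem pre_prefix (X : ℕ → Bool) {m l : ℕ} (h : m ≤ l) : pre X m <+: pre X l := by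
  rw [← take_pre X h]
  exact List.take_prefix _ _

theorem mem_cylinder_iff {X : ℕ → Bool} {σ : List Bool} :
    X ∈ cylinder σ ↔ pre X σ.length = σ := by
  change (∀ i (h : i < σ.length), X i = σ[i]) ↔ _
  constructor
  · intro h
    refine List.ext_getElem (by simp) fun i h1 h2 => ?_
    simpa [pre] using h i h2
  · intro h i hi
    have : (pre X σ.length)[i]'(by simpa) = X i := by simp [pre]
    rw [← this]
    simp [h]

/-- All strings of length `m`. -/
def boolLists : ℕ → List (List Bool)
  | 0 => [[]]
  | m + 1 => (boolLists m).flatMap fun τ => [false :: τ, true :: τ]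

theorem primrec_boolLists : Primrec boolLists := by
  refine (Primrec.nat_rec₁ (f := fun _ (L : List (List Bool)) =>
    L.flatMap fun τ => [false :: τ, true :: τ]) [[]] ?_).of_eq fun m => ?_
  · change Primrec fun p : ℕ × List (List Bool) => p.2.flatMap fun τ => [false :: τ, true :: τ]
    fun_prop
  · induction m with
    | zero => rfl
    | succ m ih => simp only [boolLists, ← ih]

theorem mem_boolLists {m : ℕ} {τ : List Bool} : τ ∈ boolLists m ↔ τ.length = m := by
  induction m generalizing τ with
  | zero => simp [boolLists]
  | succ m ih =>
    simp only [boolLists, List.mem_flatMap, ih, List.mem_cons, List.not_mem_nil, or_false]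
    constructor
    · rintro ⟨τ', rfl, rfl | rfl⟩ <;> rfl
    · rcases τ with _ | ⟨b, τ⟩
      · simp
      · intro h
        refine ⟨τ, by simpa using h, ?_⟩
        cases b <;> simp

theorem nodup_boolLists (m : ℕ) : (boolLists m).Nodup := by
  induction m with
  | zero => simp [boolLists]
  | succ m ih =>
    rw [boolLists, List.nodup_flatMap]
    refine ⟨fun τ _ => by simp, ih.imp fun {σ τ} h => ?_⟩
    simp only [Function.onFun, List.disjoint_left, List.mem_cons, List.not_mem_nil, or_false]
    rintro _ (rfl | rfl) (h' | h') <;> simp_all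

instance : IsProbabilityMeasure coinMeasure := by
  unfold coinMeasure; infer_instance

theorem measurableSet_cylinder (σ : List Bool) : MeasurableSet (cylinder σ) := by
  have : cylinder σ = ⋂ i : Fin σ.length, (fun X : ℕ → Bool => X i) ⁻¹' {σ[i]} := by
    ext X
    simp only [Set.mem_iInter, Set.mem_preimage, Set.mem_singleton_iff]
    exact ⟨fun h i => h i i.2, fun h i hi => h ⟨i, hi⟩⟩
  rw [this]
  exact MeasurableSet.iInter fun i => measurable_pi_apply _ (MeasurableSet.singleton _)

theorem coinMeasure_cylinder (σ : List Bool) : coinMeasure (cylinder σ) = 2⁻¹ ^ σ.length := by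
  have : cylinder σ = Set.pi (Finset.range σ.length) fun i => {σ.getD i false} := by
    ext X
    simp only [Set.mem_pi, Finset.coe_range, Set.mem_Iio, Set.mem_singleton_iff]
    refine forall_congr' fun i => forall_congr' fun hi => ?_
    simp [hi]
  rw [this, coinMeasure, Measure.infinitePi_pi _ fun i _ => MeasurableSet.singleton _]
  simp

/-- The number of strings of length `m` that satisfy `T`. -/
def countLists (m : ℕ) (T : List Bool → Bool) : ℕ := ((boolLists m).filter T).length

theorem clopen_eq (m : ℕ) (T : List Bool → Bool) : {X : ℕ → Bool | T (pre X m) = true} =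
    ⋃ τ ∈ ((boolLists m).filter T).toFinset, cylinder τ := by
  ext X
  simp only [Set.mem_iUnion, List.mem_toFinset, List.mem_filter, mem_boolLists, exists_prop,
    mem_cylinder_iff]
  constructor
  · intro h
    exact ⟨pre X m, ⟨by simp, h⟩, by simp⟩
  · rintro ⟨τ, ⟨rfl, h⟩, hX⟩
    change T (pre X τ.length) = true
    rwa [hX]

theorem measurableSet_clopen (m : ℕ) (T : List Bool → Bool) :
    MeasurableSet {X : ℕ → Bool | T (pre X m) = true} := by
  rw [clopen_eq]
  exact Finset.measurableSet_biUnion _ fun τ _ => measurableSet_cylinder τ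

theorem coinMeasure_clopen (m : ℕ) (T : List Bool → Bool) :
    coinMeasure {X : ℕ → Bool | T (pre X m) = true} = countLists m T * 2⁻¹ ^ m := by
  rw [clopen_eq, measure_biUnion_finset _ fun τ _ => measurableSet_cylinder τ]
  · rw [Finset.sum_congr rfl (g := fun _ => (2⁻¹ : ENNReal) ^ m)]
    · rw [Finset.sum_const, List.toFinset_card_of_nodup ((nodup_boolLists m).filter _),
        nsmul_eq_mul, countLists]
    · intro τ hτ
      rw [coinMeasure_cylinder]
      simp only [List.mem_toFinset, List.mem_filter, mem_boolLists] at hτ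
      rw [hτ.1]
  · intro σ hσ τ hτ hne
    simp only [Finset.mem_coe, List.mem_toFinset, List.mem_filter, mem_boolLists] at hσ hτ
    refine Set.disjoint_left.2 fun X hX hX' => hne ?_
    rw [mem_cylinder_iff] at hX hX'
    rw [← hX, ← hX', hσ.1, hτ.1]

theorem coinMeasure_real_clopen (m : ℕ) (T : List Bool → Bool) :
    coinMeasure.real {X : ℕ → Bool | T (pre X m) = true} = countLists m T / 2 ^ m := by
  rw [Measure.real, coinMeasure_clopen]
  simp [div_eq_mul_inv]

/-! ### A sequence of strings with small losses -/

section Potential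

variable {u : List Bool → Set (ℕ → Bool)} {ρ : ℕ → List Bool} {cp : ℕ → ℕ}

/-- Each increment is a net change of the potential m along ρ plus a loss; the net changes
telescope. -/
theorem sum_increment_le {m : List Bool → ℝ} {Λ B : ℝ} (hB : ∀ σ, m σ ≤ B)
    (hloss : ∀ N, ∑ s ∈ Finset.range N, (m (ρ s) - m ((ρ s).take (cp s))) ≤ Λ) (N : ℕ) :
    m (ρ 0) + ∑ s ∈ Finset.range N, (m (ρ (s + 1)) - m ((ρ s).take (cp s))) ≤ B + Λ := by
  have h : ∑ s ∈ Finset.range N, (m (ρ (s + 1)) - m ((ρ s).take (cp s))) =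
      ∑ s ∈ Finset.range N, (m (ρ (s + 1)) - m (ρ s)) +
        ∑ s ∈ Finset.range N, (m (ρ s) - m ((ρ s).take (cp s))) := by
    rw [← Finset.sum_add_distrib]
    exact Finset.sum_congr rfl fun s _ => by ring
  rw [h, Finset.sum_range_sub fun s => m (ρ s)]
  linarith [hB (ρ N), hloss N]

/-- The next set adds to the union only what lies outside the set of the preserved prefix, since
that one is contained in the preceding set. So the union is bounded by the increments. -/
theorem measure_iUnion_le_of_losses (hu : ∀ σ τ, σ <+: τ → u σ ⊆ u τ)
    (hmeas : ∀ σ, MeasurableSet (u σ)) (hcp : ∀ s, (ρ (s + 1)).take (cp s) = (ρ s).take (cp s))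
    {Λ B : ℝ} (hB : ∀ σ, coinMeasure.real (u σ) ≤ B)
    (hloss : ∀ N, ∑ s ∈ Finset.range N,
      (coinMeasure.real (u (ρ s)) - coinMeasure.real (u ((ρ s).take (cp s)))) ≤ Λ) :
    coinMeasure (⋃ s, u (ρ s)) ≤ ENNReal.ofReal (B + Λ) := by
  have hfin : ∀ N, coinMeasure.real (⋃ s ∈ Finset.range (N + 1), u (ρ s)) ≤
      coinMeasure.real (u (ρ 0)) + ∑ s ∈ Finset.range N, (coinMeasure.real (u (ρ (s + 1))) -
        coinMeasure.real (u ((ρ s).take (cp s)))) := by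
    intro N
    induction N with
    | zero => simp
    | succ N ih =>
      rw [Finset.sum_range_succ, ← add_assoc]
      have hsub : (⋃ s ∈ Finset.range (N + 1 + 1), u (ρ s)) ⊆
          (⋃ s ∈ Finset.range (N + 1), u (ρ s)) ∪ (u (ρ (N + 1)) \ u ((ρ N).take (cp N))) := by
        intro X hX
        simp only [Set.mem_iUnion, Finset.mem_range, exists_prop] at hX
        obtain ⟨s, hs, hX⟩ := hX
        have : ∀ t, t < N + 1 → X ∈ u (ρ t) → X ∈ ⋃ s ∈ Finset.range (N + 1), u (ρ s) :=
          fun t ht h => by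
            simp only [Set.mem_iUnion, Finset.mem_range, exists_prop]
            exact ⟨t, ht, h⟩
        rcases Nat.lt_succ_iff_lt_or_eq.1 hs with hs | rfl
        · exact Or.inl (this s hs hX)
        · by_cases h : X ∈ u ((ρ N).take (cp N))
          · exact Or.inl (this N (by omega) (hu _ _ (List.take_prefix _ _) h))
          · exact Or.inr ⟨hX, h⟩
      refine (measureReal_mono hsub).trans ((measureReal_union_le _ _).trans (add_le_add ih ?_))
      rw [measureReal_sdiff _ (hmeas _)]
      rw [← hcp]
      exact hu _ _ (List.take_prefix _ _)
  have hmono : Monotone fun N => ⋃ s ∈ Finset.range (N + 1), u (ρ s) := by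
    intro a b hab
    refine Set.biUnion_subset_biUnion_left fun s hs => ?_
    simp only [Finset.coe_range, Set.mem_Iio] at hs ⊢
    omega
  have hU : (⋃ s, u (ρ s)) = ⋃ N, ⋃ s ∈ Finset.range (N + 1), u (ρ s) := by
    ext X
    simp only [Set.mem_iUnion, Finset.mem_range, exists_prop]
    exact ⟨fun ⟨s, hs⟩ => ⟨s, s, by omega, hs⟩, fun ⟨N, s, _, hs⟩ => ⟨s, hs⟩⟩
  rw [hU, hmono.measure_iUnion]
  refine iSup_le fun N => ?_
  rw [← ofReal_measureReal (measure_ne_top _ _)]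
  exact ENNReal.ofReal_le_ofReal ((hfin N).trans
    (sum_increment_le (m := fun σ => coinMeasure.real (u σ)) hB hloss N))

/-- The increments are nonnegative with bounded partial sums, so their tails tend to 0, and a tail
dominates what lies beyond a fixed prefix length. -/
theorem exists_forall_sub_le_of_losses (hu : ∀ σ τ, σ <+: τ → u σ ⊆ u τ)
    (hcp : ∀ s, (ρ (s + 1)).take (cp s) = (ρ s).take (cp s)) {Λ B : ℝ} (hB : ∀ σ, coinMeasure.real (u σ) ≤ B)
    (hloss : ∀ N, ∑ s ∈ Finset.range N,
      (coinMeasure.real (u (ρ s)) - coinMeasure.real (u ((ρ s).take (cp s)))) ≤ Λ)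
    (hlen : ∀ s, (ρ s).length = s + 1) {ε : ℝ} (hε : 0 < ε) :
    ∃ n, ∀ s, coinMeasure.real (u (ρ s)) - coinMeasure.real (u ((ρ s).take n)) ≤ ε := by
  set m : List Bool → ℝ := fun σ => coinMeasure.real (u σ)
  have hmono : ∀ σ τ, σ <+: τ → m σ ≤ m τ := fun σ τ h => measureReal_mono (hu σ τ h)
  set I : ℕ → ℝ := fun s => m (ρ (s + 1)) - m ((ρ s).take (cp s)) with hI
  have hI0 : ∀ s, 0 ≤ I s := fun s => sub_nonneg.2 (by
    rw [← hcp]; exact hmono _ _ (List.take_prefix _ _))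
  have hsum : Summable I := by
    refine summable_of_sum_range_le (c := B + Λ) hI0 fun N => ?_
    have := sum_increment_le (m := m) hB hloss N
    linarith [show 0 ≤ m (ρ 0) from measureReal_nonneg]
  obtain ⟨n, hn⟩ := ((tendsto_order.1 hsum.tendsto_sum_tsum_nat).1 (∑' s, I s - ε)
    (by linarith)).exists
  have hrec : ∀ s, n ≤ s → m (ρ s) - m ((ρ s).take (n + 1)) ≤ ∑ t ∈ Finset.Ico n s, I t := by
    intro s hs
    induction s, hs using Nat.le_induction with
    | base => simp [List.take_of_length_le (hlen n).le]
    | succ s hs ih =>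
      rw [Finset.sum_Ico_succ_top hs]
      -- If the change reaches below n + 1, the newest increment alone suffices, because everything
      -- beyond the preserved prefix is new. Otherwise the prefix is unchanged and the induction
      -- hypothesis applies.
      rcases le_total (cp s) (n + 1) with hc | hc
      · have h1 : m ((ρ s).take (cp s)) ≤ m ((ρ (s + 1)).take (n + 1)) := by
          rw [← hcp]
          exact hmono _ _ (List.take_prefix_take_left hc)
        have h2 : 0 ≤ ∑ t ∈ Finset.Ico n s, I t := Finset.sum_nonneg fun t _ => hI0 t
        simp only [hI] at h2 ⊢
        linarith
      · have h1 : (ρ (s + 1)).take (n + 1) = (ρ s).take (n + 1) := by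
          have := congrArg (List.take (n + 1)) (hcp s)
          rwa [List.take_take, List.take_take, min_eq_left hc] at this
        have h2 : m ((ρ s).take (cp s)) ≤ m (ρ s) := hmono _ _ (List.take_prefix _ _)
        rw [h1]
        simp only [hI] at ih ⊢
        linarith
  refine ⟨n + 1, fun s => ?_⟩
  rcases le_total n s with hs | hs
  · refine (hrec s hs).trans ?_
    rw [Finset.sum_Ico_eq_sub _ hs]
    linarith [hsum.sum_le_tsum (Finset.range s) fun t _ => hI0 t]
  · rw [List.take_of_length_le (by rw [hlen]; omega)]
    simp [hε.le]

end Potential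

/-! ### Tests relative to a string oracle -/

/-- Some prefix of `τ` is seen to be in the `i`-th component of the `j`-th test, in `|ρ|` steps and
with the oracle information `ρ`. -/
def accepts (j i : ℕ) (ρ τ : List Bool) : Bool :=
  (List.range (ρ.length + 1)).any fun l => (List.range (τ.length + 1)).any fun p =>
    (Nat.Partrec.Code.evaln ρ.length (Denumerable.ofNat Nat.Partrec.Code j)
      (Encodable.encode (ρ.take l, Encodable.encode (i, τ.take p)))).isSome

/-- The number of strings of length `|ρ|` accepted with the oracle information `ρ`. -/
def hits (j i : ℕ) (ρ : List Bool) : ℕ := countLists ρ.length (accepts j i ρ)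

/-- The set accepted with the oracle information `ρ` has measure at most `2^{-i}`. -/
def small (j i : ℕ) (ρ : List Bool) : Bool := Nat.ble (hits j i ρ * 2 ^ i) (2 ^ ρ.length)

/-- For the tests and components with index at most `e`, going from `ρ ↾ n` to `ρ` increases the
measure of the accepted set by at most `2^{-(e+i)}`, as long as this measure is allowed. -/
def lrGood (e n : ℕ) (ρ : List Bool) : Bool :=
  (List.range (e + 1)).all fun j => (List.range (e + 1)).all fun i =>
    (List.range (ρ.length + 1)).all fun l =>
      !(Nat.ble n l) || !(small j i (ρ.take l)) ||
        Nat.ble (hits j i (ρ.take l) * 2 ^ n * 2 ^ (e + i))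
          (hits j i (ρ.take n) * 2 ^ l * 2 ^ (e + i) + 2 ^ l * 2 ^ n)

@[fun_prop]
theorem primrec_accepts {α : Type*} [Primcodable α] {j i : α → ℕ} {ρ τ : α → List Bool}
    (hj : Primrec j) (hi : Primrec i) (hρ : Primrec ρ) (hτ : Primrec τ) :
    Primrec fun a => accepts (j a) (i a) (ρ a) (τ a) := by
  unfold accepts; fun_prop

@[fun_prop]
theorem primrec_hits {α : Type*} [Primcodable α] {j i : α → ℕ} {ρ : α → List Bool}
    (hj : Primrec j) (hi : Primrec i) (hρ : Primrec ρ) :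
    Primrec fun a => hits (j a) (i a) (ρ a) := by
  unfold hits countLists
  have := primrec_boolLists
  fun_prop

@[fun_prop]
theorem primrec_small {α : Type*} [Primcodable α] {j i : α → ℕ} {ρ : α → List Bool}
    (hj : Primrec j) (hi : Primrec i) (hρ : Primrec ρ) :
    Primrec fun a => small (j a) (i a) (ρ a) := by
  unfold small; fun_prop

@[fun_prop]
theorem primrec_lrGood {α : Type*} [Primcodable α] {e n : α → ℕ} {ρ : α → List Bool}
    (he : Primrec e) (hn : Primrec n) (hρ : Primrec ρ) :
    Primrec fun a => lrGood (e a) (n a) (ρ a) := by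
  unfold lrGood; fun_prop

theorem accepts_iff {j i : ℕ} {ρ τ : List Bool} : accepts j i ρ τ = true ↔
    ∃ l ≤ ρ.length, ∃ p ≤ τ.length,
      (Nat.Partrec.Code.evaln ρ.length (Denumerable.ofNat Nat.Partrec.Code j)
        (Encodable.encode (ρ.take l, Encodable.encode (i, τ.take p)))).isSome := by
  simp only [accepts, List.any_eq_true, List.mem_range, Nat.lt_succ_iff]

theorem accepts_mono {j i : ℕ} {ρ ρ' τ τ' : List Bool} (hρ : ρ <+: ρ') (hτ : τ <+: τ')
    (h : accepts j i ρ τ = true) : accepts j i ρ' τ' = true := by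
  rw [accepts_iff] at h ⊢
  obtain ⟨l, hl, p, hp, h⟩ := h
  obtain ⟨x, hx⟩ := Option.isSome_iff_exists.1 h
  refine ⟨l, hl.trans hρ.length_le, p, hp.trans hτ.length_le, Option.isSome_iff_exists.2 ⟨x, ?_⟩⟩
  have h1 : ρ'.take l = ρ.take l := by
    obtain ⟨ρ₁, rfl⟩ := hρ
    exact List.take_append_of_le_length hl
  have h2 : τ'.take p = τ.take p := by
    obtain ⟨τ₁, rfl⟩ := hτ
    exact List.take_append_of_le_length hp
  rw [h1, h2]
  exact Nat.Partrec.Code.evaln_mono hρ.length_le hx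

/-! ### Accepted sets and their cut-off at the permitted measure -/

/-- The clopen set accepted with the oracle information `ρ`. -/
def acceptSet (j i : ℕ) (ρ : List Bool) : Set (ℕ → Bool) :=
  {X | accepts j i ρ (pre X ρ.length) = true}

/-- The part of `acceptSet` that is accepted before the measure becomes too large. -/
def cappedSet (j i : ℕ) (ρ : List Bool) : Set (ℕ → Bool) :=
  {X | ∃ l ≤ ρ.length, small j i (ρ.take l) = true ∧ X ∈ acceptSet j i (ρ.take l)}

variable {j i : ℕ}

theorem acceptSet_mono {ρ ρ' : List Bool} (h : ρ <+: ρ') : acceptSet j i ρ ⊆ acceptSet j i ρ' :=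
  fun X hX => accepts_mono h (pre_prefix X h.length_le) hX

theorem measureReal_acceptSet (ρ : List Bool) :
    coinMeasure.real (acceptSet j i ρ) = hits j i ρ / 2 ^ ρ.length :=
  coinMeasure_real_clopen _ _

theorem small_iff {ρ : List Bool} :
    small j i ρ = true ↔ coinMeasure.real (acceptSet j i ρ) ≤ (1 / 2) ^ i := by
  rw [measureReal_acceptSet, small, Nat.ble_eq, div_le_iff₀ (by positivity), one_div, inv_pow,
    inv_mul_eq_div, le_div_iff₀ (by positivity)]
  exact_mod_cast Iff.rfl

theorem small_of_prefix {ρ ρ' : List Bool} (h : ρ <+: ρ') (hs : small j i ρ' = true) :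
    small j i ρ = true :=
  small_iff.2 ((measureReal_mono (acceptSet_mono h)).trans (small_iff.1 hs))

theorem cappedSet_mono {ρ ρ' : List Bool} (h : ρ <+: ρ') : cappedSet j i ρ ⊆ cappedSet j i ρ' := by
  rintro X ⟨l, hl, hs, hX⟩
  have : ρ'.take l = ρ.take l := by
    obtain ⟨ρ₁, rfl⟩ := h
    exact List.take_append_of_le_length hl
  exact ⟨l, hl.trans h.length_le, by rwa [this], by rwa [this]⟩

theorem cappedSet_subset (ρ : List Bool) : cappedSet j i ρ ⊆ acceptSet j i ρ := by
  rintro X ⟨l, -, -, hX⟩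
  exact acceptSet_mono (List.take_prefix _ _) hX

theorem acceptSet_subset_cappedSet {ρ : List Bool} (h : small j i ρ = true) :
    acceptSet j i ρ ⊆ cappedSet j i ρ :=
  fun X hX => ⟨ρ.length, le_rfl, by rwa [List.take_length], by rwa [List.take_length]⟩

/-- Accepted sets grow with the string, so the longest prefix of permitted measure absorbs the
others. This gives measurability and the measure bound at once. -/
theorem cappedSet_eq (ρ : List Bool) : cappedSet j i ρ = ∅ ∨
    ∃ l ≤ ρ.length, small j i (ρ.take l) = true ∧ cappedSet j i ρ = acceptSet j i (ρ.take l) := by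
  by_cases h : ∃ l ≤ ρ.length, small j i (ρ.take l) = true
  · right
    obtain ⟨l₀, hl₀, hs₀⟩ := h
    set l := Nat.findGreatest (fun l => small j i (ρ.take l) = true) ρ.length
    have hl : l ≤ ρ.length := Nat.findGreatest_le _
    have hs : small j i (ρ.take l) = true :=
      Nat.findGreatest_spec (P := fun l => small j i (ρ.take l) = true) hl₀ hs₀
    refine ⟨l, hl, hs, Set.Subset.antisymm ?_ fun X hX => ⟨l, hl, hs, hX⟩⟩
    rintro X ⟨l', hl', hs', hX⟩
    exact acceptSet_mono (List.take_prefix_take_left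
      (Nat.le_findGreatest (P := fun l => small j i (ρ.take l) = true) hl' hs')) hX
  · left
    push Not at h
    refine Set.eq_empty_of_forall_notMem fun X => ?_
    rintro ⟨l, hl, hs, -⟩
    exact h l hl hs

theorem measurableSet_cappedSet (ρ : List Bool) : MeasurableSet (cappedSet j i ρ) := by
  rcases cappedSet_eq (j := j) (i := i) ρ with h | ⟨l, -, -, h⟩
  · rw [h]; exact MeasurableSet.empty
  · rw [h]; exact measurableSet_clopen _ _

theorem measureReal_cappedSet_le (ρ : List Bool) :
    coinMeasure.real (cappedSet j i ρ) ≤ (1 / 2) ^ i := by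
  rcases cappedSet_eq (j := j) (i := i) ρ with h | ⟨l, -, hs, h⟩
  · rw [h]; simp
  · rw [h]; exact small_iff.1 hs

theorem hits_ble_iff {e n l : ℕ} {ρ : List Bool} (hn : n ≤ ρ.length) (hl : l ≤ ρ.length) :
    Nat.ble (hits j i (ρ.take l) * 2 ^ n * 2 ^ (e + i))
      (hits j i (ρ.take n) * 2 ^ l * 2 ^ (e + i) + 2 ^ l * 2 ^ n) = true ↔
    coinMeasure.real (acceptSet j i (ρ.take l)) ≤
      coinMeasure.real (acceptSet j i (ρ.take n)) + (1 / 2) ^ (e + i) := by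
  rw [measureReal_acceptSet, measureReal_acceptSet, List.length_take_of_le hn,
    List.length_take_of_le hl, Nat.ble_eq, ← Nat.cast_le (α := ℝ)]
  have h1 : (hits j i (ρ.take n) : ℝ) / 2 ^ n + (1 / 2) ^ (e + i) =
      (hits j i (ρ.take n) * 2 ^ (e + i) + 2 ^ n) / (2 ^ n * 2 ^ (e + i)) := by
    rw [one_div, inv_pow]
    field_simp
  rw [h1, div_le_div_iff₀ (by positivity) (by positivity)]
  push_cast
  constructor <;> intro h <;> nlinarith [h]

theorem lrGood_iff {e n : ℕ} {ρ : List Bool} : lrGood e n ρ = true ↔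
    ∀ j ≤ e, ∀ i ≤ e, ∀ l ≤ ρ.length, n ≤ l → small j i (ρ.take l) = true →
      coinMeasure.real (acceptSet j i (ρ.take l)) ≤
        coinMeasure.real (acceptSet j i (ρ.take n)) + (1 / 2) ^ (e + i) := by
  simp only [lrGood, List.all_eq_true, List.mem_range, Nat.lt_succ_iff]
  refine forall₂_congr fun j _ => forall₂_congr fun i _ => forall₂_congr fun l hl => ?_
  by_cases hn : n ≤ l
  · rw [← hits_ble_iff (hn.trans hl) hl]
    by_cases hs : small j i (ρ.take l) = true <;> simp [hn, hs]
  · have : Nat.ble n l = false := by simpa [← Bool.not_eq_true] using hn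
    simp [hn, this]

/-- If the decisive prefix length is at least n, then the prefix of length n is small as well and is
not truncated by the cap. Otherwise nothing is gained beyond n. -/
theorem cappedSet_sub_le_of_lrGood {e n : ℕ} {ρ : List Bool} (h : lrGood e n ρ = true)
    (hj : j ≤ e) (hi : i ≤ e) : coinMeasure.real (cappedSet j i ρ) -
      coinMeasure.real (cappedSet j i (ρ.take n)) ≤ (1 / 2) ^ (e + i) := by
  rcases cappedSet_eq (j := j) (i := i) ρ with h' | ⟨l, hl, hs, h'⟩
  · rw [h']
    have : 0 ≤ coinMeasure.real (cappedSet j i (ρ.take n)) := measureReal_nonneg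
    have : (0 : ℝ) ≤ (1 / 2) ^ (e + i) := by positivity
    simp only [measureReal_empty]
    linarith
  · rw [h']
    rcases le_total n l with hn | hn
    · have h1 := lrGood_iff.1 h j hj i hi l hl hn hs
      have h2 : coinMeasure.real (acceptSet j i (ρ.take n)) ≤
          coinMeasure.real (cappedSet j i (ρ.take n)) :=
        measureReal_mono (acceptSet_subset_cappedSet
          (small_of_prefix (List.take_prefix_take_left hn) hs))
      linarith
    · have h2 : coinMeasure.real (acceptSet j i (ρ.take l)) ≤
          coinMeasure.real (cappedSet j i (ρ.take n)) := by
        refine measureReal_mono ((acceptSet_subset_cappedSet hs).trans (cappedSet_mono ?_))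
        exact List.take_prefix_take_left hn
      have : (0 : ℝ) ≤ (1 / 2) ^ (e + i) := by positivity
      linarith

/-! ### The losses of the construction -/

section

variable {P : ℕ → ℕ → ℕ → List (ℕ × ℕ) → Bool}

variable (P) in
/-- The first `s + 1` bits of the `s`-th approximation. -/
noncomputable def approxBits (s : ℕ) : List Bool := fstBits (s + 1) (limTrunc P (s + 1))

theorem approxBits_eq (s : ℕ) : approxBits P s = restr (approx P s) (s + 1) :=
  fstBits_limTrunc _ _

theorem length_approxBits (s : ℕ) : (approxBits P s).length = s + 1 := by
  rw [approxBits_eq, length_restr]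

open Classical in
variable (P) in
/-- The least `x ≤ s` that enters the approximation at stage `s + 1`, or `s + 1`. -/
noncomputable def changePoint (s : ℕ) : ℕ :=
  if h : ∃ x ≤ s, x ∈ approx P (s + 1) ∧ x ∉ approx P s then Nat.find h else s + 1

theorem changePoint_spec (s : ℕ) : changePoint P s = s + 1 ∨
    changePoint P s ≤ s ∧ changePoint P s ∈ approx P (s + 1) ∧ changePoint P s ∉ approx P s := by
  classical
  unfold changePoint
  split_ifs with h
  · exact Or.inr (Nat.find_spec h)
  · exact Or.inl rfl

theorem mem_approx_succ_iff {s x : ℕ} (hx : x < changePoint P s) :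
    x ∈ approx P (s + 1) ↔ x ∈ approx P s := by
  classical
  refine ⟨fun h => ?_, fun h => approx_mono (Nat.le_succ s) h⟩
  by_contra hn
  unfold changePoint at hx
  split_ifs at hx with hex
  · obtain ⟨h1, -⟩ := Nat.find_spec hex
    exact Nat.find_min hex hx ⟨by omega, h, hn⟩
  · exact hex ⟨x, by omega, h, hn⟩

theorem changePoint_le (s : ℕ) : changePoint P s ≤ s + 1 := by
  rcases changePoint_spec (P := P) s with h | h <;> omega

theorem take_changePoint (s : ℕ) : (approxBits P (s + 1)).take (changePoint P s) =
    (approxBits P s).take (changePoint P s) := by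
  have := changePoint_le (P := P) s
  rw [approxBits_eq, approxBits_eq, take_restr_of_le _ (by omega), take_restr_of_le _ this]
  exact restr_congr fun x hx => mem_approx_succ_iff hx

/-- A bound for the losses charged to the `e`-th requirement. -/
noncomputable def lossBound (j i e : ℕ) : ℝ :=
  (if e < i + j then (1 / 2) ^ i else 0) + (1 / 2) ^ i * (1 / 2) ^ e

theorem sum_lossBound_le (j i : ℕ) (s : Finset ℕ) :
    ∑ e ∈ s, lossBound j i e ≤ (i + j + 2) * (1 / 2) ^ i := by
  simp only [lossBound, Finset.sum_add_distrib]
  have h1 : ∑ e ∈ s, (if e < i + j then (1 / 2 : ℝ) ^ i else 0) ≤ (i + j) * (1 / 2) ^ i := by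
    rw [← Finset.sum_filter, Finset.sum_const, nsmul_eq_mul]
    refine mul_le_mul_of_nonneg_right ?_ (by positivity)
    have : (s.filter fun e => e < i + j).card ≤ (Finset.range (i + j)).card :=
      Finset.card_le_card fun e he => by
        simp only [Finset.mem_filter, Finset.mem_range] at he ⊢
        exact he.2
    rw [Finset.card_range] at this
    exact_mod_cast this
  have h2 : ∑ e ∈ s, (1 / 2 : ℝ) ^ i * (1 / 2) ^ e ≤ 2 * (1 / 2) ^ i := by
    rw [← Finset.mul_sum, mul_comm]
    refine mul_le_mul_of_nonneg_right ?_ (by positivity)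
    refine (summable_geometric_two.sum_le_tsum s fun e _ => by positivity).trans ?_
    rw [tsum_geometric_two]
  linarith

/-- Each loss is charged to the requirement whose permanent instance causes the change. The finitely
many requirements with e < i + j are charged the full measure 2^{-i}; for the others both indices
are at most e, so `lrGood` applies. -/
theorem sum_loss_le
    (hgood : ∀ e n r, P e n r (limTrunc P r) = true → lrGood e n (fstBits r (limTrunc P r)) = true)
    (N : ℕ) : ∑ s ∈ Finset.range N, (coinMeasure.real (cappedSet j i (approxBits P s)) -
      coinMeasure.real (cappedSet j i ((approxBits P s).take (changePoint P s)))) ≤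
      (i + j + 2) * (1 / 2) ^ i := by
  classical
  set loss : ℕ → ℝ := fun s => coinMeasure.real (cappedSet j i (approxBits P s)) -
    coinMeasure.real (cappedSet j i ((approxBits P s).take (changePoint P s)))
  have hex : ∀ s, ∃ e n, changePoint P s ≤ s → n ≤ changePoint P s ∧ Permanent P e n (s + 1) := by
    intro s
    by_cases h : changePoint P s ≤ s
    · obtain ⟨-, h1, h2⟩ := (changePoint_spec (P := P) s).resolve_left (by omega)
      obtain ⟨e, n, hn, hp⟩ := exists_permanent_of_approx (s := s + 1) (by omega) h1 h2
      exact ⟨e, n, fun _ => ⟨hn, hp⟩⟩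
    · exact ⟨0, 0, fun h' => absurd h' h⟩
  choose e n hen using hex
  have hle : ∀ s, changePoint P s ≤ s → loss s ≤ lossBound j i (e s) := by
    intro s hs
    obtain ⟨hn, hp⟩ := hen s hs
    have h0 : 0 ≤ coinMeasure.real
      (cappedSet j i ((approxBits P s).take (changePoint P s))) := measureReal_nonneg
    have hpos : (0 : ℝ) ≤ (1 / 2) ^ i * (1 / 2) ^ e s := by positivity
    by_cases hij : e s < i + j
    · simp only [loss, lossBound, if_pos hij]
      linarith [measureReal_cappedSet_le (j := j) (i := i) (approxBits P s)]
    · have h1 := cappedSet_sub_le_of_lrGood (j := j) (i := i) (hgood _ _ _ hp.spec)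
        (by omega) (by omega)
      have h2 : coinMeasure.real (cappedSet j i ((approxBits P s).take (n s))) ≤
          coinMeasure.real (cappedSet j i ((approxBits P s).take (changePoint P s))) :=
        measureReal_mono (cappedSet_mono (List.take_prefix_take_left hn))
      change coinMeasure.real (cappedSet j i (approxBits P s)) -
        coinMeasure.real (cappedSet j i ((approxBits P s).take (n s))) ≤ _ at h1
      simp only [loss, lossBound, if_neg hij]
      rw [add_comm, pow_add] at h1
      linarith
  have hzero : ∀ s, ¬ changePoint P s ≤ s → loss s = 0 := by
    intro s hs
    have : changePoint P s = s + 1 := le_antisymm (changePoint_le s) (by omega)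
    simp only [loss, this]
    rw [List.take_of_length_le (length_approxBits s).le, sub_self]
  rw [← Finset.sum_filter_add_sum_filter_not _ fun s => changePoint P s ≤ s,
    Finset.sum_eq_zero (s := (Finset.range N).filter fun s => ¬ changePoint P s ≤ s)
      fun s hs => hzero s (Finset.mem_filter.1 hs).2, add_zero]
  refine (Finset.sum_le_sum fun s hs => hle s (Finset.mem_filter.1 hs).2).trans ?_
  -- No requirement is charged twice: its unique permanent instance determines the stage.
  rw [← Finset.sum_image (f := lossBound j i) (g := e)]
  · exact sum_lossBound_le j i _
  · intro s hs t ht hst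
    have h1 := (hen s (Finset.mem_filter.1 hs).2).2
    have h2 := (hen t (Finset.mem_filter.1 ht).2).2
    rw [← hst] at h2
    simpa using (h1.eq h2).2

/-- The measure-theoretic part of the eligibility condition is satisfiable in the limit. -/
theorem exists_forall_lrGood
    (hgood : ∀ e n r, P e n r (limTrunc P r) = true → lrGood e n (fstBits r (limTrunc P r)) = true)
    (e : ℕ) : ∃ n₀, ∀ n, n₀ ≤ n → ∀ r, lrGood e n (fstBits r (limTrunc P r)) = true := by
  have hex : ∀ j i : ℕ, ∃ n, ∀ s, coinMeasure.real (cappedSet j i (approxBits P s)) -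
      coinMeasure.real (cappedSet j i ((approxBits P s).take n)) ≤ (1 / 2) ^ (e + i) :=
    fun j i => exists_forall_sub_le_of_losses (fun _ _ => cappedSet_mono) take_changePoint
      measureReal_cappedSet_le (sum_loss_le hgood) length_approxBits (by positivity)
  choose f hf using hex
  -- The 1 excludes r = 0 in the nontrivial case, so that r is of the form s + 1.
  refine ⟨max 1 ((Finset.range (e + 1) ×ˢ Finset.range (e + 1)).sup fun p => f p.1 p.2),
    fun n hn r => ?_⟩
  rw [lrGood_iff]
  intro j hj i hi l hl hnl hs
  have hfn : f j i ≤ n := by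
    refine le_trans ?_ ((le_max_right _ _).trans hn)
    exact Finset.le_sup (f := fun p : ℕ × ℕ => f p.1 p.2) (b := (j, i)) (by simp; omega)
  obtain ⟨s, rfl⟩ : ∃ s, r = s + 1 := ⟨r - 1, by
    have : l ≤ r := by simpa [fstBits] using hl
    have := (le_max_left _ _).trans hn
    omega⟩
  change coinMeasure.real (acceptSet j i ((approxBits P s).take l)) ≤
    coinMeasure.real (acceptSet j i ((approxBits P s).take n)) + _
  have h1 : coinMeasure.real (acceptSet j i ((approxBits P s).take l)) ≤
      coinMeasure.real (cappedSet j i (approxBits P s)) :=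
    measureReal_mono fun X hX => ⟨l, hl, hs, hX⟩
  have h2 : coinMeasure.real (cappedSet j i ((approxBits P s).take (f j i))) ≤
      coinMeasure.real (acceptSet j i ((approxBits P s).take n)) :=
    measureReal_mono ((cappedSet_mono (List.take_prefix_take_left hfn)).trans (cappedSet_subset _))
  linarith [hf j i s]

/-! ### `D` is LR-complete -/

variable (P) in
/-- A component of a test relative to `D` that covers a component of the `j`-th test relative
to `∅'`. -/
def coverTest (j c : ℕ) : Set (ℕ × List Bool) :=
  {p | ∃ s l, l ≤ s + 1 ∧ small j (2 * p.1 + c) ((approxBits P s).take l) = true ∧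
    p.2.length = l ∧ accepts j (2 * p.1 + c) ((approxBits P s).take l) p.2 = true}

theorem testComponent_coverTest (j c m : ℕ) : testComponent (coverTest P j c) m =
    ⋃ s, cappedSet j (2 * m + c) (approxBits P s) := by
  ext X
  simp only [Set.mem_iUnion]
  constructor
  · rintro ⟨τ, ⟨s, l, hl, hs, rfl, hacc⟩, hX⟩
    refine ⟨s, τ.length, by rwa [length_approxBits], hs, ?_⟩
    change accepts _ _ _ _ = true
    rw [List.length_take_of_le (by rwa [length_approxBits]), mem_cylinder_iff.1 hX]
    exact hacc
  · rintro ⟨s, l, hl, hs, hX⟩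
    have hlen : ((approxBits P s).take l).length = l := List.length_take_of_le hl
    refine ⟨pre X l, ⟨s, l, by rwa [length_approxBits] at hl, hs, length_pre _ _, ?_⟩,
      mem_cylinder_iff.2 (by simp)⟩
    change accepts _ _ _ _ = true at hX
    rwa [hlen] at hX

theorem ceIn_coverTest (hP : Primrec (state P)) (j c : ℕ) :
    CEIn (outSet P) (coverTest P j c) := by
  let R : ℕ × List Bool → ℕ → List Bool → Bool := fun p l ρ =>
    small j (2 * p.1 + c) (ρ.take l) && p.2.length == l &&
      accepts j (2 * p.1 + c) (ρ.take l) p.2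
  have hsc : Primrec fun q : ((ℕ × List Bool) × List Bool) × ℕ =>
      settledCheck P (q.2 + 1) q.1.2 := primrec_settledCheck hP (by fun_prop) (by fun_prop)
  refine ceIn_of_search (outSet P) (Q := fun p σ => (List.range σ.length).any fun s =>
    settledCheck P (s + 1) σ && (List.range (s + 2)).any fun l =>
      R p l (fstBits (s + 1) (trunc (s + 1) (state P σ.length).1))) ?_ ?_
  · unfold R
    fun_prop
  · intro p
    simp only [List.any_eq_true, List.mem_range, Bool.and_eq_true, length_restr]
    constructor
    · rintro ⟨s, l, hl, hs, hlen, hacc⟩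
      obtain ⟨k, hk⟩ := exists_check (P := P) (s + 1)
      have hc := hk (max k (s + 1)) (le_max_left _ _)
      refine ⟨max k (s + 1), s, by omega, hc, l, by omega, ?_⟩
      rw [(settled_of_check hc).trunc_eq]
      simp only [R, Bool.and_eq_true, beq_iff_eq]
      exact ⟨⟨hs, hlen⟩, hacc⟩
    · rintro ⟨k, s, -, hc, l, hl, hR⟩
      rw [(settled_of_check hc).trunc_eq] at hR
      simp only [R, Bool.and_eq_true, beq_iff_eq] at hR
      exact ⟨s, l, by omega, hR.1.1, hR.1.2, hR.2⟩

theorem exists_test_index {Z : Set ℕ} {S : Set (ℕ × List Bool)} (hS : CEIn Z S) :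
    ∃ j, ∀ a, a ∈ S ↔ ∃ l k, (Nat.Partrec.Code.evaln k (Denumerable.ofNat Nat.Partrec.Code j)
      (Encodable.encode (restr Z l, Encodable.encode a))).isSome := by
  obtain ⟨e, he⟩ := exists_computesFrom hS
  refine ⟨Encodable.encode e, fun a => ?_⟩
  rw [Denumerable.ofNat_encode]
  simp only [Option.isSome_iff_exists]
  constructor
  · intro ha
    obtain ⟨l, k, h⟩ := (he (Encodable.encode a) 0).1 (by simpa [ha, Part.assert] using ⟨(), rfl⟩)
    exact ⟨l, k, 0, h⟩
  · rintro ⟨l, k, y, h⟩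
    have := (he (Encodable.encode a) y).2 ⟨l, k, h⟩
    simp only [Encodable.encodek, Part.coe_some, Part.bind_some, Part.mem_map_iff,
      Part.mem_assert_iff] at this
    obtain ⟨_, ⟨h, -⟩, -⟩ := this
    exact h

theorem lrComplete_outSet (hP : Primrec (state P))
    (hgood : ∀ e n r, P e n r (limTrunc P r) = true → lrGood e n (fstBits r (limTrunc P r)) = true) :
    LRComplete (outSet P) := by
  intro X hX S hS hmeas
  by_contra! hall
  obtain ⟨j, hj⟩ := exists_test_index hS
  -- Component m of the cover uses component i = 2m + j + 4. Its measure is at most (i + j + 3)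
  -- 2^{-i}, which is at most 2^{-m} because 2(m + j) + 7 ≤ 2^{m+j+4}.
  set c := j + 4 with hc
  obtain ⟨m, hm⟩ := hX (coverTest P j c) (ceIn_coverTest hP j c) fun m => by
    rw [testComponent_coverTest]
    refine (measure_iUnion_le_of_losses (fun _ _ => cappedSet_mono) measurableSet_cappedSet
      take_changePoint measureReal_cappedSet_le (sum_loss_le hgood)).trans ?_
    have h1 : ((1 : ℝ) / 2) ^ (2 * m + c) + (((2 * m + c : ℕ) : ℝ) + j + 2) *
        (1 / 2) ^ (2 * m + c) ≤ (1 / 2) ^ m := by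
      have h2 : ∀ k : ℕ, 2 * k + 7 ≤ 2 ^ (k + 4) := by
        intro k
        induction k with
        | zero => norm_num
        | succ k ih => rw [show k + 1 + 4 = k + 4 + 1 by ring, pow_succ]; omega
      have h3 : ((2 * m + c : ℕ) : ℝ) + j + 3 ≤ 2 ^ (m + c) := by
        have := h2 (m + j)
        rw [hc, show m + (j + 4) = m + j + 4 by ring]
        have h4 : ((2 * (m + j) + 7 : ℕ) : ℝ) ≤ ((2 ^ (m + j + 4) : ℕ) : ℝ) := by exact_mod_cast this
        push_cast at h4 ⊢
        linarith
      have h5 : ((1 : ℝ) / 2) ^ m = 2 ^ (m + c) * (1 / 2) ^ (2 * m + c) := by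
        rw [show 2 * m + c = (m + c) + m by ring, pow_add _ (m + c) m, ← mul_assoc, ← mul_pow]
        norm_num
      rw [h5]
      have h6 : (0 : ℝ) ≤ (1 / 2) ^ (2 * m + c) := by positivity
      nlinarith [mul_le_mul_of_nonneg_right h3 h6]
    refine (ENNReal.ofReal_le_ofReal h1).trans (le_of_eq ?_)
    rw [ENNReal.ofReal_pow (by positivity), one_div, ENNReal.ofReal_inv_of_pos (by norm_num)]
    simp
  refine hm ?_
  rw [testComponent_coverTest]
  set i := 2 * m + c
  obtain ⟨σ, hσ, hXσ⟩ := hall i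
  obtain ⟨l, k, hlk⟩ := (hj (i, σ)).1 hσ
  set r := max (max l k) σ.length with hr
  -- the set accepted with the oracle information `∅' ↾ r` is small
  have hsmall : small j i (restr halting r) = true := by
    rw [small_iff]
    have hsub : acceptSet j i (restr halting r) ⊆ testComponent S i := by
      intro Y hY
      obtain ⟨l', hl', p, hp, hacc⟩ := accepts_iff.1 hY
      rw [length_restr] at hl'
      rw [take_restr_of_le _ hl'] at hacc
      refine ⟨_, (hj _).2 ⟨l', _, hacc⟩, ?_⟩
      rw [length_restr, length_pre] at hp
      rw [length_restr, take_pre _ hp, mem_cylinder_iff, length_pre]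
    have h1 := (measure_mono hsub).trans (hmeas i)
    have h2 := ENNReal.toReal_mono (by simp) h1
    simpa [Measure.real] using h2
  have haccept : X ∈ acceptSet j i (restr halting r) := by
    refine accepts_iff.2 ⟨l, by simp [hr], σ.length, by simp [hr], ?_⟩
    obtain ⟨x, hx⟩ := Option.isSome_iff_exists.1 hlk
    rw [take_restr_of_le _ (by simp [hr]), length_restr, take_pre _ (by simp [hr]),
      mem_cylinder_iff.1 hXσ]
    exact Option.isSome_iff_exists.2 ⟨x, Nat.Partrec.Code.evaln_mono (by simp [hr]) hx⟩
  have hev : ∀ᶠ s in atTop, ∀ x ∈ Set.Iio r, x ∈ approx P s ↔ x ∈ halting :=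
    (eventually_all_finite (Set.finite_Iio r)).2 fun x _ => eventually_mem_approx_iff x
  -- At this stage the approximation is correct below r, so the true computation accepting X is also
  -- seen by the cover.
  obtain ⟨s, hs, hrs⟩ := (hev.and (eventually_ge_atTop r)).exists
  have htake : (approxBits P s).take r = restr halting r := by
    rw [approxBits_eq, take_restr_of_le _ (by omega)]
    exact restr_congr hs
  simp only [Set.mem_iUnion]
  exact ⟨s, r, by rw [length_approxBits]; omega, by rwa [htake], by rwa [htake]⟩

end

/-! ### Turing functionals evaluated along strings -/

theorem findSome?_range_eq_some {α : Type*} {f : ℕ → Option α} {r : ℕ} {v : α} :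
    (List.range r).findSome? f = some v ↔ ∃ m < r, f m = some v ∧ ∀ k < m, f k = none := by
  induction r with
  | zero => simp
  | succ r ih =>
    rw [List.range_succ, List.findSome?_append, Option.or_eq_some_iff, ih,
      List.findSome?_eq_none_iff]
    simp only [List.mem_range, List.findSome?_singleton]
    constructor
    · rintro (⟨m, hm, h⟩ | ⟨h, h'⟩)
      · exact ⟨m, by omega, h⟩
      · exact ⟨r, by omega, h', h⟩
    · rintro ⟨m, hm, h, h'⟩
      rcases Nat.lt_succ_iff_lt_or_eq.1 hm with hm | rfl
      · exact Or.inl ⟨m, hm, h, h'⟩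
      · exact Or.inr ⟨h', h⟩

theorem mem_rfindOpt_iff {α : Type*} {f : ℕ → Option α} {v : α} :
    v ∈ Nat.rfindOpt f ↔ ∃ m, f m = some v ∧ ∀ k < m, f k = none := by
  refine (Part.mem_bind_iff).trans (exists_congr fun m => ?_)
  rw [Part.mem_ofOption, Option.mem_def, and_comm]
  refine and_congr_right fun h => Nat.mem_rfind.trans ?_
  refine ⟨fun hm k hk => ?_, fun hm => ⟨by simp [h], fun {k} hk => by simp [hm k hk]⟩⟩
  simpa using (Part.mem_some_iff.1 (hm.2 hk)).symm

theorem mem_functional_iff {e : Nat.Partrec.Code} {Z : Set ℕ} {y v : ℕ} :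
    v ∈ functional e Z y ↔ ∃ r, functionalStage e Z y r = some v := by
  simp only [functional, functionalStage, mem_rfindOpt_iff, findSome?_range_eq_some]
  exact ⟨fun ⟨m, h⟩ => ⟨m + 1, m, by omega, h⟩, fun ⟨r, m, _, h⟩ => ⟨m, h⟩⟩

theorem functionalStage_mono {e : Nat.Partrec.Code} {Z : Set ℕ} {y v r s : ℕ} (hrs : r ≤ s)
    (h : functionalStage e Z y r = some v) : functionalStage e Z y s = some v := by
  simp only [functionalStage, findSome?_range_eq_some] at h ⊢
  obtain ⟨m, hm, h⟩ := h
  exact ⟨m, hm.trans_le hrs, h⟩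

/-- `functionalStage`, with a string as the oracle. -/
def stringStage (e : Nat.Partrec.Code) (σ : List Bool) (y s : ℕ) : Option ℕ :=
  (List.range s).findSome? fun m =>
    Nat.Partrec.Code.evaln m.unpair.1 e (Encodable.encode (σ.take m.unpair.2, y))

@[fun_prop]
theorem primrec_stringStage {α : Type*} [Primcodable α] {e : α → Nat.Partrec.Code}
    {σ : α → List Bool} {y s : α → ℕ} (he : Primrec e) (hσ : Primrec σ) (hy : Primrec y)
    (hs : Primrec s) : Primrec fun a => stringStage (e a) (σ a) (y a) (s a) := by
  unfold stringStage; fun_prop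

theorem stringStage_restr {e : Nat.Partrec.Code} {Z : Set ℕ} {y s l : ℕ} (h : s ≤ l) :
    stringStage e (restr Z l) y s = functionalStage e Z y s := by
  refine Option.ext fun v => ?_
  simp only [stringStage, functionalStage, findSome?_range_eq_some]
  have : ∀ m < s, (restr Z l).take m.unpair.2 = restr Z m.unpair.2 := fun m hm =>
    take_restr_of_le _ (by have := Nat.unpair_right_le m; omega)
  refine exists_congr fun m => and_congr_right fun hm => ?_
  rw [this m hm]
  refine and_congr_right fun _ => forall₂_congr fun k hk => ?_
  rw [this k (by omega)]
  rfl

/-! ### Estimates of the cost -/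

theorem le_half_pow_iff {q : ℚ≥0} {e : ℕ} : q ≤ (1 / 2) ^ e ↔ q.num * 2 ^ e ≤ q.den := by
  conv_lhs => rw [← NNRat.num_div_den q]
  have : (0 : ℚ≥0) < q.den := by exact_mod_cast q.den_pos
  rw [one_div, inv_pow, div_le_iff₀ this, ← div_eq_inv_mul, le_div_iff₀ (by positivity)]
  exact_mod_cast Iff.rfl

theorem toENNReal_le {p q : ℚ≥0} : toENNReal p ≤ toENNReal q ↔ p ≤ q := by
  simp [toENNReal]

theorem toENNReal_half_pow (e : ℕ) : toENNReal ((1 / 2) ^ e) = 2⁻¹ ^ e := by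
  simp [toENNReal, ENNReal.coe_inv, ENNReal.inv_pow]

theorem NondecreasingInStage.mono {c : ℕ → ℕ → ℚ≥0} (h : NondecreasingInStage c) (x : ℕ) :
    Monotone (c x) := monotone_nat_of_le_succ (h.2 x)

/-- By monotonicity in the stage, every single value is bounded by the limit inferior. -/
theorem exists_forall_cost_le {c : ℕ → ℕ → ℚ≥0} (h : NondecreasingInStage c)
    (hc : LimitCondition c) (e : ℕ) : ∃ n, ∀ x, n ≤ x → ∀ t, c x t ≤ (1 / 2) ^ e := by
  have h1 : ∀ᶠ x in atTop, liminf (fun s => toENNReal (c x s)) atTop < toENNReal ((1 / 2) ^ e) :=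
    hc.eventually_lt_const (by rw [toENNReal_half_pow]; exact ENNReal.pow_pos (by simp) _)
  obtain ⟨n, hn⟩ := eventually_atTop.1 h1
  refine ⟨n, fun x hx t => toENNReal_le.1 (le_trans ?_ (hn x hx).le)⟩
  refine le_liminf_of_le (by isBoundedDefault) ?_
  filter_upwards [eventually_ge_atTop t] with s hs
  exact toENNReal_le.2 (h.mono x hs)

/-- With the oracle information `σ`, all values `c(x,t)` with `x ≥ n` that are seen to converge are
at most `2^{-e}`. -/
def costGood (p : Nat.Partrec.Code) (e n : ℕ) (σ : List Bool) : Bool :=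
  (List.range σ.length).all fun x => (List.range σ.length).all fun t =>
    !(Nat.ble n x) || (stringStage p σ (Nat.pair x t) σ.length).elim true fun v =>
      Nat.ble (v.unpair.1 * 2 ^ e) v.unpair.2

@[fun_prop]
theorem primrec_costGood {α : Type*} [Primcodable α] (p : Nat.Partrec.Code) {e n : α → ℕ}
    {σ : α → List Bool} (he : Primrec e) (hn : Primrec n) (hσ : Primrec σ) :
    Primrec fun a => costGood p (e a) (n a) (σ a) := by
  unfold costGood; fun_prop

theorem costGood_iff {p : Nat.Partrec.Code} {Z : Set ℕ} {c : ℕ → ℕ → ℚ≥0}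
    (hp : ∀ x t, functional p Z (Nat.pair x t) = Part.some (Nat.pair (c x t).num (c x t).den))
    {e n r : ℕ} : costGood p e n (restr Z r) = true ↔
      ∀ x < r, n ≤ x → ∀ t < r, (functionalStage p Z (Nat.pair x t) r).isSome →
        c x t ≤ (1 / 2) ^ e := by
  simp only [costGood, List.all_eq_true, List.mem_range, length_restr, stringStage_restr le_rfl,
    le_half_pow_iff]
  refine forall₂_congr fun x _ => ?_
  by_cases hn : n ≤ x
  · simp only [hn, true_imp_iff]
    refine forall₂_congr fun t _ => ?_
    rcases h : functionalStage p Z (Nat.pair x t) r with _ | v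
    · simp
    · have : v ∈ functional p Z (Nat.pair x t) := mem_functional_iff.2 ⟨r, h⟩
      rw [hp, Part.mem_some_iff] at this
      simp [this, hn]
  · have : Nat.ble n x = false := by simpa [← Bool.not_eq_true] using hn
    simp [hn, this]

/-! ### The approximation computable from `D` -/

section

variable {P : ℕ → ℕ → ℕ → List (ℕ × ℕ) → Bool}

theorem sum_approx {r : ℕ} : ∑ x ∈ approx P r, 2 ^ x =
    (limTrunc P (r + 1)).foldr (fun q a => 2 ^ q.1 + a) 0 := by
  obtain ⟨v, hv⟩ := exists_settled (P := P) (r + 1)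
  rw [approx, List.sum_toFinset]
  · generalize limTrunc P (r + 1) = L
    induction L with
    | nil => rfl
    | cons q L ih => simpa using ih
  · rw [← hv.trunc_eq]
    exact ((List.dropWhile_sublist _).map _).nodup (nodup_events v)

/-- Any function that is computed from `D` by a search for the least stage can be used to speed
up the approximation `approx P`. -/
theorem computableIn_sum_approx (hP : Primrec (state P)) {R : ℕ → ℕ → List Bool → Bool}
    (hR : Primrec fun q : ℕ × ℕ × List Bool => R q.1 q.2.1 q.2.2) {p : ℕ → ℕ}
    (hp : ∀ s, R s (p s) (restr (outSet P) (p s)) = true)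
    (hmin : ∀ s, ∀ k < p s, R s k (restr (outSet P) k) = false) :
    ComputableIn {charFn (outSet P)} fun s => ∑ x ∈ approx P (p s), 2 ^ x := by
  -- The search first identifies the least stage from prefixes of σ, then waits until σ shows that
  -- the corresponding truncated list is final.
  let Q : ℕ → List Bool → Option ℕ := fun s σ =>
    ((List.range σ.length).findSome? fun k => bif R s k (σ.take k) then some k else none).bind
      fun k => bif settledCheck P (k + 1) σ then
        some ((trunc (k + 1) (state P σ.length).1).foldr (fun q a => 2 ^ q.1 + a) 0) else none
  have hQ : Primrec fun q : ℕ × List Bool => (Q q.1 q.2) := by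
    have h1 : Primrec fun q : (ℕ × List Bool) × ℕ => R q.1.1 q.2 (q.1.2.take q.2) :=
      hR.comp (g := fun q : (ℕ × List Bool) × ℕ => (q.1.1, q.2, q.1.2.take q.2)) (by fun_prop)
    have h2 : Primrec fun q : (ℕ × List Bool) × ℕ => settledCheck P (q.2 + 1) q.1.2 :=
      primrec_settledCheck hP (by fun_prop) (by fun_prop)
    unfold Q
    fun_prop
  have hfind : ∀ s l k, ((List.range l).findSome? fun k => bif R s k ((restr (outSet P) l).take k)
      then some k else none) = some k ↔ k = p s ∧ k < l := by
    intro s l k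
    simp only [findSome?_range_eq_some]
    constructor
    · rintro ⟨m, hm, h, h'⟩
      rw [take_restr_of_le _ hm.le] at h
      rcases hR' : R s m (restr (outSet P) m)
      · simp [hR'] at h
      obtain rfl : m = k := by simpa [hR'] using h
      refine ⟨?_, hm⟩
      rcases lt_trichotomy m (p s) with h1 | h1 | h1
      · simp [hmin s m h1] at hR'
      · exact h1
      · have := h' _ h1
        rw [take_restr_of_le _ (h1.trans hm).le] at this
        simp [hp s] at this
    · rintro ⟨rfl, hl⟩
      refine ⟨p s, hl, by simp [take_restr_of_le _ hl.le, hp], fun k hk => ?_⟩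
      simp [take_restr_of_le _ (hk.trans hl).le, hmin s k hk]
  refine computableIn_of_search _ hQ (fun s => ?_) fun s l b hb => ?_
  · obtain ⟨l, hl⟩ := exists_check (P := P) (p s + 1)
    refine ⟨max l (p s + 1), ?_⟩
    simp only [Q, length_restr, (hfind s (max l (p s + 1)) (p s)).2 ⟨rfl, by omega⟩,
      Option.bind_some, hl _ (le_max_left _ _), cond_true, Option.isSome_some]
  · simp only [Q, length_restr, Option.bind_eq_some_iff] at hb
    obtain ⟨k, hk, hb⟩ := hb
    obtain ⟨rfl, -⟩ := (hfind s l k).1 hk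
    rcases hc : settledCheck P (p s + 1) (restr (outSet P) l)
    · simp [hc] at hb
    · rw [sum_approx, ← (settled_of_check hc).trunc_eq]
      simpa [hc] using hb.symm

/-- If every change of an increasing approximation is paid for by an instance of a requirement,
then the total cost is finite. -/
theorem totalCost_lt_top {c : ℕ → ℕ → ℚ≥0} {As : ℕ → Finset ℕ} {p : ℕ → ℕ} (hp : Monotone p)
    (hAs : ∀ s, As s ⊆ As (s + 1))
    (h : ∀ s x, x < s → x ∈ As s → x ∉ As (s - 1) →
      ∃ e n q, Permanent P e n q ∧ p (s - 1) < q ∧ q ≤ p s ∧ c x s ≤ (1 / 2) ^ e) :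
    totalCost c As < ⊤ := by
  classical
  let f : ℕ → ENNReal := fun s => ∑' x, if x < s ∧ IsLeast {y | ¬ (y ∈ As (s - 1) ↔ y ∈ As s)} x
    then toENNReal (c x s) else 0
  have key : ∀ s, f s ≠ 0 → ∃ e, f s ≤ 2⁻¹ ^ e ∧
      ∃ n q, Permanent P e n q ∧ p (s - 1) < q ∧ q ≤ p s := by
    intro s hs
    obtain ⟨x, hx⟩ : ∃ x, x < s ∧ IsLeast {y | ¬ (y ∈ As (s - 1) ↔ y ∈ As s)} x := by
      by_contra hne
      exact hs (ENNReal.tsum_eq_zero.2 fun x => if_neg fun h => hne ⟨x, h⟩)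
    have hf : f s = toENNReal (c x s) := by
      refine (tsum_eq_single x fun y hy => if_neg fun h => hy (h.2.unique hx.2)).trans (if_pos hx)
    have hsub : As (s - 1) ⊆ As s := by
      have := hAs (s - 1)
      rwa [Nat.sub_add_cancel (by omega)] at this
    have hx2 : ¬ (x ∈ As (s - 1) ↔ x ∈ As s) := hx.2.1
    have hx1 : x ∉ As (s - 1) := fun h => hx2 ⟨fun _ => hsub h, fun _ => h⟩
    obtain ⟨e, n, q, hP, h1, h2, h3⟩ := h s x hx.1 (by tauto) hx1
    refine ⟨e, ?_, n, q, hP, h1, h2⟩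
    rw [hf, ← toENNReal_half_pow]
    exact toENNReal_le.2 h3
  choose! E hE using key
  -- Equal requirements have the same permanent instance and hence the same q, but the intervals
  -- (p(s-1), p(s)] are disjoint.
  have hinj : Function.Injective fun s : Function.support f => E s := by
    rintro ⟨s, hs⟩ ⟨t, ht⟩ hst
    obtain ⟨-, n, q, h1, h2, h3⟩ := hE s hs
    obtain ⟨-, n', q', h1', h2', h3'⟩ := hE t ht
    simp only at hst
    rw [hst] at h1
    obtain ⟨-, rfl⟩ := h1.eq h1'
    by_contra hne
    have hne' : s ≠ t := fun h => hne (Subtype.ext h)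
    rcases lt_or_gt_of_ne hne' with hlt | hlt
    · have := hp (show s ≤ t - 1 by omega); omega
    · have := hp (show t ≤ s - 1 by omega); omega
  calc totalCost c As = ∑' s : Function.support f, f s :=
        (tsum_subtype_eq_of_support_subset subset_rfl).symm
    _ ≤ ∑' s : Function.support f, (2⁻¹ : ENNReal) ^ E s :=
        ENNReal.tsum_le_tsum fun s => (hE s s.2).1
    _ ≤ ∑' e : ℕ, (2⁻¹ : ENNReal) ^ e :=
        ENNReal.tsum_comp_le_tsum_of_injective hinj fun e => (2⁻¹ : ENNReal) ^ e
    _ < ⊤ := by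
      rw [ENNReal.tsum_geometric]
      simp

end

/-! ### Combining the cost and measure conditions -/

/-- The positive part of the argument, for a set `D` that is also LR-complete. -/
theorem exists_ce_incomplete_obeys {c : Set ℕ → ℕ → ℕ → ℚ≥0} (hc : IsTotalCostFunctional c)
    (hmono : ∀ Z, NondecreasingInStage (c Z)) (hlim : ∀ Z, LimitCondition (c Z)) :
    ∃ D : Set ℕ, CE D ∧ ¬ TuringLE halting D ∧ Obeys D (c D) halting ∧ LRComplete D := by
  obtain ⟨p, hp⟩ := hc
  let good : ℕ → ℕ → ℕ → List (ℕ × ℕ) → Bool := fun e n r L =>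
    costGood p e n (outBits r L) && lrGood e n (fstBits r L)
  have hprim : Primrec fun q : ℕ × ℕ × ℕ × List (ℕ × ℕ) => good q.1 q.2.1 q.2.2.1 q.2.2.2 := by
    unfold good; fun_prop
  set P := eligible good with hPdef
  have hP : Primrec (state P) := primrec_state (primrec_eligible hprim)
  set D := outSet P with hD
  have hgood : ∀ e n r, P e n r (limTrunc P r) = true →
      costGood p e n (restr D r) = true ∧ lrGood e n (fstBits r (limTrunc P r)) = true := by
    intro e n r h
    conv at h => lhs; rw [hPdef]
    simpa [eligible, good, ← hPdef, outBits_limTrunc] using (Bool.and_eq_true_iff.1 h).2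
  have hlr := fun e n r h => (hgood e n r h).2
  refine ⟨D, ce_outSet hP, not_turingLE_outSet hprim fun e => ?_, ?_, lrComplete_outSet hP hlr⟩
  · obtain ⟨n₁, h₁⟩ := exists_forall_cost_le (hmono D) (hlim D) e
    obtain ⟨n₂, h₂⟩ := exists_forall_lrGood hlr e
    refine ⟨max n₁ n₂, fun r => Bool.and_eq_true_iff.2 ⟨?_, h₂ _ (le_max_right _ _) r⟩⟩
    rw [outBits_limTrunc, costGood_iff (hp _)]
    exact fun x _ hx t _ _ => h₁ x (le_trans (le_max_left _ _) hx) t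
  -- the stage by which all relevant costs are seen to converge
  let R : ℕ → ℕ → List Bool → Bool := fun s k σ => Nat.blt (s + 1) k &&
    (List.range (s + 1)).all fun t => (List.range (t + 1)).all fun x =>
      (stringStage p σ (Nat.pair x (t + 1)) k).isSome
  have hR : ∀ s k, R s k (restr D k) = true ↔ s + 1 < k ∧ ∀ t ≤ s, ∀ x ≤ t,
      (functionalStage p D (Nat.pair x (t + 1)) k).isSome := by
    intro s k
    simp [R, stringStage_restr le_rfl]
  have hex : ∀ s, ∃ k, R s k (restr D k) = true := by
    intro s
    have h1 : ∀ y ∈ (Finset.range (s + 1) ×ˢ Finset.range (s + 1)), ∀ᶠ k in atTop,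
        (functionalStage p D (Nat.pair y.1 (y.2 + 1)) k).isSome := by
      intro y _
      obtain ⟨r, hr⟩ := mem_functional_iff.1 ((hp D y.1 (y.2 + 1)).symm ▸ Part.mem_some _)
      filter_upwards [eventually_ge_atTop r] with k hk
      rw [functionalStage_mono hk hr]; rfl
    obtain ⟨k, hk, hk'⟩ := (((Finset.eventually_all _).2 h1).and
      (eventually_gt_atTop (s + 1))).exists
    refine ⟨k, (hR s k).2 ⟨hk', fun t ht x hx => hk (x, t) ?_⟩⟩
    simp only [Finset.mem_product, Finset.mem_range]; omega
  classical
  let q : ℕ → ℕ := fun s => Nat.find (hex s)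
  have hq : ∀ s, R s (q s) (restr D (q s)) = true := fun s => Nat.find_spec (hex s)
  have hqmin : ∀ s, ∀ k < q s, R s k (restr D k) = false := fun s k hk => by
    simpa using Nat.find_min (hex s) hk
  have hqmono : Monotone q := monotone_nat_of_le_succ fun s => by
    refine Nat.find_min' (hex s) ((hR _ _).2 ?_)
    obtain ⟨h1, h2⟩ := (hR _ _).1 (hq (s + 1))
    exact ⟨by omega, fun t ht => h2 t (by omega)⟩
  have hqgt : ∀ s, s + 1 < q s := fun s => ((hR _ _).1 (hq s)).1
  refine ⟨fun s => approx P (q s), ⟨computableIn_sum_approx hP (R := R) ?_ hq hqmin, fun x => ?_⟩,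
    totalCost_lt_top (P := P) hqmono (fun s => approx_mono (hqmono (Nat.le_succ s))) ?_⟩
  · unfold R; fun_prop
  · have : Tendsto q atTop atTop := 
      tendsto_atTop_mono (fun s => (hqgt s).le.trans' (Nat.le_succ s)) tendsto_id
    exact this.eventually (eventually_mem_approx_iff x)
  · intro s x hxs hx hx'
    have hex' : ∃ k, x ∈ approx P k := ⟨_, hx⟩
    -- This is the index at which x enters the original approximation, between the consecutive
    -- chosen indices for s - 1 and s; the instance to be charged has r = k.
    set k := Nat.find hex' with hk
    have hxk : x ∈ approx P k := Nat.find_spec hex'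
    have hks : k ≤ q s := Nat.find_min' hex' hx
    have hsk : q (s - 1) < k := by
      by_contra! h
      exact hx' (approx_mono h hxk)
    have hsk' := hqgt (s - 1)
    obtain ⟨e, n, hnx, hperm⟩ := exists_permanent_of_approx (P := P) (s := k) (x := x) (by omega) hxk
      (Nat.find_min hex' (by omega))
    refine ⟨e, n, k, hperm, hsk, hks, ?_⟩
    refine (costGood_iff (hp D)).1 (hgood e n k hperm.spec).1 x (by omega) hnx s (by omega) ?_
    -- The cost at stage s has already converged by q(s-1) < k, so the instance saw it and
    -- guarantees the bound. This is why the search at s includes stage s + 1.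
    have h1 := ((hR _ _).1 (hq (s - 1))).2 (s - 1) le_rfl x (by omega)
    rw [Nat.sub_add_cancel (by omega)] at h1
    obtain ⟨v, hv⟩ := Option.isSome_iff_exists.1 h1
    rw [functionalStage_mono hsk.le hv]; rfl

/-! ### Monotonicity of the cost functional for `K`-triviality -/

theorem pfMachineStage_suffix_succ (Z : Set ℕ) (e : Nat.Partrec.Code) (s : ℕ) :
    pfMachineStage Z e s <:+ pfMachineStage Z e (s + 1) := by
  rw [pfMachineStage]
  split
  · exact List.suffix_rfl
  · split
    · exact List.suffix_rfl
    · split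
      · exact List.suffix_cons _ _
      · exact List.suffix_rfl

theorem eq_of_prefix_pfMachineStage {Z : Set ℕ} {e : Nat.Partrec.Code} {s : ℕ}
    {p q : List Bool × ℕ} (hp : p ∈ pfMachineStage Z e s) (hq : q ∈ pfMachineStage Z e s)
    (h : p.1 <+: q.1) : p = q := by
  induction s with
  | zero => simp [pfMachineStage] at hp
  | succ s ih =>
    rw [pfMachineStage] at hp hq
    split at hp
    · simp_all
    · split at hp
      · simp_all
      · split at hp
        · rename_i σ hσ _ y hy hfree
          simp only [hσ, hy, if_pos hfree, List.mem_cons] at hq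
          rw [List.mem_cons] at hp
          rcases hp with rfl | hp <;> rcases hq with rfl | hq
          · rfl
          · exact absurd h (hfree q hq).1
          · exact absurd h (hfree p hp).2
          · exact ih hp hq
        · rename_i σ hσ _ y hy hfree
          simp only [hσ, hy, if_neg hfree] at hq
          exact ih hp hq

theorem mem_universalStage {Z : Set ℕ} {s : ℕ} {p : List Bool × ℕ} :
    p ∈ universalStage Z s ↔ ∃ e < s, ∃ q ∈ pfMachineStage Z (Denumerable.ofNat _ e) s,
      (List.replicate e false ++ true :: q.1, q.2) = p := by
  simp [universalStage]

theorem universalStage_subset_succ (Z : Set ℕ) (s : ℕ) :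
    universalStage Z s ⊆ universalStage Z (s + 1) := by
  intro p hp
  rw [mem_universalStage] at hp ⊢
  obtain ⟨e, he, q, hq, h⟩ := hp
  exact ⟨e, by omega, q, (pfMachineStage_suffix_succ Z _ s).subset hq, h⟩

theorem replicate_append_prefix {e e' : ℕ} {σ τ : List Bool}
    (h : List.replicate e false ++ true :: σ <+: List.replicate e' false ++ true :: τ) :
    e = e' ∧ σ <+: τ := by
  induction e generalizing e' with
  | zero =>
    cases e' with
    | zero => simpa using h
    | succ e' => simp [List.replicate_succ] at h
  | succ e ih =>
    cases e' with
    | zero => simp [List.replicate_succ] at h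
    | succ e' =>
      simp only [List.replicate_succ, List.cons_append, List.cons_prefix_cons, true_and] at h
      simpa using ih h

theorem eq_of_prefix_universalStage {Z : Set ℕ} {s : ℕ} {p q : List Bool × ℕ}
    (hp : p ∈ universalStage Z s) (hq : q ∈ universalStage Z s) (h : p.1 <+: q.1) : p = q := by
  obtain ⟨e, -, p, hp', rfl⟩ := mem_universalStage.1 hp
  obtain ⟨e', -, q, hq', rfl⟩ := mem_universalStage.1 hq
  obtain ⟨rfl, h'⟩ := replicate_append_prefix h
  rw [eq_of_prefix_pfMachineStage hp' hq' h']

theorem KStage_le_of_mem {Z : Set ℕ} {s w : ℕ} {p : List Bool × ℕ} (hw : w < s)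
    (hp : p ∈ universalStage Z s) (hpw : p.2 = w) : KStage Z s w ≤ p.1.length := by
  rw [KStage, if_neg (by omega)]
  exact List.minimum_le_of_mem' (List.mem_map.2 ⟨p, by simp [hp, hpw], rfl⟩)

theorem exists_of_KStage_eq {Z : Set ℕ} {s w k : ℕ} (h : KStage Z s w = k) :
    w < s ∧ ∃ p ∈ universalStage Z s, p.2 = w ∧ p.1.length = k := by
  rw [KStage] at h
  split at h
  · exact absurd h WithTop.top_ne_coe
  · refine ⟨by omega, ?_⟩
    obtain ⟨p, hp, hpk⟩ := List.mem_map.1 (List.minimum_mem h)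
    simp only [List.mem_filter, decide_eq_true_eq] at hp
    exact ⟨p, hp.1, hp.2, hpk⟩

theorem KStage_succ_le (Z : Set ℕ) (s w : ℕ) : KStage Z (s + 1) w ≤ KStage Z s w := by
  cases h : KStage Z s w with
  | top => exact le_top
  | coe k =>
    obtain ⟨hw, p, hp, hpw, rfl⟩ := exists_of_KStage_eq h
    exact KStage_le_of_mem (by omega) (universalStage_subset_succ Z s hp) hpw

theorem twoPowNeg_top : twoPowNeg ⊤ = 0 := rfl

theorem twoPowNeg_coe (k : ℕ) : twoPowNeg (WithTop.some k) = (1 / 2) ^ k := rfl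

theorem antitone_twoPowNeg : Antitone twoPowNeg := by
  intro a b hab
  cases b with
  | top => exact zero_le
  | coe b =>
    cases a with
    | top => simp at hab
    | coe a =>
      rw [twoPowNeg_coe, twoPowNeg_coe]
      exact pow_le_pow_of_le_one (by positivity)
        (by rw [one_div]; exact inv_le_one_of_one_le₀ (by norm_num)) (by exact_mod_cast hab)

theorem nondecreasingInStage_costK (Z : Set ℕ) : NondecreasingInStage (costK Z) := by
  refine ⟨fun x s h => by simp [costK, Finset.Ioc_eq_empty_of_le h.le], fun x s => ?_⟩
  calc costK Z x s ≤ ∑ w ∈ Finset.Ioc x s, twoPowNeg (KStage Z (s + 1) w) :=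
        Finset.sum_le_sum fun w _ => antitone_twoPowNeg (KStage_succ_le Z s w)
    _ ≤ costK Z x (s + 1) := Finset.sum_le_sum_of_subset (Finset.Ioc_subset_Ioc_right (by omega))

/-! ### The limit condition -/

theorem toENNReal_sum (F : Finset ℕ) (g : ℕ → ℚ≥0) :
    toENNReal (∑ w ∈ F, g w) = ∑ w ∈ F, toENNReal (g w) := by
  simp only [toENNReal, NNRat.cast_sum, ENNReal.ofNNReal_finsetSum]

/-- Kraft's inequality. -/
theorem sum_twoPowNeg_KStage_le (Z : Set ℕ) (s : ℕ) (F : Finset ℕ) :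
    ∑ w ∈ F, toENNReal (twoPowNeg (KStage Z s w)) ≤ 1 := by
  classical
  -- The set assigned to w is the cylinder of a shortest program for w; prefix-freeness makes these
  -- sets disjoint.
  have key : ∀ w, ∃ U : Set (ℕ → Bool), MeasurableSet U ∧
      toENNReal (twoPowNeg (KStage Z s w)) = coinMeasure U ∧
      ∀ X ∈ U, ∃ p ∈ universalStage Z s, p.2 = w ∧ X ∈ cylinder p.1 := by
    intro w
    cases h : KStage Z s w with
    | top => exact ⟨∅, MeasurableSet.empty, by simp [twoPowNeg_top, toENNReal], by simp⟩
    | coe k =>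
      obtain ⟨-, p, hp, hpw, rfl⟩ := exists_of_KStage_eq h
      refine ⟨cylinder p.1, measurableSet_cylinder _, ?_, fun X hX => ⟨p, hp, hpw, hX⟩⟩
      rw [coinMeasure_cylinder, twoPowNeg_coe, toENNReal_half_pow]
  choose U hU hval hmem using key
  rw [Finset.sum_congr rfl fun w _ => hval w, ← measure_biUnion_finset _ fun w _ => hU w]
  · exact prob_le_one
  · intro w _ w' _ hne
    rw [Function.onFun, Set.disjoint_left]
    intro X hX hX'
    obtain ⟨p, hp, rfl, hp'⟩ := hmem w X hX
    obtain ⟨q, hq, rfl, hq'⟩ := hmem w' X hX'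
    rw [mem_cylinder_iff] at hp' hq'
    refine hne ?_
    rcases le_total p.1.length q.1.length with h | h
    · rw [eq_of_prefix_universalStage hp hq]
      rw [← hp', ← hq']; exact pre_prefix _ h
    · rw [eq_of_prefix_universalStage hq hp]
      rw [← hp', ← hq']; exact pre_prefix _ h

/-- The costs are dominated by tails of the series of the suprema over s of the weights, which
converges by Kraft's inequality at each stage. -/
theorem limitCondition_costK (Z : Set ℕ) : LimitCondition (costK Z) := by
  let h : ℕ → ENNReal := fun w => ⨆ s, toENNReal (twoPowNeg (KStage Z s w))
  have hmono : ∀ w, Monotone fun s => toENNReal (twoPowNeg (KStage Z s w)) := fun w =>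
    monotone_nat_of_le_succ fun s => toENNReal_le.2 (antitone_twoPowNeg (KStage_succ_le Z s w))
  have hsum : ∑' w, h w ≠ ⊤ := by
    refine ne_top_of_le_ne_top ENNReal.one_ne_top ?_
    rw [ENNReal.tsum_eq_iSup_sum]
    refine iSup_le fun F => ?_
    rw [ENNReal.finsetSum_iSup_of_monotone hmono]
    exact iSup_le fun s => sum_twoPowNeg_KStage_le Z s F
  refine tendsto_of_tendsto_of_tendsto_of_le_of_le tendsto_const_nhds
    (ENNReal.tendsto_sum_nat_add h hsum) (fun _ => zero_le) fun x => ?_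
  refine (liminf_le_liminf (v := fun _ => ∑' k, h (k + x)) (Eventually.of_forall fun s => ?_)
    (by isBoundedDefault) (by isBoundedDefault)).trans_eq (liminf_const _)
  calc toENNReal (costK Z x s) = ∑ w ∈ Finset.Ioc x s, toENNReal (twoPowNeg (KStage Z s w)) :=
        toENNReal_sum _ _
    _ ≤ ∑ w ∈ Finset.Ioc x s, h w :=
        Finset.sum_le_sum fun w _ => le_iSup (fun s => toENNReal (twoPowNeg (KStage Z s w))) s
    _ ≤ ∑ w ∈ Finset.Ico x (s + 1), h w := Finset.sum_le_sum_of_subset fun w hw => by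
        simp only [Finset.mem_Ioc, Finset.mem_Ico] at hw ⊢; omega
    _ = ∑ k ∈ Finset.range (s + 1 - x), h (k + x) := by
        rw [Finset.sum_Ico_eq_sum_range]; simp only [add_comm]
    _ ≤ ∑' k, h (k + x) := ENNReal.sum_le_tsum _

/-! ### The cost functional for `K`-triviality is a Turing functional -/

/-- A functional that is computed by a search through the initial segments of the oracle. -/
theorem exists_functional {F : List Bool → ℕ → Option ℕ}
    (hF : Primrec fun q : List Bool × ℕ => F q.1 q.2) :
    ∃ e, ∀ (Z : Set ℕ) y v, (∀ l w, F (restr Z l) y = some w → w = v) →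
      (∃ l, F (restr Z l) y = some v) → functional e Z y = Part.some v := by
  have h1 : Partrec fun n : ℕ => (((Encodable.decode n : Option (List Bool × ℕ)).bind
      fun q => F q.1 q.2 : Option ℕ) : Part ℕ) := by
    refine Computable.ofOption (Primrec.to_comp ?_)
    fun_prop
  obtain ⟨e, he⟩ := Nat.Partrec.Code.exists_code.1 (Partrec.nat_iff.1 h1)
  have hev : ∀ σ y w, w ∈ e.eval (Encodable.encode (σ, y)) ↔ F σ y = some w := by
    intro σ y w
    rw [he]
    simp
  have hatt : ∀ Z y m w, attempt e Z y m = some w → F (restr Z m.unpair.2) y = some w :=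
    fun Z y m w h => (hev _ _ _).1 (Nat.Partrec.Code.evaln_sound h)
  refine ⟨e, fun Z y v hval ⟨l, hl⟩ => ?_⟩
  obtain ⟨k, hk⟩ := Nat.Partrec.Code.evaln_complete.1 ((hev _ _ _).2 hl)
  have hdom : (functional e Z y).Dom := Nat.rfindOpt_dom.2 ⟨Nat.pair k l, v, by
    simpa [attempt] using hk⟩
  obtain ⟨m, hm⟩ := Nat.rfindOpt_spec (Part.get_mem hdom)
  rw [← Part.some_get hdom, hval _ _ (hatt Z y m _ hm)]

/-- One stage of the enumeration of a prefix-free machine. -/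
def pfStep (e : Nat.Partrec.Code) (σ : List Bool) (s : ℕ) (L : List (List Bool × ℕ)) :
    List (List Bool × ℕ) :=
  (Encodable.decode s.unpair.1 : Option (List Bool)).elim L fun τ =>
    (stringStage e σ (Encodable.encode τ) s).elim L fun y =>
      bif L.all fun p => !(τ == p.1.take τ.length) && !(p.1 == τ.take p.1.length) then (τ, y) :: L
      else L

/-- `pfMachineStage`, with a string as the oracle. -/
def pfString (e : Nat.Partrec.Code) (σ : List Bool) (s : ℕ) : List (List Bool × ℕ) :=
  s.rec [] fun s L => pfStep e σ s L

@[fun_prop]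
theorem primrec_pfString {α : Type*} [Primcodable α] {e : α → Nat.Partrec.Code}
    {σ : α → List Bool} {s : α → ℕ} (he : Primrec e) (hσ : Primrec σ) (hs : Primrec s) :
    Primrec fun a => pfString (e a) (σ a) (s a) := by
  unfold pfString
  refine Primrec.nat_rec' (h := fun a p => pfStep (e a) (σ a) p.1 p.2) hs (by fun_prop) ?_
  change Primrec fun q : α × ℕ × List (List Bool × ℕ) => pfStep (e q.1) (σ q.1) q.2.1 q.2.2
  unfold pfStep
  fun_prop

theorem pfString_restr {e : Nat.Partrec.Code} {Z : Set ℕ} {s l : ℕ} (h : s ≤ l + 1) :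
    pfString e (restr Z l) s = pfMachineStage Z e s := by
  induction s with
  | zero => rfl
  | succ s ih =>
    have : pfString e (restr Z l) (s + 1) = pfStep e (restr Z l) s (pfString e (restr Z l) s) := rfl
    rw [this, ih (by omega), pfMachineStage, pfStep]
    cases (Encodable.decode s.unpair.1 : Option (List Bool)) with
    | none => rfl
    | some τ =>
      simp only [Option.elim_some, stringStage_restr (show s ≤ l by omega)]
      cases functionalStage e Z (Encodable.encode τ) s with
      | none => rfl
      | some y =>
        simp only [Option.elim_some, Bool.cond_eq_ite, List.all_eq_true, Bool.and_eq_true,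
          Bool.not_eq_true', beq_eq_false_iff_ne, List.prefix_iff_eq_take, ne_eq]

/-- `universalStage`, with a string as the oracle. -/
def universalString (σ : List Bool) (s : ℕ) : List (List Bool × ℕ) :=
  (List.range s).flatMap fun e => (pfString (Denumerable.ofNat Nat.Partrec.Code e) σ s).map fun p =>
    ((List.range e).map (fun _ => false) ++ true :: p.1, p.2)

@[fun_prop]
theorem primrec_universalString {α : Type*} [Primcodable α] {σ : α → List Bool} {s : α → ℕ}
    (hσ : Primrec σ) (hs : Primrec s) : Primrec fun a => universalString (σ a) (s a) := by
  unfold universalString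
  fun_prop

theorem universalString_restr {Z : Set ℕ} {s l : ℕ} (h : s ≤ l + 1) :
    universalString (restr Z l) s = universalStage Z s := by
  simp [universalString, universalStage, pfString_restr h]

/-! ### The cost as a fraction in lowest terms -/

/-- A bound on the lengths of the programs in `L`. -/
def lengthBound (L : List (List Bool × ℕ)) : ℕ := L.foldr (fun p n => p.1.length + n) 0

/-- The largest `2^{N-k}` such that `k` is the length of a program for `w` in `L`. -/
def weight (L : List (List Bool × ℕ)) (N w : ℕ) : ℕ :=
  L.foldr (fun p n => bif p.2 == w then max (2 ^ (N - p.1.length)) n else n) 0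

@[fun_prop]
theorem primrec_lengthBound {α : Type*} [Primcodable α] {L : α → List (List Bool × ℕ)}
    (hL : Primrec L) : Primrec fun a => lengthBound (L a) := by
  unfold lengthBound; fun_prop

@[fun_prop]
theorem primrec_weight {α : Type*} [Primcodable α] {L : α → List (List Bool × ℕ)} {N w : α → ℕ}
    (hL : Primrec L) (hN : Primrec N) (hw : Primrec w) :
    Primrec fun a => weight (L a) (N a) (w a) := by
  unfold weight; fun_prop

theorem length_le_lengthBound {L : List (List Bool × ℕ)} {p : List Bool × ℕ} (h : p ∈ L) :
    p.1.length ≤ lengthBound L := by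
  induction L with
  | nil => simp at h
  | cons q L ih =>
    rw [lengthBound, List.foldr_cons]
    rcases List.mem_cons.1 h with rfl | h
    · omega
    · have := ih h
      rw [lengthBound] at this
      omega

/-- Over a common denominator the shortest program corresponds to the largest numerator, so natural
number arithmetic suffices. -/
theorem twoPowNeg_minimum {L : List (List Bool × ℕ)} {N : ℕ} (hN : ∀ p ∈ L, p.1.length ≤ N)
    (w : ℕ) : twoPowNeg ((L.filter fun p => p.2 = w).map fun p => p.1.length).minimum =
      (weight L N w : ℚ≥0) / 2 ^ N := by
  induction L with
  | nil => simp [weight, twoPowNeg_top]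
  | cons q L ih =>
    specialize ih fun p hp => hN p (List.mem_cons_of_mem _ hp)
    rw [weight, List.foldr_cons, ← weight]
    by_cases hq : q.2 = w
    · have h2 : twoPowNeg (WithTop.some q.1.length) = (2 ^ (N - q.1.length) : ℕ) / 2 ^ N := by
        have hl := hN q List.mem_cons_self
        rw [twoPowNeg_coe, eq_div_iff (by positivity)]
        push_cast
        conv_lhs => rw [← Nat.sub_add_cancel hl, pow_add]
        rw [mul_left_comm, ← mul_pow]
        simp
      simp only [hq, decide_true, List.filter_cons_of_pos, List.map_cons, List.minimum_cons,
        antitone_twoPowNeg.map_min, ih, h2, beq_self_eq_true, cond_true, Nat.cast_max]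
      rw [max_div_div_right (by positivity : (0 : ℚ≥0) ≤ 2 ^ N)]
    · have : (q.2 == w) = false := by simpa using hq
      simp [hq, this, ih]

/-- The numerator of the cost, over the denominator `2 ^ lengthBound L`. -/
def costNum (L : List (List Bool × ℕ)) (x s : ℕ) : ℕ :=
  (List.range s).foldr (fun w n => (bif Nat.blt x w then weight L (lengthBound L) w else 0) + n) 0

@[fun_prop]
theorem primrec_costNum {α : Type*} [Primcodable α] {L : α → List (List Bool × ℕ)} {x s : α → ℕ}
    (hL : Primrec L) (hx : Primrec x) (hs : Primrec s) :
    Primrec fun a => costNum (L a) (x a) (s a) := by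
  unfold costNum; fun_prop

theorem costK_eq (Z : Set ℕ) (x s : ℕ) : costK Z x s =
    (costNum (universalStage Z s) x s : ℚ≥0) / 2 ^ lengthBound (universalStage Z s) := by
  have h1 : costNum (universalStage Z s) x s = ∑ w ∈ Finset.range s,
      if x < w then weight (universalStage Z s) (lengthBound (universalStage Z s)) w else 0 := by
    rw [costNum]
    rw [← List.toFinset_range, List.sum_toFinset _ List.nodup_range]
    induction List.range s with
    | nil => rfl
    | cons w L ih =>
      rw [List.foldr_cons, List.map_cons, List.sum_cons, ih]
      by_cases h : x < w
      · have : Nat.blt x w = true := by simpa using h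
        simp [h, this]
      · have : Nat.blt x w = false := by simpa [← Bool.not_eq_true] using h
        simp [h, this]
  rw [h1, costK, Nat.cast_sum, Finset.sum_div]
  have h2 : ∀ w ∈ Finset.range s, ((if x < w then weight (universalStage Z s)
      (lengthBound (universalStage Z s)) w else 0 : ℕ) : ℚ≥0) /
        2 ^ lengthBound (universalStage Z s) =
      if x < w then twoPowNeg (KStage Z s w) else 0 := by
    intro w hw
    rw [Finset.mem_range] at hw
    split
    · rw [KStage, if_neg (by omega), twoPowNeg_minimum fun p => length_le_lengthBound]
    · simp
  rw [Finset.sum_congr rfl h2, ← Finset.sum_filter]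
  -- The only index missing from the first sum is w = s, whose complexity at stage s is infinite.
  refine (Finset.sum_subset (fun w hw => ?_) fun w hw hw' => ?_).symm
  · simp only [Finset.mem_filter, Finset.mem_range, Finset.mem_Ioc] at hw ⊢
    omega
  · simp only [Finset.mem_filter, Finset.mem_range, Finset.mem_Ioc] at hw hw'
    rw [KStage, if_pos (by omega), twoPowNeg_top]

/-- The fraction `a / b` in lowest terms, as a pair. -/
def reduced (a b : ℕ) : Option ℕ := (List.range (b + 1)).findSome? fun d =>
  bif Nat.blt 0 d && (a * d % b == 0) then some (Nat.pair (a * d / b) d) else none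

@[fun_prop]
theorem primrec_reduced {α : Type*} [Primcodable α] {a b : α → ℕ} (ha : Primrec a)
    (hb : Primrec b) : Primrec fun x => reduced (a x) (b x) := by
  unfold reduced; fun_prop

/-- The reduced denominator is the least d > 0 with b ∣ a d, by coprimality. -/
theorem reduced_eq {q : ℚ≥0} {a b : ℕ} (hb : 0 < b) (hq : q = a / b) :
    reduced a b = some (Nat.pair q.num q.den) := by
  have hb' : (b : ℚ≥0) ≠ 0 := by exact_mod_cast hb.ne'
  have hd' : (q.den : ℚ≥0) ≠ 0 := by exact_mod_cast q.den_ne_zero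
  have h1 : a * q.den = b * q.num := by
    have h := NNRat.num_div_den q
    nth_rw 3 [hq] at h
    rw [div_eq_div_iff hd' hb'] at h
    have : q.num * b = a * q.den := by exact_mod_cast h
    rw [← this, mul_comm]
  have hmin : ∀ d, 0 < d → b ∣ a * d → q.den ≤ d := by
    intro d hd ⟨n, hn⟩
    refine Nat.le_of_dvd hd ((NNRat.coprime_num_den q).symm.dvd_of_dvd_mul_left (k := q.den) ?_)
    refine ⟨n, Nat.eq_of_mul_eq_mul_left hb ?_⟩
    rw [← mul_assoc, ← h1, mul_right_comm, hn]; ring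
  refine findSome?_range_eq_some.2 ⟨q.den, ?_, ?_, fun k hk => ?_⟩
  · exact Nat.lt_succ_of_le (hmin b hb (dvd_mul_left _ _))
  · have : Nat.blt 0 q.den = true := by simp
    simp [this, h1, Nat.mul_div_cancel_left _ hb]
  · by_contra h
    have h' : 0 < k ∧ a * k % b = 0 := by
      rcases h2 : (Nat.blt 0 k && (a * k % b == 0)) with _ | _
      · simp [h2] at h
      · simpa using h2
    exact absurd (hmin k h'.1 (Nat.dvd_of_mod_eq_zero h'.2)) (by omega)

theorem isTotalCostFunctional_costK : IsTotalCostFunctional costK := by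
  -- Strings shorter than the stage give no answer; all longer ones give the same, correct one.
  let F : List Bool → ℕ → Option ℕ := fun σ y => bif Nat.ble y.unpair.2 σ.length then
    reduced (costNum (universalString σ y.unpair.2) y.unpair.1 y.unpair.2)
      (2 ^ lengthBound (universalString σ y.unpair.2)) else none
  have hF : Primrec fun q : List Bool × ℕ => F q.1 q.2 := by
    unfold F; fun_prop
  have hval : ∀ Z l x t, t ≤ l → F (restr Z l) (Nat.pair x t) =
      some (Nat.pair (costK Z x t).num (costK Z x t).den) := by
    intro Z l x t h
    have : Nat.ble t l = true := by simpa using h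
    simp only [F, Nat.unpair_pair, length_restr, this, cond_true,
      universalString_restr (h.trans (Nat.le_succ l))]
    exact reduced_eq (by positivity) (by rw [costK_eq]; push_cast; rfl)
  obtain ⟨e, he⟩ := exists_functional hF
  refine ⟨e, fun Z x t => he Z _ _ (fun l w hw => ?_) ⟨t, hval Z t x t le_rfl⟩⟩
  by_cases h : t ≤ l
  · rw [hval Z l x t h] at hw
    exact (Option.some.inj hw).symm
  · have : Nat.ble t l = false := by simpa [← Bool.not_eq_true] using h
    simp [F, this] at hw

end CostFn
theorem mainTheorem9 :
    (∀ c : Set ℕ → ℕ → ℕ → ℚ≥0,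
      CostFn.IsTotalCostFunctional c →
      (∀ Z, CostFn.NondecreasingInStage (c Z)) →
      (∀ Z, CostFn.LimitCondition (c Z)) →
      ∃ D : Set ℕ, CostFn.CE D ∧ ¬ CostFn.TuringLE CostFn.halting D ∧
        CostFn.Obeys D (c D) CostFn.halting) ∧
    (CostFn.IsTotalCostFunctional CostFn.costK ∧
      (∀ Z, CostFn.NondecreasingInStage (CostFn.costK Z)) ∧
      (∀ Z, CostFn.LimitCondition (CostFn.costK Z)) ∧
      ∃ D : Set ℕ, CostFn.CE D ∧ ¬ CostFn.TuringLE CostFn.halting D ∧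
        CostFn.Obeys D (CostFn.costK D) CostFn.halting ∧
        CostFn.LRComplete D) := by
  refine ⟨fun c hc hmono hlim => ?_, ?_⟩
  · obtain ⟨D, h1, h2, h3, -⟩ := CostFn.exists_ce_incomplete_obeys hc hmono hlim
    exact ⟨D, h1, h2, h3⟩
  · have hmono := CostFn.nondecreasingInStage_costK
    have hlim := CostFn.limitCondition_costK
    exact ⟨CostFn.isTotalCostFunctional_costK, hmono, hlim,
      CostFn.exists_ce_incomplete_obeys CostFn.isTotalCostFunctional_costK hmono hlim⟩
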